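/- Let $\pi:Y\to X$ be a fibered manifold (a smooth surjective submersion) with $\dim X=n\ge 1$ and $\dim Y=n+m$, let $\rho$ be a smooth $n$-form on $J^rY$, and let $\Xi_1,\Xi_2$ be smooth $\pi$-projectable vector fields on $Y$. Fix a fibered chart $(x^i,y^\sigma)$ with induced jet coordinates $y^\sigma_I$, and put $ds=dx^1\wedge\dots\wedge dx^n$, $ds_j=\frac{\partial}{\partial x^j}\rfloor ds$, $\omega^\sigma_I=dy^\sigma_I-y^\sigma_{Ii}dx^i$. Notation. For a form $\rho$ on $J^kY$, $h\rho$ and $p_1\rho$ are its horizontal and $1$-contact components on $J^{k+1}Y$. The formal derivative $d_i$ acts on forms, commutes with $d$, obeys the Leibniz rule, is the total derivative on functions, and satisfies $d_i dx^j=0$, $d_i dy^\sigma_I=dy^\sigma_{Ii}$; $d_I$ is its iterate, and $d_H\theta=(-1)^q d_i\theta\wedge dx^i$ for a $q$-form $\theta$. Sums over multi-indices run over all ordered tuples $I$, where $\frac{\partial}{\partial y^\sigma_I}$ stands for the coordinate vector field multiplied by $I!/|I|!$, $I!$ being the product of the factorials of the multiplicities of the entries of $I$. For an $(n+1)$-form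 $\beta$ on $J^sY$ let $$\mathcal I(\beta)=\omega^\sigma\wedge\sum_{|I|\le s}(-1)^{|I|}d_I\Big(\frac{\partial}{\partial y^\sigma_I}\rfloor p_1\beta\Big)\ \text{ on } J^{2s+1}Y,\qquad \mathcal R(\beta)=-\sum_{|I|\le s-1}d_I\chi^{Ij}\wedge ds_j\ \text{ on } J^{2s}Y,$$ where $\chi^I\wedge ds=\omega^\sigma\wedge\zeta^I_\sigma$, $\zeta^I_\sigma=\sum_{|J|\le s-|I|}(-1)^{|J|}\binom{|I|+|J|}{|J|}d_J\eta^{JI}_\sigma$ and $\eta^I_\sigma=\frac{\partial}{\partial y^\sigma_I}\rfloor p_1\beta$. For an $n$-form $\rho$ on $J^sY$ put $E_n(h\rho)=\mathcal I(d\rho)$, on $J^{2s+1}Y$; for a horizontal $n$-form $\lambda$ (where $h\lambda=\lambda$ up to pull-back) put $E_n(\lambda)=\mathcal I(d\lambda)$ and $p_{d_V\lambda}=-p_1\mathcal R(d\lambda)$. For a projectable field $\Xi=\xi^i\frac{\partial}{\partial x^i}+\xi^\sigma\frac{\partial}{\partial y^\sigma}$, $J^k\Xi$ is its prolongation, with components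 $\xi^i$ and $\Xi^\sigma_I$, where $\Xi^\sigma_\emptyset=\xi^\sigma$ and $\Xi^\sigma_{Ij}=d_j\Xi^\sigma_I-y^\sigma_{Ii}\frac{\partial \xi^i}{\partial x^j}$; further $\Xi_H=\xi^i d_i$, $J^k\Xi_V=\sum_{|I|\le k}(\Xi^\sigma_I-y^\sigma_{Ii}\xi^i)\frac{\partial}{\partial y^\sigma_I}$ (sum over unordered $I$), $\Xi_V=J^0\Xi_V$, and the current with prolongation up to order $k$ is $$\epsilon^{(k)}_\Xi(\lambda)=J^k\Xi_V\rfloor p_{d_V\lambda}+\Xi_H\rfloor\lambda .$$ Theorem. The form $d_H\epsilon^{(r+1)}_{\Xi_1}(h\rho)$ is the pull-back of a smooth $n$-form on the part of $J^{2r+1}Y$ over the chart domain (denoted by the same symbol), and for every $k$ with $r+1\le k\le 2r+1$ (in particular for $k=r+1$), on the part of $J^{4r+3}Y$ over the chart domain, $$(\pi_{4r+3,r+1})^*\big(L_{J^{r+1}\Xi_2}L_{J^{r+1}\Xi_1}h\rho\big)=\Xi_{2,V}\rfloor E_n\big(\Xi_{1,V}\rfloor E_n(h\rho)\big)+d_H\epsilon^{(k)}_{\Xi_2}\big(\Xi_{1,V}\rfloor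 E_n(h\rho)\big)+d_H\epsilon^{(k)}_{\Xi_2}\big(d_H\epsilon^{(r+1)}_{\Xi_1}(h\rho)\big),$$ where $$\epsilon^{(k)}_{\Xi_2}\big(\Xi_{1,V}\rfloor E_n(h\rho)\big)=\Xi_{2,H}\rfloor\Xi_{1,V}\rfloor E_n(h\rho)+J^{k}\Xi_{2,V}\rfloor p_{d_V(\Xi_{1,V}\rfloor E_n(h\rho))},$$ $$\epsilon^{(k)}_{\Xi_2}\big(d_H\epsilon^{(r+1)}_{\Xi_1}(h\rho)\big)=\Xi_{2,H}\rfloor d_H\big(J^{r+1}\Xi_{1,V}\rfloor p_{d_Vh\rho}+\Xi_{1,H}\rfloor h\rho\big)+J^{k}\Xi_{2,V}\rfloor p_{d_Vd_H(J^{r+1}\Xi_{1,V}\rfloor p_{d_Vh\rho}+\Xi_{1,H}\rfloor h\rho)} .$$ -/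

import Mathlib

open scoped Manifold ContDiff Topology

noncomputable section

namespace SecondVariation

/-! ### Coordinates on jet spaces

The base has dimension `n`, the fibres have dimension `m`.  A multi-index is an unordered tuple of
elements of `Fin n`, that is, a `Multiset (Fin n)`; its length is its cardinality. -/

/-- Multi-indices of length at most `k`. -/
abbrev MIdx (n k : ℕ) : Type := {I : Multiset (Fin n) // I.card ≤ k}

instance instFiniteMIdx (n k : ℕ) : Finite (MIdx n k) := by
  have hfin : Finite {l : List (Fin n) // l.length ≤ k} := List.finite_length_le (Fin n) k
  refine Finite.of_surjective
    (fun l : {l : List (Fin n) // l.length ≤ k} =>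
      (⟨(l.1 : Multiset (Fin n)), by simpa using l.2⟩ : MIdx n k)) ?_
  rintro ⟨I, hI⟩
  induction I using Quotient.inductionOn with
  | h l => exact ⟨⟨l, by simpa using hI⟩, rfl⟩

instance instFintypeMIdx (n k : ℕ) : Fintype (MIdx n k) := Fintype.ofFinite _

/-- The coordinate space of `k`-jets: points `(x^i, y^σ_I)` with `|I| ≤ k`. -/
abbrev JetC (n m k : ℕ) : Type := (Fin n → ℝ) × (Fin m → MIdx n k → ℝ)

/-- The coordinate space of the total space: points `(x^i, y^σ)`. -/
abbrev TotC (n m : ℕ) : Type := (Fin n → ℝ) × (Fin m → ℝ)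

/-- Differential forms of degree `q` in the coordinates of `k`-jets. -/
abbrev Form (n m k q : ℕ) : Type := JetC n m k → (JetC n m k) [⋀^Fin q]→L[ℝ] ℝ

section Coordinates

variable {n m : ℕ}

/-- The coordinate function `y^σ_I` on `k`-jets; being linear, it is also the `1`-form `dy^σ_I`.
It is `0` if `|I| > k`. -/
def dy (k : ℕ) (σ : Fin m) (I : Multiset (Fin n)) : JetC n m k →L[ℝ] ℝ :=
  if h : I.card ≤ k then
    (ContinuousLinearMap.proj (R := ℝ) (φ := fun _ : MIdx n k => ℝ) ⟨I, h⟩).comp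
      ((ContinuousLinearMap.proj (R := ℝ) (φ := fun _ : Fin m => MIdx n k → ℝ) σ).comp
        (ContinuousLinearMap.snd ℝ (Fin n → ℝ) (Fin m → MIdx n k → ℝ)))
  else 0

/-- The `1`-form `dx^i`. -/
def dx (k : ℕ) (i : Fin n) : JetC n m k →L[ℝ] ℝ :=
  (ContinuousLinearMap.proj (R := ℝ) (φ := fun _ : Fin n => ℝ) i).comp
    (ContinuousLinearMap.fst ℝ (Fin n → ℝ) (Fin m → MIdx n k → ℝ))

/-- The projection `π_{K,k}` in coordinates (used for `k ≤ K` only). -/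
def jetProj (K k : ℕ) : JetC n m K →L[ℝ] JetC n m k :=
  (ContinuousLinearMap.fst ℝ (Fin n → ℝ) (Fin m → MIdx n K → ℝ)).prod
    (ContinuousLinearMap.pi fun σ => ContinuousLinearMap.pi fun I => dy K σ I.1)

/-- The projection of `k`-jets to the total space. -/
def toTot {k : ℕ} (u : JetC n m k) : TotC n m := (u.1, fun σ => dy k σ 0 u)

/-- The `k`-jets over an open set `W` of the total space. -/
def jetDomain (W : Set (TotC n m)) (k : ℕ) : Set (JetC n m k) := {u | toTot u ∈ W}

/-- Pull-back of forms by `π_{K,k}` (used for `k ≤ K` only). -/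
def pull {k q : ℕ} (K : ℕ) (θ : Form n m k q) : Form n m K q := fun u =>
  (θ (jetProj K k u)).compContinuousLinearMap (jetProj K k)

/-- The coordinate vector `∂/∂x^i`. -/
def partialX (k : ℕ) (i : Fin n) : JetC n m k := (Pi.single i 1, 0)

open Classical in
/-- The coordinate vector `∂/∂y^σ_I`. -/
def partialY (k : ℕ) (σ : Fin m) (I : Multiset (Fin n)) : JetC n m k :=
  (0, Pi.single σ fun J => if J.1 = I then 1 else 0)

/-- The total derivative
`d_i = ∂/∂x^i + ∑ y^σ_{Ii} ∂/∂y^σ_I`, a vector field on `k`-jets along `π_{K,k}`, for `k < K`.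
(For `K = k` the components of top order `k`, which do not make sense on `k`-jets, are set to `0`;
such a vector may only be inserted in forms that are pulled back from jets of order `< k`.) -/
def totalVec (K k : ℕ) (i : Fin n) (u : JetC n m K) : JetC n m k :=
  (Pi.single i 1, fun σ I => dy K σ (i ::ₘ I.1) u)

/-- The contact form `ω^σ_I = dy^σ_I - y^σ_{Ii} dx^i`, where `|I| < k`. -/
def contactForm (k : ℕ) (σ : Fin m) (I : Multiset (Fin n)) (u : JetC n m k) :
    JetC n m k →L[ℝ] ℝ :=
  dy k σ I - ∑ i, dy k σ (i ::ₘ I) u • dx k i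

/-- The wedge product `α ∧ θ` of a covector and an alternating form. -/
def wedgeOne {k q : ℕ} (α : JetC n m k →L[ℝ] ℝ) (θ : (JetC n m k) [⋀^Fin q]→L[ℝ] ℝ) :
    (JetC n m k) [⋀^Fin (q + 1)]→L[ℝ] ℝ :=
  ContinuousAlternatingMap.alternatizeUncurryFin (α.smulRight θ)

/-- The interior product `X ⌋ θ`. -/
def contract {k q : ℕ} (X : JetC n m k → JetC n m k) (θ : Form n m k (q + 1)) : Form n m k q :=
  fun u => (θ u).curryLeft (X u)

/-- The Lie derivative `L_X θ = X ⌋ dθ + d (X ⌋ θ)` of a form of positive degree. -/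
def lieDeriv {k q : ℕ} (X : JetC n m k → JetC n m k) (θ : Form n m k (q + 1)) :
    Form n m k (q + 1) := fun u =>
  contract X (fun v => extDeriv θ v) u + extDeriv (contract X θ) u

/-! ### Contact decomposition -/

/-- The horizontal projection `h : T J^{k+1} → T J^k`, `Φ ↦ dx^i(Φ) d_i`. -/
def hMap (k : ℕ) (u : JetC n m (k + 1)) : JetC n m (k + 1) →L[ℝ] JetC n m k :=
  ∑ i, (dx (k + 1) i).smulRight (totalVec (k + 1) k i u)

/-- The complementary projection `p Φ = T π_{k+1,k} Φ - h Φ`. -/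
def pMap (k : ℕ) (u : JetC n m (k + 1)) : JetC n m (k + 1) →L[ℝ] JetC n m k :=
  jetProj (k + 1) k - hMap k u

/-- The horizontal component `hρ = p_0 ρ`: `(hρ)(Φ_1, …, Φ_q) = ρ(hΦ_1, …, hΦ_q)`. -/
def horizontal {k q : ℕ} (ρ : Form n m k q) : Form n m (k + 1) q := fun u =>
  (ρ (jetProj (k + 1) k u)).compContinuousLinearMap (hMap k u)

/-- The 1-contact component:
`(p_1 ρ)(Φ_0, …, Φ_q) = ∑_a (-1)^a ρ(pΦ_a, hΦ_0, …, (no Φ_a), …, hΦ_q)`. -/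
def contactOne {k q : ℕ} (ρ : Form n m k (q + 1)) : Form n m (k + 1) (q + 1) := fun u =>
  ContinuousAlternatingMap.alternatizeUncurryFin
    ((ContinuousAlternatingMap.compContinuousLinearMapCLM (hMap k u)).comp
      (((ρ (jetProj (k + 1) k u)).curryLeft).comp (pMap k u)))

/-- The formal derivative `d_i` of forms, from `k`-jets to `(k+1)`-jets: the Lie derivative along
the total derivative vector field `d_i` along `π = π_{k+1,k}`, namely the derivative at `t = 0` of
the pull-backs of `θ` by the maps `π + t d_i`.  On functions it is the total derivative; it commutes
with `d`, satisfies the Leibniz rule for `∧`, and `d_i dx^j = 0`, `d_i dy^σ_I = dy^σ_{Ii}`. -/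
def formalD {k q : ℕ} (i : Fin n) (θ : Form n m k q) : Form n m (k + 1) q := fun u =>
  deriv (fun t : ℝ =>
    (θ (jetProj (k + 1) k u + t • totalVec (k + 1) k i u)).compContinuousLinearMap
      (jetProj (k + 1) k + t • fderiv ℝ (totalVec (k + 1) k i) u)) 0

/-- The iterated formal derivative `d_I` for an ordered tuple `I` of length `l`. -/
def formalDs {k q : ℕ} : (l : ℕ) → (Fin l → Fin n) → Form n m k q → Form n m (k + l) q
  | 0, _, θ => θ
  | l + 1, I, θ => formalD (I (Fin.last l)) (formalDs l (fun a => I a.castSucc) θ)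

/-- The horizontal differential `d_H θ = (-1)^q d_i θ ∧ dx^i = dx^i ∧ d_i θ` of a `q`-form. -/
def dH {k q : ℕ} (θ : Form n m k q) : Form n m (k + 1) (q + 1) := fun u =>
  ∑ i, wedgeOne (dx (k + 1) i) (formalD i θ u)

/-! ### Prolongation of projectable vector fields

A vector field `Ξ = ξ^i ∂/∂x^i + ξ^σ ∂/∂y^σ` is given by its components, a map `TotC n m → TotC n m`;
in the projectable case `ξ^i` depends on `x` only. -/

/-- The components of the prolongation of `Ξ`: `Ξ^σ_∅ = ξ^σ` and
`Ξ^σ_{Ij} = d_j Ξ^σ_I - y^σ_{Ii} ∂ξ^i/∂x^j`. -/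
def prolComp (Ξ : TotC n m → TotC n m) (σ : Fin m) : (L : List (Fin n)) → JetC n m L.length → ℝ
  | [] => fun u => (Ξ (toTot u)).2 σ
  | j :: L => fun u =>
      fderiv ℝ (prolComp Ξ σ L) (jetProj (L.length + 1) L.length u)
          (totalVec (L.length + 1) L.length j u)
        - ∑ i, dy (L.length + 1) σ (i ::ₘ (L : Multiset (Fin n))) u
            * (fderiv ℝ Ξ (toTot u) (Pi.single j 1, 0)).1 i

/-- The component `Ξ^σ_I` as a function on `K`-jets, `|I| ≤ K`. -/
def prolCoeff (K : ℕ) (Ξ : TotC n m → TotC n m) (σ : Fin m) (I : Multiset (Fin n))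
    (u : JetC n m K) : ℝ :=
  prolComp Ξ σ (I.sort (· ≥ ·)) (jetProj K (I.sort (· ≥ ·)).length u)

/-- The prolongation `J^k Ξ`. -/
def prolong (k : ℕ) (Ξ : TotC n m → TotC n m) : JetC n m k → JetC n m k := fun u =>
  ((Ξ (toTot u)).1, fun σ I => prolCoeff k Ξ σ I.1 u)

/-- The vertical part `J^kΞ_V = ∑_{|I| ≤ k} (Ξ^σ_I - y^σ_{Ii} ξ^i) ∂/∂y^σ_I` of `J^k Ξ`, considered
on `K`-jets, where `K > k`. -/
def vertPart (K k : ℕ) (Ξ : TotC n m → TotC n m) : JetC n m K → JetC n m K := fun u =>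
  (0, fun σ I =>
    if I.1.card ≤ k then
      prolCoeff K Ξ σ I.1 u - ∑ i, dy K σ (i ::ₘ I.1) u * (Ξ (toTot u)).1 i
    else 0)

/-- The horizontal part `Ξ_H = ξ^i d_i`, considered on `K`-jets
(to be inserted in forms pulled back from jets of order `< K`). -/
def horPart (K : ℕ) (Ξ : TotC n m → TotC n m) : JetC n m K → JetC n m K := fun u =>
  ∑ i, (Ξ (toTot u)).1 i • totalVec K K i u

end Coordinates

/-! ### The interior Euler operator and the residual operator

From here on the base has dimension `n + 1`, so that Lagrangians are `(n+1)`-forms.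

Sums over multi-indices run over all ordered tuples `I : Fin l → Fin (n+1)`.  As usual, this is
compensated by the factor `I! / |I|!` in front of `∂/∂y^σ_I`, the inverse of the number of
distinct rearrangements of the tuple. -/

section Euler

variable {n m : ℕ}

/-- The multi-index underlying an ordered tuple. -/
def tupleIdx {d l : ℕ} (I : Fin l → Fin d) : Multiset (Fin d) := (List.ofFn I : Multiset (Fin d))

/-- The factor `I! / |I|!`. -/
def idxWeight {d : ℕ} (I : Multiset (Fin d)) : ℝ :=
  (∏ i, ((I.count i).factorial : ℝ)) / (I.card.factorial : ℝ)

/-- The volume element `ds = dx^1 ∧ ⋯ ∧ dx^{n+1}`. -/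
def volForm (k : ℕ) : (JetC (n + 1) m k) [⋀^Fin (n + 1)]→L[ℝ] ℝ :=
  ContinuousAlternatingMap.compContinuousLinearMap
    ({ (Matrix.detRowAlternating : (Fin (n + 1) → ℝ) [⋀^Fin (n + 1)]→ₗ[ℝ] ℝ) with
        cont := Continuous.matrix_det continuous_id } :
      (Fin (n + 1) → ℝ) [⋀^Fin (n + 1)]→L[ℝ] ℝ)
    (ContinuousLinearMap.fst ℝ (Fin (n + 1) → ℝ) (Fin m → MIdx (n + 1) k → ℝ))

/-- `ds_j = ∂/∂x^j ⌋ ds`. -/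
def volFormContr (k : ℕ) (j : Fin (n + 1)) : (JetC (n + 1) m k) [⋀^Fin n]→L[ℝ] ℝ :=
  (volForm k).curryLeft (partialX k j)

/-- The forms `η^I_σ` with `p_1 ρ = ∑_I ω^σ_I ∧ η^I_σ`, the sum being over all ordered tuples:
`η^I_σ = (I! / |I|!) ∂/∂y^σ_I ⌋ p_1 ρ`. -/
def etaForm {s : ℕ} (ρ : Form (n + 1) m s (n + 2)) (σ : Fin m) (I : Multiset (Fin (n + 1))) :
    Form (n + 1) m (s + 1) (n + 1) := fun u =>
  idxWeight I • (contactOne ρ u).curryLeft (partialY (s + 1) σ I)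

/-- The interior Euler operator on forms of degree `dim X + 1`,
`𝓘(ρ) = ω^σ ∧ ∑_{|I| ≤ s} (-1)^{|I|} d_I (∂/∂y^σ_I ⌋ p_1 ρ)`. -/
def interiorEuler {s : ℕ} (ρ : Form (n + 1) m s (n + 2)) :
    Form (n + 1) m (2 * s + 1) (n + 2) := fun u =>
  ∑ σ, wedgeOne (contactForm (2 * s + 1) σ 0 u)
    (∑ l ∈ Finset.range (s + 1), ∑ I : Fin l → Fin (n + 1),
      (-1 : ℝ) ^ l • pull (2 * s + 1) (formalDs l I (etaForm ρ σ (tupleIdx I))) u)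

/-- `ζ^I_σ = ∑_{|J| ≤ s - |I|} (-1)^{|J|} (|I|+|J| choose |J|) d_J η^{JI}_σ`. -/
def zetaForm {s : ℕ} (ρ : Form (n + 1) m s (n + 2)) (σ : Fin m) (I : Multiset (Fin (n + 1))) :
    Form (n + 1) m (2 * s + 1 - I.card) (n + 1) := fun u =>
  ∑ l ∈ Finset.range (s - I.card + 1), ∑ J : Fin l → Fin (n + 1),
    ((-1 : ℝ) ^ l * ((I.card + l).choose l : ℝ)) •
      pull (2 * s + 1 - I.card) (formalDs l J (etaForm ρ σ (tupleIdx J + I))) u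

/-- The 1-contact `1`-forms `χ^I` with `ω^σ ∧ ζ^I_σ = χ^I ∧ ds`. -/
def chiForm {s : ℕ} (ρ : Form (n + 1) m s (n + 2)) (I : Multiset (Fin (n + 1))) :
    Form (n + 1) m (2 * s + 1 - I.card) 1 := fun u =>
  ∑ σ, zetaForm ρ σ I u (fun a => partialX (2 * s + 1 - I.card) a) •
    ContinuousAlternatingMap.ofSubsingleton ℝ (JetC (n + 1) m (2 * s + 1 - I.card)) ℝ (0 : Fin 1)
      (contactForm (2 * s + 1 - I.card) σ 0 u)

/-- The residual operator on forms of degree `dim X + 1`,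
`𝓡(ρ) = - ∑_{|I| ≤ s-1} d_I χ^{Ij} ∧ ds_j`. -/
def residual {s : ℕ} (ρ : Form (n + 1) m s (n + 2)) : Form (n + 1) m (2 * s) (n + 1) := fun u =>
  -∑ l ∈ Finset.range s, ∑ I : Fin l → Fin (n + 1), ∑ j : Fin (n + 1),
    wedgeOne
      ((ContinuousAlternatingMap.ofSubsingleton ℝ (JetC (n + 1) m (2 * s)) ℝ (0 : Fin 1)).symm
        (pull (2 * s) (formalDs l I (chiForm ρ (j ::ₘ tupleIdx I))) u))
      (volFormContr (2 * s) j)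

/-- The Euler–Lagrange form `E(hρ) = 𝓘(dρ)` of the Lagrangian `hρ`, where `ρ` is a form of degree
`dim X` on `s`-jets.  (If `ρ` itself is horizontal, then `hρ` is `ρ` up to pull-back.) -/
def eulerLagrange {s : ℕ} (ρ : Form (n + 1) m s (n + 1)) :
    Form (n + 1) m (2 * s + 1) (n + 2) :=
  interiorEuler fun u => extDeriv ρ u

/-- The generalized momentum `p_{d_V L} = - p_1 𝓡(dL)` of a Lagrangian `L`.  Here `p_1` is omitted,
because `𝓡(dL)` is 1-contact, so that `p_1` only pulls it back. -/
def momentum {s : ℕ} (L : Form (n + 1) m s (n + 1)) : Form (n + 1) m (2 * s) (n + 1) := fun u =>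
  -residual (fun v => extDeriv L v) u

/-- The Noether current `J^kΞ_V ⌋ p_{d_V L} + Ξ_H ⌋ L` of a Lagrangian `L` of order `s ≥ 1`. -/
def noetherCurrent {s : ℕ} (k : ℕ) (Ξ : TotC (n + 1) m → TotC (n + 1) m)
    (L : Form (n + 1) m s (n + 1)) : Form (n + 1) m (2 * s) n := fun u =>
  contract (vertPart (2 * s) k Ξ) (momentum L) u
    + contract (horPart (2 * s) Ξ) (pull (2 * s) L) u

end Euler

/-! ### Fibered manifolds, jets, forms on jet spaces, projectable vector fields -/

section Manifolds

variable {n m : ℕ} {X Y : Type*}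
  [TopologicalSpace X] [ChartedSpace (Fin n → ℝ) X]
  [TopologicalSpace Y] [ChartedSpace (TotC n m) Y]

/-- The projection of a fibered manifold: a smooth surjective submersion. -/
structure IsFiberedManifold (π : Y → X) : Prop where
  smooth : ContMDiff 𝓘(ℝ, TotC n m) 𝓘(ℝ, Fin n → ℝ) ∞ π
  surjective : Function.Surjective π
  submersion : ∀ y, Function.Surjective (mfderiv 𝓘(ℝ, TotC n m) 𝓘(ℝ, Fin n → ℝ) π y)

/-- A fibered chart `(x^i, y^σ)` on an open set of `Y`, with its chart `(x^i)` of the base. -/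
structure FiberedChart (π : Y → X) where
  total : OpenPartialHomeomorph Y (TotC n m)
  base : OpenPartialHomeomorph X (Fin n → ℝ)
  total_mem : total ∈ IsManifold.maximalAtlas 𝓘(ℝ, TotC n m) ∞ Y
  base_mem : base ∈ IsManifold.maximalAtlas 𝓘(ℝ, Fin n → ℝ) ∞ X
  base_source : base.source = π '' total.source
  fst_total : ∀ y ∈ total.source, (total y).1 = base (π y)

/-- A point `pt` of `X` and a smooth local section of `π` near `pt` (the values of `toFun` away
from `pt` are irrelevant). -/
structure LocalSection (n m : ℕ) {X Y : Type*}
    [TopologicalSpace X] [ChartedSpace (Fin n → ℝ) X]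
    [TopologicalSpace Y] [ChartedSpace (TotC n m) Y] (π : Y → X) where
  pt : X
  toFun : X → Y
  isSection : ∀ᶠ x in 𝓝 pt, π (toFun x) = x
  smooth : ∀ᶠ x in 𝓝 pt, ContMDiffAt 𝓘(ℝ, Fin n → ℝ) 𝓘(ℝ, TotC n m) ∞ toFun x

/-- Iterated partial derivatives of a function on `ℝⁿ`. -/
def iterPartial : List (Fin n) → ((Fin n → ℝ) → ℝ) → (Fin n → ℝ) → ℝ
  | [], f => f
  | i :: L, f => fun x => fderiv ℝ (iterPartial L f) x (Pi.single i 1)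

/-- The coordinates `x^i`, `y^σ_I = ∂^{|I|} γ^σ / ∂x^I` of the `k`-jet of a local section. -/
def sectionCoords {π : Y → X} (c : FiberedChart (n := n) (m := m) π) (k : ℕ)
    (γ : LocalSection n m π) : JetC n m k :=
  (c.base γ.pt, fun σ I =>
    iterPartial (I.1.sort (· ≥ ·)) (fun x => (c.total (γ.toFun (c.base.symm x))).2 σ)
      (c.base γ.pt))

/-- Two local sections have the same `k`-jet if they have the same value and the same derivatives up
to order `k` at the same point. -/
def jetSetoid (n m : ℕ) {X Y : Type*} [TopologicalSpace X] [ChartedSpace (Fin n → ℝ) X]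
    [TopologicalSpace Y] [ChartedSpace (TotC n m) Y] (π : Y → X) (k : ℕ) :
    Setoid (LocalSection n m π) where
  r γ δ := γ.pt = δ.pt ∧ γ.toFun γ.pt = δ.toFun δ.pt ∧
    ∀ c : FiberedChart (n := n) (m := m) π, γ.toFun γ.pt ∈ c.total.source →
      sectionCoords c k γ = sectionCoords c k δ
  iseqv :=
    { refl := fun _ => ⟨rfl, rfl, fun _ _ => rfl⟩
      symm := fun h => ⟨h.1.symm, h.2.1.symm, fun c hc => (h.2.2 c (h.2.1 ▸ hc)).symm⟩
      trans := fun h h' => ⟨h.1.trans h'.1, h.2.1.trans h'.2.1, fun c hc =>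
        (h.2.2 c hc).trans (h'.2.2 c (h.2.1 ▸ hc))⟩ }

/-- The jet space `J^k π`. -/
def JetSpace (n m : ℕ) {X Y : Type*} [TopologicalSpace X] [ChartedSpace (Fin n → ℝ) X]
    [TopologicalSpace Y] [ChartedSpace (TotC n m) Y] (π : Y → X) (k : ℕ) : Type _ :=
  Quotient (jetSetoid n m π k)

/-- The projection `J^k π → Y`. -/
def JetSpace.toTotal {π : Y → X} {k : ℕ} (j : JetSpace n m π k) : Y :=
  Quotient.lift (s := jetSetoid n m π k) (fun γ => γ.toFun γ.pt) (fun _ _ h => h.2.1) j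

open Classical in
/-- The coordinates on `J^k π` induced by a fibered chart, on the jets over its domain. -/
def JetSpace.coords {π : Y → X} {k : ℕ} (c : FiberedChart (n := n) (m := m) π)
    (j : JetSpace n m π k) : JetC n m k :=
  Quotient.lift (s := jetSetoid n m π k)
    (fun γ => if γ.toFun γ.pt ∈ c.total.source then sectionCoords c k γ else 0)
    (fun γ δ h => by
      by_cases hc : γ.toFun γ.pt ∈ c.total.source
      · have hd : δ.toFun δ.pt ∈ c.total.source := h.2.1 ▸ hc
        simp only [hc, hd, if_true]
        exact h.2.2 c hc
      · have hd : δ.toFun δ.pt ∉ c.total.source := h.2.1 ▸ hc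
        simp only [hc, hd, if_false]) j

/-- A smooth differential `q`-form on `J^k π`: a smooth form in the induced coordinates of each
fibered chart, such that any two of them correspond to each other under the (unique) change `T` of
coordinates. -/
structure JetForm (n m : ℕ) {X Y : Type*} [TopologicalSpace X] [ChartedSpace (Fin n → ℝ) X]
    [TopologicalSpace Y] [ChartedSpace (TotC n m) Y] (π : Y → X) (k q : ℕ) where
  rep : FiberedChart (n := n) (m := m) π → Form n m k q
  smooth : ∀ c, ContDiffOn ℝ ∞ (rep c) (jetDomain c.total.target k)
  compatible : ∀ (c c' : FiberedChart (n := n) (m := m) π) (T : JetC n m k → JetC n m k),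
    (∀ j : JetSpace n m π k, j.toTotal ∈ c.total.source → j.toTotal ∈ c'.total.source →
      T (j.coords c) = j.coords c') →
    ∀ j : JetSpace n m π k, j.toTotal ∈ c.total.source → j.toTotal ∈ c'.total.source →
      rep c (j.coords c) =
        (rep c' (j.coords c')).compContinuousLinearMap (fderiv ℝ T (j.coords c))

/-- A smooth `π`-projectable vector field on `Y`: it is `π`-related to a vector field on `X` (which
is then smooth, because `π` is a surjective submersion). -/
structure ProjectableField (n m : ℕ) {X Y : Type*} [TopologicalSpace X]
    [ChartedSpace (Fin n → ℝ) X] [TopologicalSpace Y] [ChartedSpace (TotC n m) Y]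
    [IsManifold 𝓘(ℝ, TotC n m) ∞ Y] (π : Y → X) where
  toFun : (y : Y) → TangentSpace 𝓘(ℝ, TotC n m) y
  smooth : ContMDiff 𝓘(ℝ, TotC n m) 𝓘(ℝ, TotC n m).tangent ∞
    (fun y => (⟨y, toFun y⟩ : TangentBundle 𝓘(ℝ, TotC n m) Y))
  projectable : ∃ ξ : (x : X) → TangentSpace 𝓘(ℝ, Fin n → ℝ) x,
    ∀ y, mfderiv 𝓘(ℝ, TotC n m) 𝓘(ℝ, Fin n → ℝ) π y (toFun y) = ξ (π y)

/-- The components of a vector field in a fibered chart. -/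
def ProjectableField.rep [IsManifold 𝓘(ℝ, TotC n m) ∞ Y] {π : Y → X}
    (Ξ : ProjectableField n m π) (c : FiberedChart (n := n) (m := m) π) :
    TotC n m → TotC n m := fun w =>
  mfderiv 𝓘(ℝ, TotC n m) 𝓘(ℝ, TotC n m) c.total (c.total.symm w) (Ξ.toFun (c.total.symm w))

end Manifolds

end SecondVariation

end

/-!
The identity is reduced to a computation with functions on one jet space `J^N`, `N = 4r + 3`, over
the chart domain.

*Truncated total derivatives.*  On the coordinate space of `N`-jets the total derivatives `d_i`,
with the components of order `N` set to zero, are vector fields.  They commute exactly, and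
`[∂/∂y^σ_I, d_j] = ∂/∂y^σ_{I-j}`.  Hence the smooth functions on the jets over the chart domain form
an algebra with commuting derivations (`totalDer`), and all formal derivatives of forms of
sufficiently low order become, after pull-back to `N`-jets, derivations applied to coefficients:
`HasCoeff.formalD` for horizontal forms, and `HasVertValue.formalD` for the values of one-forms on
vertical fields.

*Algebra.*  For commuting derivations, `sum_tupleSum_iter_mul_eq` is the iterated integration by
parts `∑ d_I Q · η^I = Q ∑ (-1)^{|I|} d_I η^I + ∑ d_j (∑ d_I (Q ζ^{Ij}))`, and
`sum_tupleSum_euler_divergence` says that the Euler operator annihilates divergences.  The weights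
`I!/|I|!` enter through `tupleSum_idxWeight_smul`, which turns a weighted sum over ordered tuples
into a sum over multi-indices.

*First variation.*  For `L = f ds` of order at most `k + 1`, the Lie derivative along a prolongation
has the coefficient `∑ d_i(ξ^i f) + ∑ d_I Q^σ ∂f/∂y^σ_I` (`HasVolCoeff.lieDeriv_prolong`), where
`Q^σ = ξ^σ - y^σ_i ξ^i`.  Integration by parts splits it into `Q^σ E_σ(f)` and the divergence of the
Noether current (`lieFun_eq`, `hasCoeff_noetherCurrent`).  The form `E(hρ)`, although defined by
`dρ` and not by `d(hρ)`, has the components `E_σ(f)`, where `hρ = f ds`, since `p_1 dρ` and `p_1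
d(hρ)` differ by a divergence (`isSourceForm_eulerLagrange`).

*Second variation.*  Put `L' = L_{J^{r+1}Ξ_1} hρ`, a horizontal form of order `r + 1`, `L_1 =
Ξ_{1,V} ⌋ E(hρ)`, and `L_2 = L' - L_1`, which is `d_H ε_{Ξ_1}(hρ)` by the first variation formula
and visibly has order `2r + 1`.  The first variation formula for `L' = L_1 + L_2` and `Ξ_2` gives
the result: currents and Euler–Lagrange expressions are additive in the Lagrangian
(`noetherFun_add`), `E(L_2) = 0` since `L_2` is a divergence, and truncating the prolongation of
`Ξ_{2,V}` at order `k ≥ r + 1` does not matter, because `L'` has order `r + 1` even though `L_1` and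
`L_2` separately do not (`noetherFun_eq`).
-/

noncomputable section

namespace SecondVariation

/-! ### Sums over ordered tuples and over multi-indices -/

section TupleSums

variable {d : ℕ} {M : Type*} [AddCommMonoid M]

/-- The sum over all ordered tuples of length `l` of a function of the underlying multi-index. -/
def tupleSum (l : ℕ) (F : Multiset (Fin d) → M) : M := ∑ I : Fin l → Fin d, F (tupleIdx I)

theorem card_tupleIdx {l : ℕ} (I : Fin l → Fin d) : (tupleIdx I).card = l := by
  simp [tupleIdx]

theorem tupleIdx_cons {l : ℕ} (i : Fin d) (I : Fin l → Fin d) :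
    tupleIdx (Fin.cons i I : Fin (l + 1) → Fin d) = i ::ₘ tupleIdx I := by
  simp [tupleIdx, List.ofFn_succ]

theorem tupleIdx_succ_last {l : ℕ} (I : Fin (l + 1) → Fin d) :
    tupleIdx I = I (Fin.last l) ::ₘ tupleIdx (fun a => I a.castSucc) := by
  rw [tupleIdx, List.ofFn_succ', List.concat_eq_append, ← Multiset.coe_add,
    Multiset.coe_singleton, add_comm, Multiset.singleton_add, tupleIdx]

theorem tupleSum_zero (F : Multiset (Fin d) → M) : tupleSum 0 F = F 0 := by
  simp [tupleSum, tupleIdx]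

theorem tupleSum_succ (l : ℕ) (F : Multiset (Fin d) → M) :
    tupleSum (l + 1) F = ∑ i, tupleSum l (fun I => F (i ::ₘ I)) := by
  simp only [tupleSum]
  rw [← (Fin.consEquiv fun _ : Fin (l + 1) => Fin d).sum_comp, Fintype.sum_prod_type]
  simp [Fin.consEquiv, tupleIdx_cons]

theorem tupleSum_congr {l : ℕ} {F G : Multiset (Fin d) → M}
    (h : ∀ I : Multiset (Fin d), I.card = l → F I = G I) : tupleSum l F = tupleSum l G :=
  Finset.sum_congr rfl fun I _ => h _ (card_tupleIdx I)

theorem tupleSum_eq_zero {l : ℕ} {F : Multiset (Fin d) → M}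
    (h : ∀ I : Multiset (Fin d), I.card = l → F I = 0) : tupleSum l F = 0 :=
  Finset.sum_eq_zero fun I _ => h _ (card_tupleIdx I)

theorem tupleSum_add_fun (l : ℕ) (F G : Multiset (Fin d) → M) :
    tupleSum l (fun I => F I + G I) = tupleSum l F + tupleSum l G :=
  Finset.sum_add_distrib

theorem tupleSum_sum {ι : Type*} (s : Finset ι) (l : ℕ) (F : ι → Multiset (Fin d) → M) :
    tupleSum l (fun I => ∑ a ∈ s, F a I) = ∑ a ∈ s, tupleSum l (F a) :=
  Finset.sum_comm

theorem map_tupleSum {M' F' : Type*} [AddCommMonoid M'] [FunLike F' M M']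
    [AddMonoidHomClass F' M M'] (φ : F') (l : ℕ) (F : Multiset (Fin d) → M) :
    φ (tupleSum l F) = tupleSum l (fun I => φ (F I)) :=
  map_sum φ _ _

theorem tupleSum_tupleSum (p q : ℕ) (F : Multiset (Fin d) → M) :
    tupleSum p (fun I => tupleSum q (fun J => F (I + J))) = tupleSum (p + q) F := by
  induction p generalizing F with
  | zero => simp [tupleSum_zero]
  | succ p ih =>
    rw [tupleSum_succ, Nat.add_right_comm, tupleSum_succ]
    refine Finset.sum_congr rfl fun i _ => ?_
    rw [← ih]
    simp

/-- The multi-indices of length `l`. -/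
def idxFinset (d l : ℕ) : Finset (Multiset (Fin d)) := by
  classical exact ((Finset.univ : Finset (MIdx d l)).image Subtype.val).filter fun I => I.card = l

theorem mem_idxFinset {l : ℕ} {I : Multiset (Fin d)} : I ∈ idxFinset d l ↔ I.card = l := by
  simp only [idxFinset, Finset.mem_filter, Finset.mem_image, Finset.mem_univ, true_and,
    and_iff_right_iff_imp]
  exact fun h => ⟨⟨I, h.le⟩, rfl⟩

theorem sum_idxFinset_cons (i : Fin d) (l : ℕ) (F : Multiset (Fin d) → M) :
    ∑ I ∈ idxFinset d (l + 1) with i ∈ I, F I = ∑ I ∈ idxFinset d l, F (i ::ₘ I) := by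
  refine Finset.sum_nbij' (fun I => I.erase i) (fun I => i ::ₘ I) ?_ ?_ ?_ ?_ ?_
  · intro I hI
    rw [Finset.mem_filter, mem_idxFinset] at hI
    rw [mem_idxFinset, Multiset.card_erase_of_mem hI.2, hI.1, Nat.pred_succ]
  · intro I hI
    rw [mem_idxFinset] at hI
    simp [mem_idxFinset, hI]
  · intro I hI
    exact Multiset.cons_erase (Finset.mem_filter.1 hI).2
  · intro I _
    exact Multiset.erase_cons_head i I
  · intro I hI
    rw [Multiset.cons_erase (Finset.mem_filter.1 hI).2]

theorem idxWeight_cons (i : Fin d) (I : Multiset (Fin d)) :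
    idxWeight (i ::ₘ I) = idxWeight I * ((I.count i + 1) / (I.card + 1)) := by
  have h : ∏ a, (((i ::ₘ I).count a).factorial : ℝ)
      = (∏ a, ((I.count a).factorial : ℝ)) * (I.count i + 1) := by
    rw [← Finset.mul_prod_erase _ _ (Finset.mem_univ i),
      ← Finset.mul_prod_erase (a := i) _ (fun a => ((I.count a).factorial : ℝ)) (Finset.mem_univ i),
      Multiset.count_cons_self, Nat.factorial_succ]
    rw [Finset.prod_congr rfl fun a ha => by
      rw [Multiset.count_cons_of_ne (Finset.ne_of_mem_erase ha)]]
    push_cast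
    ring
  rw [idxWeight, idxWeight, h, Multiset.card_cons, Nat.factorial_succ]
  push_cast
  field_simp

/-- The factor `I! / |I|!` is the inverse of the number of ordered tuples with underlying
multi-index `I`. -/
theorem tupleSum_idxWeight_smul {V : Type*} [AddCommGroup V] [Module ℝ V] (l : ℕ)
    (F : Multiset (Fin d) → V) :
    tupleSum l (fun I => idxWeight I • F I) = ∑ I ∈ idxFinset d l, F I := by
  induction l generalizing F with
  | zero =>
    have h : idxFinset d 0 = {0} := by ext; simp [mem_idxFinset]
    simp [tupleSum_zero, h, idxWeight]
  | succ l ih =>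
    have h1 (i : Fin d) : tupleSum l (fun I => idxWeight (i ::ₘ I) • F (i ::ₘ I))
        = ∑ I ∈ idxFinset d (l + 1), (((I.count i : ℝ)) / (l + 1)) • F I := by
      rw [← Finset.sum_filter_of_ne (p := fun I => i ∈ I), sum_idxFinset_cons, ← ih]
      · refine tupleSum_congr fun I hI => ?_
        rw [idxWeight_cons, mul_smul, hI, Multiset.count_cons_self, Nat.cast_succ]
      · intro I _ hne
        by_contra hi
        simp [Multiset.count_eq_zero_of_notMem hi] at hne
    rw [tupleSum_succ, Finset.sum_congr rfl fun i _ => h1 i, Finset.sum_comm]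
    refine Finset.sum_congr rfl fun I hI => ?_
    rw [← Finset.sum_smul, ← Finset.sum_div, ← Nat.cast_sum, Multiset.sum_count_eq_card]
    · rw [mem_idxFinset.1 hI, Nat.cast_succ, div_self (by positivity), one_smul]
    · simp

end TupleSums

/-! ### Integration by parts for commuting derivations -/

/-- A family of pairwise commuting derivations of a commutative algebra, in the role of the total
derivatives. -/
structure CommutingDerivations (d : ℕ) (A : Type*) [CommRing A] [Algebra ℝ A] where
  der : Fin d → Derivation ℝ A A
  comm : ∀ i j a, der i (der j a) = der j (der i a)

namespace CommutingDerivations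

variable {d : ℕ} {A : Type*} [CommRing A] [Algebra ℝ A] (D : CommutingDerivations d A)

/-- The iterated derivation `D_I`. -/
def iter (I : Multiset (Fin d)) : A →ₗ[ℝ] A :=
  haveI : LeftCommutative fun (i : Fin d) (φ : A →ₗ[ℝ] A) => (D.der i : A →ₗ[ℝ] A) ∘ₗ φ :=
    ⟨fun i j φ => LinearMap.ext fun a => D.comm i j (φ a)⟩
  I.foldr (fun i φ => (D.der i : A →ₗ[ℝ] A) ∘ₗ φ) LinearMap.id

@[simp]
theorem iter_zero (a : A) : D.iter 0 a = a := by
  simp [iter]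

@[simp]
theorem iter_cons (i : Fin d) (I : Multiset (Fin d)) (a : A) :
    D.iter (i ::ₘ I) a = D.der i (D.iter I a) := by
  simp [iter]

theorem iter_add (I J : Multiset (Fin d)) (a : A) :
    D.iter (I + J) a = D.iter I (D.iter J a) := by
  induction I using Multiset.induction_on with
  | empty => simp
  | cons i I ih => simp [ih]

theorem iter_der (I : Multiset (Fin d)) (i : Fin d) (a : A) :
    D.iter I (D.der i a) = D.der i (D.iter I a) := by
  induction I using Multiset.induction_on with
  | empty => simp
  | cons j I ih => simp [ih, D.comm i j]

/-- The iterated Leibniz rule, summed over all ordered tuples of length `l`. -/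
theorem tupleSum_iter_mul (l : ℕ) (a : A) (b : Multiset (Fin d) → A) :
    tupleSum l (fun I => D.iter I (a * b I)) =
      ∑ pq ∈ Finset.HasAntidiagonal.antidiagonal l, l.choose pq.1 •
        tupleSum pq.1 (fun P => tupleSum pq.2 (fun R => D.iter P a * D.iter R (b (P + R)))) := by
  induction l generalizing a b with
  | zero => simp [tupleSum_zero]
  | succ l ih =>
    have h (i : Fin d) : tupleSum l (fun I => D.iter (i ::ₘ I) (a * b (i ::ₘ I)))
        = tupleSum l (fun I => D.iter I (a * D.der i (b (i ::ₘ I))))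
          + tupleSum l (fun I => D.iter I (D.der i a * b (i ::ₘ I))) := by
      rw [← tupleSum_add_fun]
      refine tupleSum_congr fun I _ => ?_
      rw [iter_cons, ← iter_der, Derivation.leibniz, map_add, smul_eq_mul, smul_eq_mul,
        mul_comm (b _)]
    rw [tupleSum_succ, Finset.sum_congr rfl fun i _ => h i, Finset.sum_add_distrib,
      Finset.sum_antidiagonal_choose_succ_nsmul
        (f := fun p q => tupleSum p (fun P => tupleSum q fun R =>
          D.iter P a * D.iter R (b (P + R))))]
    congr 1
    · rw [Finset.sum_congr rfl fun i _ => ih a fun I => D.der i (b (i ::ₘ I)), Finset.sum_comm]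
      refine Finset.sum_congr rfl fun pq _ => ?_
      rw [← Finset.smul_sum, ← tupleSum_sum]
      congr 2
      ext P
      rw [tupleSum_succ]
      simp [iter_der]
    · rw [Finset.sum_congr rfl fun i _ => ih (D.der i a) fun I => b (i ::ₘ I), Finset.sum_comm]
      refine Finset.sum_congr rfl fun pq hpq => ?_
      have hl : pq.1 + pq.2 = l := Finset.HasAntidiagonal.mem_antidiagonal.1 hpq
      rw [← Finset.smul_sum, tupleSum_succ]
      have hc : l.choose pq.1 = l.choose pq.2 := Nat.choose_symm_of_eq_add hl.symm
      rw [hc]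
      congr 2
      ext i
      simp [iter_der]

/-- The coefficients `ζ^I` of the residual operator, for a single dependent variable. -/
def zeta (s : ℕ) (η : Multiset (Fin d) → A) (I : Multiset (Fin d)) : A :=
  ∑ l ∈ Finset.range (s - I.card + 1), tupleSum l fun J =>
    ((-1 : ℝ) ^ l * ((I.card + l).choose l : ℝ)) • D.iter J (η (J + I))

/-- The binomial coefficients in `ζ^I` are such that all terms `D_P Q · D_K η^{KP}` with `K ≠ ∅`
cancel. -/
theorem sum_tupleSum_iter_mul_zeta (s : ℕ) (Q : A) (η : Multiset (Fin d) → A) :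
    ∑ l ∈ Finset.range (s + 1), tupleSum l (fun I => D.iter I (Q * D.zeta s η I)) =
      ∑ l ∈ Finset.range (s + 1), tupleSum l (fun I => D.iter I Q * η I) := by
  set S : ℕ → ℕ → A := fun p k => tupleSum p fun P => tupleSum k fun K =>
    D.iter P Q * D.iter K (η (K + P)) with hS
  have hexp (l : ℕ) : tupleSum l (fun I => D.iter I (Q * D.zeta s η I)) =
      ∑ t ∈ Finset.range (s - l + 1), ∑ pq ∈ Finset.HasAntidiagonal.antidiagonal l,
        (((-1 : ℝ) ^ t * ((l + t).choose t : ℝ)) * (l.choose pq.1 : ℝ)) • S pq.1 (pq.2 + t) := by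
    have h1 : tupleSum l (fun I => D.iter I (Q * D.zeta s η I)) =
        ∑ t ∈ Finset.range (s - l + 1), ((-1 : ℝ) ^ t * ((l + t).choose t : ℝ)) •
          tupleSum l (fun I => D.iter I (Q * tupleSum t fun J => D.iter J (η (J + I)))) := by
      simp only [← LinearMap.lsmul_apply (R := ℝ) (M := A), map_tupleSum, ← tupleSum_sum]
      refine tupleSum_congr fun I hI => ?_
      simp only [LinearMap.lsmul_apply, zeta, hI, Finset.mul_sum, map_sum]
      refine Finset.sum_congr rfl fun t _ => ?_
      rw [← map_smul, ← mul_smul_comm]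
      congr 2
      rw [← LinearMap.lsmul_apply (R := ℝ) (M := A), map_tupleSum]
      rfl
    rw [h1]
    refine Finset.sum_congr rfl fun t _ => ?_
    rw [tupleSum_iter_mul, Finset.smul_sum]
    refine Finset.sum_congr rfl fun pq _ => ?_
    rw [mul_smul ((-1 : ℝ) ^ t * ((l + t).choose t : ℝ)), Nat.cast_smul_eq_nsmul]
    congr 2
    refine tupleSum_congr fun P _ => ?_
    rw [← tupleSum_tupleSum]
    refine tupleSum_congr fun R _ => ?_
    rw [map_tupleSum, ← LinearMap.mulLeft_apply (R := ℝ), map_tupleSum]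
    refine tupleSum_congr fun J _ => ?_
    rw [LinearMap.mulLeft_apply, iter_add, add_comm R J, add_assoc, add_comm R P]
  -- With `I = P + R` split by the Leibniz rule, the terms are collected according to `P` and to
  -- `k = |R| + |J|`.
  have hre : ∑ l ∈ Finset.range (s + 1), tupleSum l (fun I => D.iter I (Q * D.zeta s η I)) =
      ∑ p ∈ Finset.range (s + 1), ∑ k ∈ Finset.range (s - p + 1), ∑ t ∈ Finset.range (k + 1),
        (((-1 : ℝ) ^ t * ((p + k).choose t : ℝ)) * ((p + k - t).choose p : ℝ)) • S p k := by
    rw [Finset.sum_congr rfl fun l _ => hexp l]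
    simp only [Finset.sum_sigma']
    refine Finset.sum_nbij' (fun x => ⟨x.2.2.1, x.2.2.2 + x.2.1, x.2.1⟩)
      (fun x => ⟨x.1 + x.2.1 - x.2.2, x.2.2, (x.1, x.2.1 - x.2.2)⟩) ?_ ?_ ?_ ?_ ?_
    · rintro ⟨l, t, p, q⟩ h
      simp only [Finset.mem_sigma, Finset.mem_range, Finset.HasAntidiagonal.mem_antidiagonal] at h ⊢
      omega
    · rintro ⟨p, k, t⟩ h
      simp only [Finset.mem_sigma, Finset.mem_range, Finset.HasAntidiagonal.mem_antidiagonal] at h ⊢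
      omega
    · rintro ⟨l, t, p, q⟩ h
      simp only [Finset.mem_sigma, Finset.mem_range, Finset.HasAntidiagonal.mem_antidiagonal] at h
      obtain ⟨_, _, rfl⟩ := h
      simp only [← add_assoc, Nat.add_sub_cancel]
    · rintro ⟨p, k, t⟩ h
      simp only [Finset.mem_sigma, Finset.mem_range] at h ⊢
      rw [Nat.sub_add_cancel (by omega)]
    · rintro ⟨l, t, p, q⟩ h
      simp only [Finset.mem_sigma, Finset.mem_range, Finset.HasAntidiagonal.mem_antidiagonal] at h ⊢
      obtain ⟨_, _, rfl⟩ := h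
      simp only [← add_assoc, Nat.add_sub_cancel]
  rw [hre]
  refine Finset.sum_congr rfl fun p _ => ?_
  have hcoef (k : ℕ) : ∑ t ∈ Finset.range (k + 1),
      (((-1 : ℝ) ^ t * ((p + k).choose t : ℝ)) * ((p + k - t).choose p : ℝ))
        = if k = 0 then 1 else 0 := by
    have h1 (t : ℕ) (ht : t ∈ Finset.range (k + 1)) :
        (((-1 : ℝ) ^ t * ((p + k).choose t : ℝ)) * ((p + k - t).choose p : ℝ))
          = ((p + k).choose p : ℝ) * ((((-1) ^ t * k.choose t : ℤ)) : ℝ) := by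
      have ht' : t ≤ k := Nat.lt_succ_iff.1 (Finset.mem_range.1 ht)
      have h2 : (p + k).choose t * (p + k - t).choose p = (p + k).choose p * k.choose t := by
        have h3 := Nat.choose_mul (n := p + k) (k := p + t) (s := p) (by omega)
        have h4 := Nat.choose_mul (n := p + k) (k := p + t) (s := t) (by omega)
        rw [Nat.add_sub_cancel_left, Nat.add_sub_cancel_left] at h3
        rw [Nat.add_sub_cancel] at h4
        have h5 : (p + t).choose p = (p + t).choose t :=
          Nat.choose_symm_of_eq_add rfl
        rw [← h3, ← h4, h5]
      push_cast
      rw [mul_assoc, ← Nat.cast_mul, h2]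
      push_cast
      ring
    rw [Finset.sum_congr rfl h1, ← Finset.mul_sum, ← Int.cast_sum,
      Int.alternating_sum_range_choose]
    split_ifs with hk
    · simp [hk]
    · simp
  simp only [← Finset.sum_smul, hcoef, ite_smul, one_smul, zero_smul]
  rw [Finset.sum_ite_eq' , if_pos (by simp)]
  simp [hS, tupleSum_zero]

/-- Summation by parts, in the form in which it appears in the first variation formula: the
difference of `∑ D_I Q · η^I` and `Q · ∑ (-1)^{|I|} D_I η^I` is a divergence. -/
theorem sum_tupleSum_iter_mul_eq (s : ℕ) (Q : A) (η : Multiset (Fin d) → A) :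
    ∑ l ∈ Finset.range (s + 1), tupleSum l (fun I => D.iter I Q * η I) =
      Q * ∑ l ∈ Finset.range (s + 1), tupleSum l (fun I => (-1 : ℝ) ^ l • D.iter I (η I))
        + ∑ j, D.der j (∑ l ∈ Finset.range s,
            tupleSum l fun I => D.iter I (Q * D.zeta s η (j ::ₘ I))) := by
  rw [← sum_tupleSum_iter_mul_zeta, Finset.sum_range_succ', add_comm]
  congr 1
  · simp [tupleSum_zero, zeta]
  · simp only [map_sum]
    rw [Finset.sum_comm]
    refine Finset.sum_congr rfl fun l _ => ?_
    rw [tupleSum_succ]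
    simp only [map_tupleSum, iter_cons]

/-- The Euler operator annihilates divergences.  The family `g` stands for the partial derivatives
of a function `f`, in which case `D_j g^I + g^{I-j}` are the partial derivatives of `D_j f`. -/
theorem sum_tupleSum_euler_divergence (s : ℕ) (j : Fin d) (g : Multiset (Fin d) → A)
    (hg : ∀ I : Multiset (Fin d), I.card = s → g I = 0) :
    ∑ l ∈ Finset.range (s + 1), tupleSum l (fun I => (-1 : ℝ) ^ l • D.iter I
      (idxWeight I • (D.der j (g I) + if j ∈ I then g (I.erase j) else 0))) = 0 := by
  have h (l : ℕ) : tupleSum l (fun I => (-1 : ℝ) ^ l • D.iter I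
      (idxWeight I • (D.der j (g I) + if j ∈ I then g (I.erase j) else 0))) =
      (-1 : ℝ) ^ l • (∑ I ∈ idxFinset d l, D.iter I (D.der j (g I)) +
        ∑ I ∈ idxFinset d l with j ∈ I, D.iter I (g (I.erase j))) := by
    simp only [map_smul, smul_comm ((-1 : ℝ) ^ l)]
    rw [tupleSum_idxWeight_smul, ← Finset.smul_sum, Finset.sum_filter, ← Finset.sum_add_distrib]
    congr 1
    refine Finset.sum_congr rfl fun I _ => ?_
    split_ifs <;> simp
  -- Consecutive terms cancel, so that only the first half of the last one survives.
  have htel (k : ℕ) : ∑ l ∈ Finset.range (k + 1), tupleSum l (fun I => (-1 : ℝ) ^ l • D.iter I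
      (idxWeight I • (D.der j (g I) + if j ∈ I then g (I.erase j) else 0))) =
      (-1 : ℝ) ^ k • ∑ I ∈ idxFinset d k, D.iter I (D.der j (g I)) := by
    induction k with
    | zero =>
      rw [Finset.sum_range_one, h, Finset.sum_filter, Finset.sum_eq_zero (s := idxFinset d 0)
        (f := fun I => if j ∈ I then _ else _), add_zero]
      intro I hI
      rw [mem_idxFinset, Multiset.card_eq_zero] at hI
      simp [hI]
    | succ k ih =>
      rw [Finset.sum_range_succ, ih, h, sum_idxFinset_cons, smul_add, pow_succ]
      simp [iter_der]
  rw [htel, Finset.sum_eq_zero, smul_zero]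
  intro I hI
  simp [hg I (mem_idxFinset.1 hI)]

end CommutingDerivations

/-! ### Linear algebra of jet coordinates -/

section Jets

variable {d m : ℕ}

theorem dy_apply {k : ℕ} {σ : Fin m} {I : Multiset (Fin d)} (h : I.card ≤ k) (u : JetC d m k) :
    dy k σ I u = u.2 σ ⟨I, h⟩ := by
  simp [dy, h]

theorem dy_of_lt {k : ℕ} {σ : Fin m} {I : Multiset (Fin d)} (h : k < I.card) :
    dy k σ I = 0 := by
  simp [dy, h]

theorem jetC_ext {k : ℕ} {u v : JetC d m k} (h1 : u.1 = v.1)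
    (h2 : ∀ σ (I : Multiset (Fin d)), I.card ≤ k → dy k σ I u = dy k σ I v) : u = v := by
  refine Prod.ext h1 (funext fun σ => funext fun I => ?_)
  simpa [dy_apply I.2] using h2 σ I.1 I.2

@[simp]
theorem dx_apply (k : ℕ) (i : Fin d) (u : JetC d m k) : dx k i u = u.1 i := rfl

@[simp]
theorem jetProj_fst (K k : ℕ) (u : JetC d m K) : (jetProj K k u).1 = u.1 := rfl

theorem dy_jetProj {K k : ℕ} {σ : Fin m} {I : Multiset (Fin d)} (h : I.card ≤ k) (u : JetC d m K) :
    dy k σ I (jetProj K k u) = dy K σ I u := by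
  rw [dy_apply h]
  rfl

theorem jetProj_self {k : ℕ} (u : JetC d m k) : jetProj k k u = u :=
  jetC_ext rfl fun _ _ h => dy_jetProj h u

theorem jetProj_jetProj {K l k : ℕ} (h : k ≤ l) (u : JetC d m K) :
    jetProj l k (jetProj K l u) = jetProj K k u :=
  jetC_ext rfl fun _ _ hI => by rw [dy_jetProj hI, dy_jetProj hI, dy_jetProj (hI.trans h)]

/-- For `k ≤ l`, the map `jetProj k l` in the wrong direction extends a jet by zeros, and is a
section of the projection. -/
theorem jetProj_jetProj_self {l k : ℕ} (h : k ≤ l) (u : JetC d m k) :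
    jetProj l k (jetProj k l u) = u := by
  rw [jetProj_jetProj h, jetProj_self]

@[simp]
theorem toTot_jetProj (K k : ℕ) (u : JetC d m K) : toTot (jetProj K k u) = toTot u := by
  simp only [toTot, jetProj_fst]
  refine Prod.ext rfl (funext fun σ => ?_)
  exact dy_jetProj (by simp) u

theorem jetProj_mem_jetDomain {W : Set (TotC d m)} {K k : ℕ} {u : JetC d m K} :
    jetProj K k u ∈ jetDomain W k ↔ u ∈ jetDomain W K := by
  simp [jetDomain]

/-- The projection to the total space, as a continuous linear map. -/
def toTotCLM (k : ℕ) : JetC d m k →L[ℝ] TotC d m :=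
  (ContinuousLinearMap.fst ℝ _ _).prod (ContinuousLinearMap.pi fun σ => dy k σ 0)

theorem toTotCLM_apply {k : ℕ} (u : JetC d m k) : toTotCLM k u = toTot u := rfl

theorem isOpen_jetDomain {W : Set (TotC d m)} (hW : IsOpen W) (k : ℕ) :
    IsOpen (jetDomain W k) :=
  hW.preimage (toTotCLM (m := m) k).continuous

/-- The linear part of the total derivative vector field. -/
def totalLin (K k : ℕ) (i : Fin d) : JetC d m K →L[ℝ] JetC d m k :=
  (0 : JetC d m K →L[ℝ] (Fin d → ℝ)).prod
    (ContinuousLinearMap.pi fun σ => ContinuousLinearMap.pi fun I => dy K σ (i ::ₘ I.1))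

theorem totalVec_eq (K k : ℕ) (i : Fin d) (u : JetC d m K) :
    totalVec K k i u = (Pi.single i 1, 0) + totalLin K k i u := by
  refine Prod.ext ?_ ?_
  · simp [totalVec, totalLin]
  · funext σ I
    simp [totalVec, totalLin]

@[simp]
theorem totalVec_fst (K k : ℕ) (i : Fin d) (u : JetC d m K) :
    (totalVec K k i u).1 = Pi.single i 1 := rfl

@[simp]
theorem totalLin_fst (K k : ℕ) (i : Fin d) (u : JetC d m K) :
    (totalLin K k i u).1 = 0 := rfl

theorem dy_totalVec {K k : ℕ} {i : Fin d} {σ : Fin m} {I : Multiset (Fin d)} (h : I.card ≤ k)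
    (u : JetC d m K) : dy k σ I (totalVec K k i u) = dy K σ (i ::ₘ I) u := by
  rw [dy_apply h]
  rfl

theorem dy_totalLin {K k : ℕ} {i : Fin d} {σ : Fin m} {I : Multiset (Fin d)} (h : I.card ≤ k)
    (u : JetC d m K) : dy k σ I (totalLin K k i u) = dy K σ (i ::ₘ I) u := by
  rw [dy_apply h]
  rfl

theorem hasFDerivAt_totalVec (K k : ℕ) (i : Fin d) (u : JetC d m K) :
    HasFDerivAt (totalVec K k i) (totalLin K k i) u := by
  rw [funext (totalVec_eq K k i)]
  exact (totalLin K k i).hasFDerivAt.const_add _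

theorem contDiff_totalVec (K k : ℕ) (i : Fin d) :
    ContDiff ℝ ∞ (totalVec (m := m) K k i) := by
  rw [funext (totalVec_eq K k i)]
  exact contDiff_const.add (totalLin K k i).contDiff

theorem jetProj_totalVec {K l k : ℕ} (h : k ≤ l) (i : Fin d) (u : JetC d m K) :
    jetProj l k (totalVec K l i u) = totalVec K k i u :=
  jetC_ext rfl fun _ _ hI => by rw [dy_jetProj hI, dy_totalVec hI, dy_totalVec (hI.trans h)]

theorem totalVec_jetProj {K l k : ℕ} (h : k + 1 ≤ l) (i : Fin d) (u : JetC d m K) :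
    totalVec l k i (jetProj K l u) = totalVec K k i u :=
  jetC_ext rfl fun _ _ hI => by
    rw [dy_totalVec hI, dy_totalVec hI, dy_jetProj (by rw [Multiset.card_cons]; omega)]

@[simp]
theorem partialY_fst (k : ℕ) (σ : Fin m) (I : Multiset (Fin d)) : (partialY k σ I).1 = 0 := rfl

open Classical in
theorem dy_partialY {k : ℕ} {σ τ : Fin m} {I J : Multiset (Fin d)} (h : I.card ≤ k) :
    dy k σ I (partialY k τ J) = if σ = τ ∧ I = J then 1 else 0 := by
  rw [dy_apply h, partialY]
  rcases eq_or_ne σ τ with rfl | hσ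
  · simp
  · simp [hσ]

theorem jetProj_partialY {K k : ℕ} (σ : Fin m) (I : Multiset (Fin d)) :
    jetProj K k (partialY K σ I) = if I.card ≤ K then partialY k σ I else 0 := by
  refine jetC_ext ?_ fun τ J hJ => ?_
  · split_ifs <;> rfl
  · rw [dy_jetProj hJ]
    by_cases hJK : J.card ≤ K
    · rw [dy_partialY hJK]
      split_ifs with h1 h2 h2
      · rw [dy_partialY hJ, if_pos h1]
      · exact absurd (h1.2 ▸ hJK) h2
      · rw [dy_partialY hJ, if_neg h1]
      · simp
    · rw [dy_of_lt (by omega)]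
      split_ifs with h2
      · rw [dy_partialY hJ, if_neg]
        · rfl
        · rintro ⟨_, rfl⟩
          exact hJK h2
      · simp

theorem partialY_of_lt {k : ℕ} (σ : Fin m) {I : Multiset (Fin d)} (h : k < I.card) :
    partialY k σ I = 0 :=
  jetC_ext rfl fun τ J hJ => by
    rw [dy_partialY hJ, if_neg, map_zero]
    rintro ⟨_, rfl⟩
    omega

/-- A vertical vector is the combination of the coordinate vectors `∂/∂y^σ_I`. -/
theorem eq_sum_partialY {k : ℕ} {v : JetC d m k} (hv : v.1 = 0) :
    v = ∑ σ, ∑ l ∈ Finset.range (k + 1), ∑ I ∈ idxFinset d l, dy k σ I v • partialY k σ I := by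
  classical
  refine jetC_ext (by simp [hv, Prod.fst_sum]) fun τ J hJ => ?_
  simp only [map_sum, map_smul, dy_partialY hJ, smul_eq_mul]
  rw [Finset.sum_eq_single τ, Finset.sum_eq_single J.card, Finset.sum_eq_single J]
  · simp
  · intro I _ hI
    simp [hI.symm]
  · simp [mem_idxFinset]
  · intro l _ hl
    refine Finset.sum_eq_zero fun I hI => ?_
    rw [if_neg, mul_zero]
    rintro ⟨_, rfl⟩
    exact hl (mem_idxFinset.1 hI).symm
  · simp [hJ]
  · intro σ _ hσ
    simp [hσ.symm]
  · simp

theorem pull_pull {k q K N : ℕ} (h : k ≤ K) (θ : Form d m k q) :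
    pull N (pull K θ) = pull N θ := by
  funext u
  ext v
  simp [pull, jetProj_jetProj h, Function.comp_def]

end Jets

/-! ### The algebra of smooth functions on an open set -/

section SmoothFunctions

open Classical in
/-- The extension by zero of a function on an open set. -/
def zeroExt {E : Type*} [TopologicalSpace E] {U : TopologicalSpace.Opens E} (f : U → ℝ) : E → ℝ :=
  fun x => if h : x ∈ U then f ⟨x, h⟩ else 0

theorem zeroExt_apply {E : Type*} [TopologicalSpace E] {U : TopologicalSpace.Opens E} (f : U → ℝ)
    (u : U) : zeroExt f u = f u := by
  simp [zeroExt]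

theorem eqOn_zeroExt {E : Type*} [TopologicalSpace E] {U : TopologicalSpace.Opens E}
    {f : U → ℝ} {g : E → ℝ} (h : ∀ u : U, f u = g u) :
    Set.EqOn (zeroExt f) g U := fun x hx => by
  rw [zeroExt_apply f ⟨x, hx⟩, h]

theorem zeroExt_eventuallyEq {E : Type*} [TopologicalSpace E] {U : TopologicalSpace.Opens E}
    {f : U → ℝ} {g : E → ℝ} (h : ∀ u : U, f u = g u) (u : U) :
    zeroExt f =ᶠ[𝓝 (u : E)] g :=
  (eqOn_zeroExt h).eventuallyEq_of_mem (U.isOpen.mem_nhds u.2)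

variable {E : Type*} [NormedAddCommGroup E] [NormedSpace ℝ E] (U : TopologicalSpace.Opens E)

/-- The algebra of smooth functions on an open set. -/
def smoothFun : Subalgebra ℝ (U → ℝ) where
  carrier := {f | ContDiffOn ℝ ∞ (zeroExt f) U}
  mul_mem' {f g} hf hg := (hf.mul hg).congr (eqOn_zeroExt fun u => by
    simp [zeroExt_apply])
  add_mem' {f g} hf hg := (hf.add hg).congr (eqOn_zeroExt fun u => by
    simp [zeroExt_apply])
  algebraMap_mem' c := (contDiffOn_const (c := c)).congr (eqOn_zeroExt fun u => rfl)

variable {U}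

theorem contDiffOn_zeroExt (f : smoothFun U) : ContDiffOn ℝ ∞ (zeroExt f.1) U := f.2

/-- The restriction of a function to an open set on which it is smooth. -/
def smoothFun.of (g : E → ℝ) (hg : ContDiffOn ℝ ∞ g U) : smoothFun U :=
  ⟨fun u => g u, hg.congr (eqOn_zeroExt fun _ => rfl)⟩

@[simp]
theorem smoothFun.of_apply (g : E → ℝ) (hg : ContDiffOn ℝ ∞ g U) (u : U) :
    (smoothFun.of g hg).1 u = g u := rfl

theorem smoothFun.ext {f g : smoothFun U} (h : ∀ u : U, f.1 u = g.1 u) : f = g :=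
  Subtype.ext (funext h)

theorem smoothFun_differentiableAt (f : smoothFun U) (u : U) :
    DifferentiableAt ℝ (zeroExt f.1) u :=
  (f.2.contDiffAt (U.isOpen.mem_nhds u.2)).differentiableAt (by simp)

theorem smoothFun.sum_apply {ι : Type*} (s : Finset ι) (f : ι → smoothFun U) (u : U) :
    (∑ a ∈ s, f a).1 u = ∑ a ∈ s, (f a).1 u := by
  exact (congrFun (map_sum (smoothFun U).val f s) u).trans (Finset.sum_apply _ _ _)

/-- The derivation of the algebra of smooth functions given by a smooth vector field. -/
def vectorDer (X : E → E) (hX : ContDiffOn ℝ ∞ X U) :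
    Derivation ℝ (smoothFun U) (smoothFun U) :=
  Derivation.mk'
    { toFun f := smoothFun.of (fun x => fderiv ℝ (zeroExt f.1) x (X x))
        ((f.2.fderiv_of_isOpen U.isOpen (by simp)).clm_apply hX)
      map_add' f g := smoothFun.ext fun u => by
        have h := (zeroExt_eventuallyEq (f := (f + g).1)
          (g := fun x => zeroExt f.1 x + zeroExt g.1 x) (fun u => by simp [zeroExt_apply]) u)
        simp only [smoothFun.of_apply, h.fderiv_eq,
          fderiv_fun_add (smoothFun_differentiableAt f u) (smoothFun_differentiableAt g u)]
        rfl
      map_smul' c f := smoothFun.ext fun u => by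
        have h := (zeroExt_eventuallyEq (f := (c • f).1)
          (g := fun x => c • zeroExt f.1 x) (fun u => by simp [zeroExt_apply]) u)
        simp only [smoothFun.of_apply, h.fderiv_eq,
          fderiv_fun_const_smul (smoothFun_differentiableAt f u)]
        rfl }
    fun f g => smoothFun.ext fun u => by
      have h := (zeroExt_eventuallyEq (f := (f * g).1)
        (g := fun x => zeroExt f.1 x * zeroExt g.1 x) (fun u => by simp [zeroExt_apply]) u)
      simp only [LinearMap.coe_mk, AddHom.coe_mk, smoothFun.of_apply, h.fderiv_eq,
        fderiv_fun_mul (smoothFun_differentiableAt f u) (smoothFun_differentiableAt g u),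
        zeroExt_apply]
      rfl

theorem vectorDer_apply {X : E → E} {hX : ContDiffOn ℝ ∞ X U} (f : smoothFun U) (u : U) :
    (vectorDer X hX f).1 u = fderiv ℝ (zeroExt f.1) u (X u) := rfl

theorem vectorDer_apply_of_eq {X : E → E} {hX : ContDiffOn ℝ ∞ X U} {f : smoothFun U} {g : E → ℝ}
    (h : ∀ u : U, f.1 u = g u) (u : U) :
    (vectorDer X hX f).1 u = fderiv ℝ g u (X u) := by
  rw [vectorDer_apply, (zeroExt_eventuallyEq h u).fderiv_eq]

/-- The commutator of two vector fields, as derivations. -/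
theorem vectorDer_commutator {X Y : E → E} {hX : ContDiffOn ℝ ∞ X U} {hY : ContDiffOn ℝ ∞ Y U}
    (f : smoothFun U) (u : U) :
    (vectorDer X hX (vectorDer Y hY f)).1 u = (vectorDer Y hY (vectorDer X hX f)).1 u
      + fderiv ℝ (zeroExt f.1) u (fderiv ℝ Y u (X u) - fderiv ℝ X u (Y u)) := by
  have hu := U.isOpen.mem_nhds u.2
  have hf2 : ContDiffAt ℝ ∞ (zeroExt f.1) u := f.2.contDiffAt hu
  have hf' : DifferentiableAt ℝ (fderiv ℝ (zeroExt f.1)) u :=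
    (hf2.fderiv_right (m := ∞) (by simp)).differentiableAt (by simp)
  have hX' : DifferentiableAt ℝ X u := (hX.contDiffAt hu).differentiableAt (by simp)
  have hY' : DifferentiableAt ℝ Y u := (hY.contDiffAt hu).differentiableAt (by simp)
  have hsymm : IsSymmSndFDerivAt ℝ (zeroExt f.1) (u : E) :=
    hf2.isSymmSndFDerivAt (by
      rw [minSmoothness_of_isRCLikeNormedField]
      exact WithTop.coe_le_coe.2 (le_top : (2 : ℕ∞) ≤ ⊤))
  rw [vectorDer_apply_of_eq (g := fun x => fderiv ℝ (zeroExt f.1) x (Y x))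
      (fun v => vectorDer_apply f v),
    vectorDer_apply_of_eq (g := fun x => fderiv ℝ (zeroExt f.1) x (X x))
      (fun v => vectorDer_apply f v),
    fderiv_clm_apply hf' hX', fderiv_clm_apply hf' hY']
  have := hsymm (X u) (Y u)
  simp [this]
  ring

end SmoothFunctions

/-! ### Total derivatives and coordinate derivatives on a fixed jet space -/

section JetAlgebra

variable {d m : ℕ}

/-- The jets over an open set of the total space, as an open set. -/
def jetOpens (W : TopologicalSpace.Opens (TotC d m)) (N : ℕ) :
    TopologicalSpace.Opens (JetC d m N) :=
  ⟨jetDomain W N, isOpen_jetDomain W.isOpen N⟩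

/-- The algebra of smooth functions on the `N`-jets over an open set of the total space. -/
abbrev JetFun (W : TopologicalSpace.Opens (TotC d m)) (N : ℕ) : Type :=
  smoothFun (jetOpens W N)

variable (W : TopologicalSpace.Opens (TotC d m)) (N : ℕ)

theorem totalLin_totalVec_comm (i j : Fin d) (u : JetC d m N) :
    totalLin N N j (totalVec N N i u) = totalLin N N i (totalVec N N j u) := by
  refine jetC_ext rfl fun σ I hI => ?_
  rw [dy_totalLin hI, dy_totalLin hI]
  by_cases h : I.card + 1 ≤ N
  · rw [dy_totalVec (by simpa using h), dy_totalVec (by simpa using h), Multiset.cons_swap]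
  · rw [dy_of_lt (by rw [Multiset.card_cons]; omega), dy_of_lt (by rw [Multiset.card_cons]; omega)]
    rfl

/-- The truncated total derivatives on `N`-jets.  They commute exactly, the components of order
`N` being set to zero. -/
def totalDer : CommutingDerivations d (JetFun W N) where
  der i := vectorDer (totalVec N N i) (contDiff_totalVec N N i).contDiffOn
  comm i j f := smoothFun.ext fun u => by
    rw [vectorDer_commutator, (hasFDerivAt_totalVec N N i _).fderiv,
      (hasFDerivAt_totalVec N N j _).fderiv, totalLin_totalVec_comm, sub_self, map_zero, add_zero]

/-- The derivation `∂/∂y^σ_I`. -/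
def partialDer (σ : Fin m) (I : Multiset (Fin d)) : Derivation ℝ (JetFun W N) (JetFun W N) :=
  vectorDer (fun _ => partialY N σ I) contDiffOn_const

variable {W N}

theorem totalDer_apply (i : Fin d) (f : JetFun W N) (u : jetOpens W N) :
    ((totalDer W N).der i f).1 u = fderiv ℝ (zeroExt f.1) u (totalVec N N i u) := rfl

theorem totalDer_apply_of_eq {i : Fin d} {f : JetFun W N} {g : JetC d m N → ℝ}
    (h : ∀ u : jetOpens W N, f.1 u = g u) (u : jetOpens W N) :
    ((totalDer W N).der i f).1 u = fderiv ℝ g u (totalVec N N i u) :=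
  vectorDer_apply_of_eq (hX := (contDiff_totalVec N N i).contDiffOn) h u

theorem totalLin_partialY (j : Fin d) (σ : Fin m) {I : Multiset (Fin d)} (hI : I.card ≤ N) :
    totalLin N N j (partialY N σ I) = if j ∈ I then partialY N σ (I.erase j) else 0 := by
  refine jetC_ext (by split_ifs <;> rfl) fun τ J hJ => ?_
  rw [dy_totalLin hJ]
  by_cases h : J.card + 1 ≤ N
  · rw [dy_partialY (by simpa using h)]
    by_cases hj : j ∈ I
    · rw [if_pos hj, dy_partialY hJ]
      congr 2
      rw [eq_iff_iff]
      constructor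
      · rintro rfl
        rw [Multiset.erase_cons_head]
      · rintro rfl
        rw [Multiset.cons_erase hj]
    · rw [if_neg hj, map_zero, if_neg]
      rintro ⟨_, rfl⟩
      exact hj (Multiset.mem_cons_self j J)
  · rw [dy_of_lt (by rw [Multiset.card_cons]; omega)]
    split_ifs with hj
    · rw [dy_partialY hJ, if_neg]
      · rfl
      · rintro ⟨_, rfl⟩
        rw [Multiset.card_erase_of_mem hj] at h
        have := Multiset.card_pos_iff_exists_mem.2 ⟨j, hj⟩
        rw [Nat.pred_eq_sub_one] at h
        omega
    · simp

theorem partialDer_totalDer (σ : Fin m) {I : Multiset (Fin d)} (hI : I.card ≤ N) (j : Fin d)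
    (f : JetFun W N) :
    partialDer W N σ I ((totalDer W N).der j f) = (totalDer W N).der j (partialDer W N σ I f)
      + if j ∈ I then partialDer W N σ (I.erase j) f else 0 := by
  refine smoothFun.ext fun u => ?_
  refine (vectorDer_commutator (hY := (contDiff_totalVec N N j).contDiffOn) f u).trans ?_
  rw [(hasFDerivAt_totalVec N N j _).fderiv, totalLin_partialY j σ hI]
  split_ifs
  · simp only [fderiv_fun_const, Pi.zero_apply, zero_apply, sub_zero]
    rfl
  · simp only [fderiv_fun_const, Pi.zero_apply, zero_apply, sub_zero, map_zero]
    rfl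

/-! ### Horizontal forms and their formal derivatives -/

/-- The horizontal form on `k`-jets given by a constant form on the base. -/
def horForm {q : ℕ} (k : ℕ) (α : (Fin d → ℝ) [⋀^Fin q]→L[ℝ] ℝ) :
    (JetC d m k) [⋀^Fin q]→L[ℝ] ℝ :=
  α.compContinuousLinearMap (ContinuousLinearMap.fst ℝ _ _)

theorem horForm_comp_jetProj {q K k : ℕ} (α : (Fin d → ℝ) [⋀^Fin q]→L[ℝ] ℝ) :
    (horForm (m := m) k α).compContinuousLinearMap (jetProj K k) = horForm K α := rfl

/-- The form `θ` on `k`-jets, pulled back to `N`-jets, is the horizontal form `∑ g_a α_a` with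
smooth coefficients `g_a`, the `α_a` being constant forms on the base. -/
def HasCoeff {ι : Type*} [Fintype ι] {k q : ℕ} (θ : Form d m k q)
    (α : ι → (Fin d → ℝ) [⋀^Fin q]→L[ℝ] ℝ) (g : ι → JetFun W N) : Prop :=
  ∀ u : jetOpens W N, pull N θ u = ∑ a, (g a).1 u • horForm N (α a)

section HasCoeff

variable {ι : Type*} [Fintype ι] {k q : ℕ} {θ θ' : Form d m k q}
  {α : ι → (Fin d → ℝ) [⋀^Fin q]→L[ℝ] ℝ} {g g' : ι → JetFun W N}
theorem HasCoeff.congr_coeff (h : HasCoeff θ α g) (hg : ∀ a, g' a = g a) : HasCoeff θ α g' := by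
  rwa [funext hg]

theorem HasCoeff.apply_jetProj (h : HasCoeff θ α g) (hk : k ≤ N) (u : jetOpens W N) :
    θ (jetProj N k u) = ∑ a, (g a).1 u • horForm k (α a) := by
  have h1 := congrArg (fun β => β.compContinuousLinearMap (jetProj k N)) (h u)
  have h2 : (pull N θ u).compContinuousLinearMap (jetProj k N) = θ (jetProj N k u) := by
    ext v
    simp [pull, Function.comp_def, jetProj_jetProj_self hk]
  simp only [h2] at h1
  rw [h1]
  ext v
  simp [horForm, Function.comp_def]

theorem HasCoeff.apply (h : HasCoeff θ α g) (hk : k ≤ N) {u : JetC d m k}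
    (hu : u ∈ jetDomain W k) :
    θ u = ∑ a, zeroExt (g a).1 (jetProj k N u) • horForm k (α a) := by
  have hu' : jetProj k N u ∈ jetOpens W N := jetProj_mem_jetDomain.2 hu
  have h1 := h.apply_jetProj hk ⟨_, hu'⟩
  rw [jetProj_jetProj_self hk] at h1
  rw [h1]
  refine Finset.sum_congr rfl fun a _ => ?_
  rw [← zeroExt_apply (g a).1]

theorem HasCoeff.contDiffOn (h : HasCoeff θ α g) (hk : k ≤ N) :
    ContDiffOn ℝ ∞ θ (jetDomain W k) := by
  refine ContDiffOn.congr (f := fun u => ∑ a, zeroExt (g a).1 (jetProj k N u) • horForm k (α a))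
    ?_ fun u hu => h.apply hk hu
  refine ContDiffOn.sum fun a _ => ContDiffOn.fun_smul ?_ contDiffOn_const
  exact (contDiffOn_zeroExt (g a)).comp (jetProj k N).contDiff.contDiffOn
    fun u hu => jetProj_mem_jetDomain.2 hu

theorem HasCoeff.pullBack (h : HasCoeff θ α g) {K : ℕ} (hK : k ≤ K) :
    HasCoeff (pull K θ) α g := fun u => by
  rw [pull_pull hK, h u]

theorem HasCoeff.add (h : HasCoeff θ α g) (h' : HasCoeff θ' α g') :
    HasCoeff (fun u => θ u + θ' u) α (fun a => g a + g' a) := fun u => by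
  have h1 : pull N (fun u => θ u + θ' u) u
    = pull N θ u + pull N θ' u := rfl
  rw [h1, h u, h' u, ← Finset.sum_add_distrib]
  refine Finset.sum_congr rfl fun a _ => ?_
  rw [← add_smul]
  rfl

theorem HasCoeff.smul (h : HasCoeff θ α g) (c : ℝ) :
    HasCoeff (fun u => c • θ u) α (fun a => c • g a) := fun u => by
  have h1 : pull N (fun u => c • θ u) u = c • pull N θ u := rfl
  rw [h1, h u, Finset.smul_sum]
  refine Finset.sum_congr rfl fun a _ => ?_
  rw [smul_smul]
  rfl

theorem HasCoeff.sum {κ : Type*} {s : Finset κ} {Θ : κ → Form d m k q} {G : κ → ι → JetFun W N}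
    (h : ∀ b ∈ s, HasCoeff (Θ b) α (G b)) :
    HasCoeff (fun u => ∑ b ∈ s, Θ b u) α (fun a => ∑ b ∈ s, G b a) := fun u => by
  have h1 : pull N (fun u => ∑ b ∈ s, Θ b u) u
      = ∑ b ∈ s, pull N (Θ b) u := by
    ext v
    simp [pull]
  rw [h1, Finset.sum_congr rfl fun b hb => h b hb u, Finset.sum_comm]
  refine Finset.sum_congr rfl fun a _ => ?_
  rw [smoothFun.sum_apply, Finset.sum_smul]

/-- The curve of jets `u + t d_i`, at the level of `N`-jets, computes formal derivatives. -/
theorem formalD_jetProj (hk : k + 1 ≤ N) (i : Fin d) (θ : Form d m k q) (u : JetC d m N) :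
    formalD i θ (jetProj N (k + 1) u) = deriv (fun t : ℝ =>
      (θ (jetProj N k (u + t • totalVec N N i u))).compContinuousLinearMap
        (jetProj (k + 1) k + t • totalLin (k + 1) k i)) 0 := by
  rw [formalD]
  congr 1
  funext t
  rw [(hasFDerivAt_totalVec (k + 1) k i _).fderiv, jetProj_jetProj (by omega),
    totalVec_jetProj le_rfl, map_add, map_smul, jetProj_totalVec (by omega)]

theorem eventually_add_smul_mem (u : jetOpens W N) (v : JetC d m N) :
    ∀ᶠ t in 𝓝 (0 : ℝ), (u : JetC d m N) + t • v ∈ jetOpens W N := by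
  have hc : ContinuousAt (fun t : ℝ => (u : JetC d m N) + t • v) 0 := by fun_prop
  exact hc.eventually_mem ((jetOpens W N).isOpen.mem_nhds (by simp))

theorem hasDerivAt_zeroExt_line (f : JetFun W N) (u : jetOpens W N) (v : JetC d m N) :
    HasDerivAt (fun t : ℝ => zeroExt f.1 ((u : JetC d m N) + t • v))
      (fderiv ℝ (zeroExt f.1) u v) 0 := by
  have h1 : HasDerivAt (fun t : ℝ => (u : JetC d m N) + t • v) v 0 := by
    have := ((hasDerivAt_id (0 : ℝ)).smul_const v).const_add (u : JetC d m N)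
    rwa [one_smul] at this
  have h2 : HasFDerivAt (zeroExt f.1) (fderiv ℝ (zeroExt f.1) u) 
      ((u : JetC d m N) + (0 : ℝ) • v) := by
    rw [zero_smul, add_zero]
    exact (smoothFun_differentiableAt f u).hasFDerivAt
  exact h2.comp_hasDerivAt 0 h1

/-- Formal derivatives of horizontal forms act on the coefficients. -/
theorem HasCoeff.formalD (h : HasCoeff θ α g) (hk : k + 1 ≤ N) (i : Fin d) :
    HasCoeff (formalD i θ) α (fun a => (totalDer W N).der i (g a)) := fun u => by
  have h1 : HasDerivAt (fun t : ℝ =>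
      (θ (jetProj N k ((u : JetC d m N) + t • totalVec N N i u))).compContinuousLinearMap
        (jetProj (k + 1) k + t • totalLin (k + 1) k i))
      (∑ a, ((totalDer W N).der i (g a)).1 u • horForm (k + 1) (α a)) 0 := by
    have h2 : HasDerivAt (fun t : ℝ => ∑ a,
        zeroExt (g a).1 ((u : JetC d m N) + t • totalVec N N i u) • horForm (m := m) (k + 1) (α a))
        (∑ a, ((totalDer W N).der i (g a)).1 u • horForm (k + 1) (α a)) 0 :=
      HasDerivAt.fun_sum fun a _ => by
        rw [totalDer_apply]
        exact (hasDerivAt_zeroExt_line (g a) u (totalVec N N i u)).smul_const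
          (horForm (m := m) (k + 1) (α a))
    refine h2.congr_of_eventuallyEq ?_
    filter_upwards [eventually_add_smul_mem u (totalVec N N i u)] with t ht
    rw [h.apply_jetProj (by omega) ⟨_, ht⟩]
    ext v
    simp [horForm, Function.comp_def, ← zeroExt_apply]
  rw [pull, formalD_jetProj hk, h1.deriv]
  ext v
  simp [horForm, Function.comp_def]

theorem HasCoeff.formalDs (h : HasCoeff θ α g) (l : ℕ) (I : Fin l → Fin d) (hk : k + l ≤ N) :
    HasCoeff (formalDs l I θ) α (fun a => (totalDer W N).iter (tupleIdx I) (g a)) := by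
  induction l with
  | zero => exact h.congr_coeff fun a => by simp [tupleIdx]
  | succ l ih =>
    rw [tupleIdx_succ_last]
    simp only [CommutingDerivations.iter_cons]
    exact (ih (fun a => I a.castSucc) (by omega)).formalD (by omega) (I (Fin.last l))

end HasCoeff

end JetAlgebra

/-! ### Wedge products with the volume element -/

section Wedge

variable {d m : ℕ}

theorem wedgeOne_apply {k q : ℕ} (β : JetC d m k →L[ℝ] ℝ) (θ : (JetC d m k) [⋀^Fin q]→L[ℝ] ℝ)
    (v : Fin (q + 1) → JetC d m k) :
    wedgeOne β θ v = ∑ i : Fin (q + 1), (-1 : ℝ) ^ (i : ℕ) * (β (v i) * θ (i.removeNth v)) := by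
  rw [wedgeOne, ContinuousAlternatingMap.alternatizeUncurryFin_apply]
  refine Finset.sum_congr rfl fun i _ => ?_
  simp

theorem wedgeOne_add {k q : ℕ} (β : JetC d m k →L[ℝ] ℝ) (θ θ' : (JetC d m k) [⋀^Fin q]→L[ℝ] ℝ) :
    wedgeOne β (θ + θ') = wedgeOne β θ + wedgeOne β θ' := by
  ext v
  simp [wedgeOne_apply, mul_add, Finset.sum_add_distrib]

theorem wedgeOne_smul {k q : ℕ} (β : JetC d m k →L[ℝ] ℝ) (c : ℝ)
    (θ : (JetC d m k) [⋀^Fin q]→L[ℝ] ℝ) : wedgeOne β (c • θ) = c • wedgeOne β θ := by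
  ext v
  simp only [wedgeOne_apply, ContinuousAlternatingMap.smul_apply, smul_eq_mul, Finset.mul_sum]
  exact Finset.sum_congr rfl fun i _ => by ring

theorem wedgeOne_sum {k q : ℕ} {ι : Type*} (s : Finset ι) (β : JetC d m k →L[ℝ] ℝ)
    (θ : ι → (JetC d m k) [⋀^Fin q]→L[ℝ] ℝ) :
    wedgeOne β (∑ a ∈ s, θ a) = ∑ a ∈ s, wedgeOne β (θ a) := by
  classical
  induction s using Finset.induction_on with
  | empty =>
    ext v
    simp [wedgeOne_apply]
  | insert a s ha ih => rw [Finset.sum_insert ha, Finset.sum_insert ha, wedgeOne_add, ih]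

theorem add_wedgeOne {k q : ℕ} (β β' : JetC d m k →L[ℝ] ℝ) (θ : (JetC d m k) [⋀^Fin q]→L[ℝ] ℝ) :
    wedgeOne (β + β') θ = wedgeOne β θ + wedgeOne β' θ := by
  ext v
  simp [wedgeOne_apply, mul_add, add_mul, Finset.sum_add_distrib]

theorem smul_wedgeOne {k q : ℕ} (c : ℝ) (β : JetC d m k →L[ℝ] ℝ)
    (θ : (JetC d m k) [⋀^Fin q]→L[ℝ] ℝ) : wedgeOne (c • β) θ = c • wedgeOne β θ := by
  ext v
  simp only [wedgeOne_apply, ContinuousAlternatingMap.smul_apply, smul_eq_mul, Finset.mul_sum,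
    smul_apply]
  exact Finset.sum_congr rfl fun i _ => by ring

theorem sum_wedgeOne {k q : ℕ} {ι : Type*} (s : Finset ι) (β : ι → JetC d m k →L[ℝ] ℝ)
    (θ : (JetC d m k) [⋀^Fin q]→L[ℝ] ℝ) :
    wedgeOne (∑ a ∈ s, β a) θ = ∑ a ∈ s, wedgeOne (β a) θ := by
  classical
  induction s using Finset.induction_on with
  | empty =>
    ext v
    simp [wedgeOne_apply]
  | insert a s ha ih => rw [Finset.sum_insert ha, Finset.sum_insert ha, add_wedgeOne, ih]

theorem wedgeOne_comp_jetProj {K k q : ℕ} (β : JetC d m k →L[ℝ] ℝ)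
    (θ : (JetC d m k) [⋀^Fin q]→L[ℝ] ℝ) :
    (wedgeOne β θ).compContinuousLinearMap (jetProj K k)
      = wedgeOne (β.comp (jetProj K k)) (θ.compContinuousLinearMap (jetProj K k)) := by
  ext v
  simp only [ContinuousAlternatingMap.compContinuousLinearMap_apply, wedgeOne_apply]
  rfl

/-- The interior product is an antiderivation. -/
theorem curryLeft_wedgeOne {k q : ℕ} (β : JetC d m k →L[ℝ] ℝ)
    (θ : (JetC d m k) [⋀^Fin (q + 1)]→L[ℝ] ℝ) (v : JetC d m k) :
    (wedgeOne β θ).curryLeft v = β v • θ - wedgeOne β (θ.curryLeft v) := by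
  ext w
  rw [ContinuousAlternatingMap.curryLeft_apply_apply, wedgeOne_apply, Fin.sum_univ_succ,
    ContinuousAlternatingMap.sub_apply, wedgeOne_apply, sub_eq_add_neg, ← Finset.sum_neg_distrib]
  congr 1
  · simp
  · refine Finset.sum_congr rfl fun i _ => ?_
    rw [ContinuousAlternatingMap.curryLeft_apply_apply]
    have : i.succ.removeNth (Matrix.vecCons v w) = Matrix.vecCons v (i.removeNth w) :=
      funext fun j => Fin.cases (by simp [Fin.removeNth]) (fun j => by simp [Fin.removeNth]) j
    simp only [this, Matrix.cons_val_succ, Fin.val_succ, pow_succ]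
    ring

/-- A vertical vector inserted in `β ∧ α`, where `α` is horizontal, only meets `β`. -/
theorem curryLeft_wedgeOne_horForm {k q : ℕ} (β : JetC d m k →L[ℝ] ℝ)
    (α : (Fin d → ℝ) [⋀^Fin q]→L[ℝ] ℝ) {v : JetC d m k} (hv : v.1 = 0) :
    (wedgeOne β (horForm k α)).curryLeft v = β v • horForm k α := by
  cases q with
  | zero =>
    ext w
    have h (w' : Fin 0 → JetC d m k) : horForm k α w' = horForm k α w :=
      congrArg _ (Subsingleton.elim _ _)
    simp [ContinuousAlternatingMap.curryLeft_apply_apply, wedgeOne_apply, h]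
  | succ q =>
    rw [curryLeft_wedgeOne]
    have h : (horForm k α).curryLeft v = 0 := by
      ext w
      rw [ContinuousAlternatingMap.curryLeft_apply_apply]
      exact α.map_coord_zero 0 hv
    rw [h, sub_eq_self]
    ext w
    simp [wedgeOne_apply]

/-- The volume element of the base. -/
def baseVol (d : ℕ) : (Fin d → ℝ) [⋀^Fin d]→L[ℝ] ℝ :=
  { (Matrix.detRowAlternating : (Fin d → ℝ) [⋀^Fin d]→ₗ[ℝ] ℝ) with
    cont := Continuous.matrix_det continuous_id }

theorem baseVol_single (d : ℕ) : baseVol d (fun i => Pi.single i 1) = 1 := by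
  have h : Matrix.of (fun i => Pi.single i (1 : ℝ)) = (1 : Matrix (Fin d) (Fin d) ℝ) := by
    ext i j
    rcases eq_or_ne i j with rfl | h
    · simp
    · simp [h, h.symm]
  exact (congrArg Matrix.det h).trans Matrix.det_one

theorem eq_smul_baseVol (α : (Fin d → ℝ) [⋀^Fin d]→L[ℝ] ℝ) :
    α = α (fun i => Pi.single i 1) • baseVol d := by
  refine ContinuousAlternatingMap.toAlternatingMap_injective ?_
  refine Module.Basis.ext_alternating (Pi.basisFun ℝ (Fin d)) fun v hv => ?_
  obtain ⟨e, rfl⟩ : ∃ e : Equiv.Perm (Fin d), ⇑e = v :=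
    ⟨Equiv.ofBijective v (Finite.injective_iff_bijective.1 hv), rfl⟩
  have h (β : (Fin d → ℝ) [⋀^Fin d]→ₗ[ℝ] ℝ) :
      β (fun i => Pi.basisFun ℝ (Fin d) (e i))
        = Equiv.Perm.sign e • β (fun i => Pi.single i 1) := by
    rw [← AlternatingMap.map_perm]
    simp [Function.comp_def]
  rw [h, h]
  change _ • α _ = _ • (α _ * baseVol d _)
  rw [baseVol_single, mul_one]

theorem horForm_baseVol_totalVec {K k : ℕ} (u : JetC d m K) :
    horForm (m := m) k (baseVol d) (fun i => totalVec K k i u) = 1 :=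
  baseVol_single d

theorem horForm_baseVol_partialX (k : ℕ) :
    horForm (m := m) k (baseVol d) (fun i => partialX k i) = 1 :=
  baseVol_single d

theorem volForm_eq (n k : ℕ) : volForm (n := n) (m := m) k = horForm k (baseVol (n + 1)) := rfl

/-- The contractions of the volume element of the base with the coordinate vectors. -/
def baseVolContr (n : ℕ) (j : Fin (n + 1)) : (Fin (n + 1) → ℝ) [⋀^Fin n]→L[ℝ] ℝ :=
  (baseVol (n + 1)).curryLeft (Pi.single j 1)

theorem volFormContr_eq (n k : ℕ) (j : Fin (n + 1)) :
    volFormContr (n := n) (m := m) k j = horForm k (baseVolContr n j) := by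
  ext w
  rw [volFormContr, ContinuousAlternatingMap.curryLeft_apply_apply, volForm_eq]
  simp only [horForm, ContinuousAlternatingMap.compContinuousLinearMap_apply, baseVolContr,
    ContinuousAlternatingMap.curryLeft_apply_apply]
  congr 1
  funext i
  refine Fin.cases rfl (fun i => rfl) i

theorem wedgeOne_dx_baseVol (k : ℕ) (i : Fin d) :
    wedgeOne (dx (m := m) k i) (horForm k (baseVol d)) = 0 := by
  set γ : (Fin d → ℝ) [⋀^Fin (d + 1)]→L[ℝ] ℝ := ContinuousAlternatingMap.alternatizeUncurryFin
    ((ContinuousLinearMap.proj (R := ℝ) (φ := fun _ : Fin d => ℝ) i).smulRight (baseVol d)) with hγ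
  have h : wedgeOne (dx (m := m) k i) (horForm k (baseVol d)) = horForm k γ := by
    ext v
    rw [wedgeOne_apply, horForm, horForm, ContinuousAlternatingMap.compContinuousLinearMap_apply,
      hγ, ContinuousAlternatingMap.alternatizeUncurryFin_apply]
    refine Finset.sum_congr rfl fun j _ => ?_
    simp only [smul_eq_mul, ContinuousLinearMap.smulRight_apply, zsmul_eq_mul,
      ContinuousAlternatingMap.smul_apply]
    push_cast
    rfl
  rw [h]
  ext v
  refine AlternatingMap.map_linearDependent (K := ℝ) γ.toAlternatingMap _ fun hli => ?_
  have := hli.fintype_card_le_finrank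
  simp at this

/-- `dx^i ∧ ds_j = δ^i_j ds`. -/
theorem wedgeOne_dx_baseVolContr (n k : ℕ) (i j : Fin (n + 1)) :
    wedgeOne (dx (m := m) k i) (horForm k (baseVolContr n j))
      = if i = j then horForm k (baseVol (n + 1)) else 0 := by
  have h := curryLeft_wedgeOne (dx (m := m) k i) (horForm k (baseVol (n + 1))) (partialX k j)
  rw [wedgeOne_dx_baseVol, ← volForm_eq, ← volFormContr, volFormContr_eq] at h
  have h0 : (0 : (JetC (n + 1) m k) [⋀^Fin (n + 1 + 1)]→L[ℝ] ℝ).curryLeft (partialX k j) = 0 := rfl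
  rw [h0, eq_comm, sub_eq_zero] at h
  rw [← h, dx_apply, partialX, volForm_eq]
  split_ifs with hij
  · simp [hij]
  · simp [hij]

/-- Inserting a vector in the volume element. -/
theorem curryLeft_horForm_baseVol (n k : ℕ) (v : JetC (n + 1) m k) :
    (horForm k (baseVol (n + 1))).curryLeft v = ∑ j, v.1 j • horForm k (baseVolContr n j) := by
  ext w
  simp only [ContinuousAlternatingMap.curryLeft_apply_apply, ContinuousAlternatingMap.sum_apply,
    ContinuousAlternatingMap.smul_apply]
  have h1 : horForm k (baseVol (n + 1)) (Matrix.vecCons v w)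
      = (baseVol (n + 1)).curryLeft v.1 (fun i => (w i).1) := by
    rw [ContinuousAlternatingMap.curryLeft_apply_apply, horForm,
      ContinuousAlternatingMap.compContinuousLinearMap_apply]
    congr 1
    funext i
    refine Fin.cases rfl (fun i => rfl) i
  have h2 : v.1 = ∑ j, v.1 j • (Pi.single j 1 : Fin (n + 1) → ℝ) := by
    funext i
    simp [Finset.sum_apply, Pi.single_apply]
  rw [h1]
  conv_lhs => rw [h2]
  rw [map_sum, ContinuousAlternatingMap.sum_apply]
  refine Finset.sum_congr rfl fun j _ => ?_
  rw [map_smul]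
  rfl

end Wedge

/-! ### The contact components of a form -/

section Contact

variable {d m : ℕ}

theorem hMap_apply (k : ℕ) (u v : JetC d m (k + 1)) :
    hMap k u v = ∑ i, v.1 i • totalVec (k + 1) k i u := by
  simp [hMap]

/-- A form of degree `dim X`, evaluated on horizontal projections, is a multiple of `ds`. -/
theorem comp_hMap {k : ℕ} (θ : (JetC d m k) [⋀^Fin d]→L[ℝ] ℝ) (u : JetC d m (k + 1)) :
    θ.compContinuousLinearMap (hMap k u)
      = θ (fun i => totalVec (k + 1) k i u) • horForm (k + 1) (baseVol d) := by
  set T : (Fin d → ℝ) →L[ℝ] JetC d m k := ∑ i,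
    (ContinuousLinearMap.proj (R := ℝ) (φ := fun _ : Fin d => ℝ) i).smulRight
      (totalVec (k + 1) k i u) with hT
  have hTs (i : Fin d) : T (Pi.single i 1) = totalVec (k + 1) k i u := by
    simp [hT, Pi.single_apply]
  have h1 := congrArg (horForm (m := m) (k + 1)) (eq_smul_baseVol (θ.compContinuousLinearMap T))
  have h2 : (θ.compContinuousLinearMap T) (fun i => Pi.single i 1)
      = θ (fun i => totalVec (k + 1) k i u) := by
    simp [Function.comp_def, hTs]
  rw [h2] at h1
  have h3 : θ.compContinuousLinearMap (hMap k u)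
      = horForm (k + 1) (θ.compContinuousLinearMap T) := by
    ext v
    simp only [horForm, ContinuousAlternatingMap.compContinuousLinearMap_apply]
    congr 1
    funext i
    simp [hMap_apply, hT]
  rw [h3, h1]
  rfl

/-- `∂/∂y^σ_I ⌋ p_1 ρ` in terms of horizontal projections: the vertical vector has to be inserted
in the contact slot. -/
theorem contactOne_curryLeft_partialY {s q : ℕ} (ρ : Form d m s (q + 1)) (u : JetC d m (s + 1))
    (σ : Fin m) (I : Multiset (Fin d)) :
    (contactOne ρ u).curryLeft (partialY (s + 1) σ I) =
      ((ρ (jetProj (s + 1) s u)).curryLeft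
        (jetProj (s + 1) s (partialY (s + 1) σ I))).compContinuousLinearMap (hMap s u) := by
  have hh : hMap s u (partialY (s + 1) σ I) = 0 := by simp [hMap_apply]
  have hp : pMap s u (partialY (s + 1) σ I) = jetProj (s + 1) s (partialY (s + 1) σ I) := by
    simp [pMap, hh]
  ext w
  rw [ContinuousAlternatingMap.curryLeft_apply_apply, contactOne,
    ContinuousAlternatingMap.alternatizeUncurryFin_apply, Fin.sum_univ_succ,
    Finset.sum_eq_zero, add_zero]
  · simp only [Fin.val_zero, pow_zero, one_smul, Matrix.cons_val_zero,
      ContinuousLinearMap.coe_comp, Function.comp_apply, hp]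
    congr 1
  · intro i _
    rw [smul_eq_zero]
    right
    simp only [ContinuousLinearMap.coe_comp, Function.comp_apply,
      ContinuousAlternatingMap.compContinuousLinearMapCLM_apply,
      ContinuousAlternatingMap.compContinuousLinearMap_apply]
    cases q with
    | zero => exact i.elim0
    | succ q =>
      refine ContinuousAlternatingMap.map_coord_zero _ (0 : Fin (q + 1)) ?_
      simpa [Fin.removeNth] using hh

end Contact

/-! ### Coefficients of the Euler–Lagrange form -/

section Smooth

variable {E F : Type*} [NormedAddCommGroup E] [NormedSpace ℝ E]
  [NormedAddCommGroup F] [NormedSpace ℝ F]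

theorem contDiffOn_multilinear_apply {q : ℕ} {s : Set E}
    {θ : E → ContinuousMultilinearMap ℝ (fun _ : Fin q => F) ℝ} {v : Fin q → E → F}
    (hθ : ContDiffOn ℝ ∞ θ s) (hv : ∀ i, ContDiffOn ℝ ∞ (v i) s) :
    ContDiffOn ℝ ∞ (fun u => θ u (fun i => v i u)) s := by
  induction q with
  | zero =>
    refine (((ContinuousMultilinearMap.apply ℝ (fun _ : Fin 0 => F) ℝ 0).contDiff).comp_contDiffOn
      hθ).congr fun u _ => ?_
    simp only [Function.comp_apply, ContinuousMultilinearMap.apply_apply]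
    exact congrArg _ (Subsingleton.elim _ _)
  | succ q ih =>
    let c : ContinuousMultilinearMap ℝ (fun _ : Fin (q + 1) => F) ℝ →L[ℝ]
        F →L[ℝ] ContinuousMultilinearMap ℝ (fun _ : Fin q => F) ℝ :=
      { toFun φ := φ.curryLeft
        map_add' _ _ := rfl
        map_smul' _ _ := rfl
        cont := (continuousMultilinearCurryLeftEquiv ℝ (fun _ : Fin (q + 1) => F) ℝ).continuous }
    have h0 : ContDiff ℝ ∞ c :=
      ContinuousLinearMap.contDiff (𝕜 := ℝ)
        (E := ContinuousMultilinearMap ℝ (fun _ : Fin (q + 1) => F) ℝ)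
        (F := F →L[ℝ] ContinuousMultilinearMap ℝ (fun _ : Fin q => F) ℝ) c
    have h1 : ContDiffOn ℝ ∞ (fun u => (θ u).curryLeft (v 0 u)) s :=
      (h0.comp_contDiffOn hθ).clm_apply (hv 0)
    refine (ih h1 fun i => hv i.succ).congr fun u _ => ?_
    rw [ContinuousMultilinearMap.curryLeft_apply]
    exact congrArg _ (funext fun i => Fin.cases rfl (fun _ => rfl) i)

theorem contDiffOn_alternating_apply {q : ℕ} {s : Set E}
    {θ : E → F [⋀^Fin q]→L[ℝ] ℝ} {v : Fin q → E → F}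
    (hθ : ContDiffOn ℝ ∞ θ s) (hv : ∀ i, ContDiffOn ℝ ∞ (v i) s) :
    ContDiffOn ℝ ∞ (fun u => θ u (fun i => v i u)) s :=
  contDiffOn_multilinear_apply
    ((ContinuousAlternatingMap.toContinuousMultilinearMapCLM ℝ :
      (F [⋀^Fin q]→L[ℝ] ℝ) →L[ℝ] _).contDiff.comp_contDiffOn hθ) hv

end Smooth

section Eta

variable {d m N : ℕ} {W : TopologicalSpace.Opens (TotC d m)}

/-- A form of degree `dim X` whose pull-back to `N`-jets is `f ds`. -/
abbrev HasVolCoeff {k : ℕ} (θ : Form d m k d) (f : JetFun W N) : Prop :=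
  HasCoeff θ (fun _ : Unit => baseVol d) (fun _ => f)

theorem hasVolCoeff_iff {k : ℕ} {θ : Form d m k d} {f : JetFun W N} :
    HasVolCoeff θ f ↔ ∀ u : jetOpens W N, pull N θ u = f.1 u • horForm N (baseVol d) := by
  simp [HasVolCoeff, HasCoeff]

theorem contDiffOn_pull {s q : ℕ} {ρ : Form d m s q} (hρ : ContDiffOn ℝ ∞ ρ (jetDomain W s)) :
    ContDiffOn ℝ ∞ (pull N ρ) (jetDomain W N) :=
  (ContinuousAlternatingMap.compContinuousLinearMapCLM (jetProj N s) :
    ((JetC d m s) [⋀^Fin q]→L[ℝ] ℝ) →L[ℝ] _).contDiff.comp_contDiffOn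
    (hρ.comp (jetProj N s).contDiff.contDiffOn fun _ hu => jetProj_mem_jetDomain.2 hu)

/-- The form `ρ`, pulled back to `N`-jets and evaluated on the total derivatives: the coefficient of
`hρ`. -/
def lagrFun {s : ℕ} (ρ : Form d m s d) (hρ : ContDiffOn ℝ ∞ ρ (jetDomain W s)) : JetFun W N :=
  smoothFun.of (fun u => pull N ρ u fun i => totalVec N N i u)
    (contDiffOn_alternating_apply (contDiffOn_pull hρ)
      fun i => (contDiff_totalVec N N i).contDiffOn)

theorem hasVolCoeff_horizontal {s : ℕ} (ρ : Form d m s d)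
    (hρ : ContDiffOn ℝ ∞ ρ (jetDomain W s)) (hs : s + 1 ≤ N) :
    HasVolCoeff (horizontal ρ) (lagrFun (N := N) ρ hρ) := by
  rw [hasVolCoeff_iff]
  intro u
  have h1 : horizontal ρ (jetProj N (s + 1) u)
      = ρ (jetProj N s u) (fun i => totalVec N s i u) • horForm (s + 1) (baseVol d) := by
    rw [horizontal, comp_hMap, jetProj_jetProj (Nat.le_succ s)]
    congr 2
    funext i
    exact totalVec_jetProj le_rfl i _
  rw [pull, h1, lagrFun, smoothFun.of_apply, pull,
    ContinuousAlternatingMap.compContinuousLinearMap_apply]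
  have h2 : (⇑(jetProj N s) ∘ fun i => totalVec N N i (u : JetC d m N))
      = fun i => totalVec N s i (u : JetC d m N) :=
    funext fun i => jetProj_totalVec (by omega) i _
  rw [h2]
  rfl

/-- The coefficient of a horizontal form does not depend on the jet coordinates of order exceeding
the order of the form.  The functional `Φ` extracts the coefficient in question. -/
theorem HasCoeff.partialDer_eq_zero {ι : Type*} [Fintype ι] {k q : ℕ} {θ : Form d m k q}
    {α : ι → (Fin d → ℝ) [⋀^Fin q]→L[ℝ] ℝ} {g : ι → JetFun W N} (h : HasCoeff θ α g) (a : ι)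
    (Φ : (JetC d m N) [⋀^Fin q]→L[ℝ] ℝ → ℝ)
    (hΦ : ∀ c : ι → ℝ, Φ (∑ b, c b • horForm N (α b)) = c a)
    (σ : Fin m) {I : Multiset (Fin d)} (hI : k < I.card) :
    partialDer W N σ I (g a) = 0 := by
  refine smoothFun.ext fun u => ?_
  have h1 := hasDerivAt_zeroExt_line (g a) u (partialY N σ I)
  have h2 : (fun t : ℝ => zeroExt (g a).1 ((u : JetC d m N) + t • partialY N σ I))
      =ᶠ[𝓝 0] fun _ => Φ (pull N θ u) := by
    filter_upwards [eventually_add_smul_mem u (partialY N σ I)] with t ht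
    rw [zeroExt_apply _ (⟨_, ht⟩ : jetOpens W N), ← hΦ fun b => (g b).1 ⟨_, ht⟩,
      ← h ⟨_, ht⟩]
    congr 1
    have h0 : jetProj N k (partialY N σ I) = 0 := by
      rw [jetProj_partialY, partialY_of_lt σ hI, ite_self]
    simp only [pull, map_add, map_smul, h0, smul_zero, add_zero]
  exact h1.unique ((hasDerivAt_const (0 : ℝ) (Φ (pull N θ u))).congr_of_eventuallyEq h2)

theorem HasVolCoeff.partialDer_eq_zero {k : ℕ} {θ : Form d m k d} {f : JetFun W N}
    (h : HasVolCoeff θ f) (σ : Fin m) {I : Multiset (Fin d)} (hI : k < I.card) :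
    partialDer W N σ I f = 0 :=
  HasCoeff.partialDer_eq_zero h () (fun β => β fun i => partialX N i) (fun c => by
    simp [horForm_baseVol_partialX]) σ hI

/-- `∂/∂y^σ_I ⌋ p_1 β` is horizontal, with coefficient `β(∂/∂y^σ_I, d_1, …, d_n)`. -/
theorem hasVolCoeff_etaForm {n s : ℕ} {W : TopologicalSpace.Opens (TotC (n + 1) m)}
    {β : Form (n + 1) m s (n + 2)} {σ : Fin m}
    {I : Multiset (Fin (n + 1))} {P : JetFun W N} (hs : s + 1 ≤ N)
    (hP : ∀ u : jetOpens W N, P.1 u =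
      pull N β u (Matrix.vecCons (partialY N σ I) fun i => totalVec N N i u))
    (hI : I.card ≤ N) :
    HasVolCoeff (etaForm β σ I) (idxWeight I • P) := by
  rw [hasVolCoeff_iff]
  intro u
  have hp : jetProj (s + 1) s (partialY (m := m) (s + 1) σ I)
      = jetProj N s (partialY N σ I) := by
    rw [jetProj_partialY, jetProj_partialY, if_pos hI]
    split_ifs with h
    · rfl
    · rw [partialY_of_lt σ (by omega)]
  have h1 : etaForm β σ I (jetProj N (s + 1) u)
      = (idxWeight I * P.1 u) • horForm (s + 1) (baseVol (n + 1)) := by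
    rw [etaForm, contactOne_curryLeft_partialY, comp_hMap, hp, smul_smul, hP,
      jetProj_jetProj (Nat.le_succ s), pull,
      ContinuousAlternatingMap.compContinuousLinearMap_apply,
      ContinuousAlternatingMap.curryLeft_apply_apply]
    congr 4
    funext i
    refine Fin.cases rfl (fun i => ?_) i
    simp only [Matrix.cons_val_succ, Function.comp_apply]
    rw [totalVec_jetProj le_rfl, jetProj_totalVec (by omega)]
  rw [pull, h1]
  rfl

theorem extDeriv_pull {s q : ℕ} {ρ : Form d m s q} (hρ : ContDiffOn ℝ ∞ ρ (jetDomain W s))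
    (u : jetOpens W N) :
    pull N (fun v => extDeriv ρ v) u = extDeriv (pull N ρ) u := by
  have hd : DifferentiableAt ℝ ρ (jetProj N s u) :=
    (hρ.contDiffAt ((jetOpens W s).isOpen.mem_nhds (jetProj_mem_jetDomain.2 u.2))).differentiableAt
      (by simp)
  have h := extDeriv_pullback (r := ∞) hd
    ((jetProj N s).contDiff.contDiffAt (x := (u : JetC d m N)))
    (by
      rw [minSmoothness_of_isRCLikeNormedField]
      exact WithTop.coe_le_coe.2 (le_top : (2 : ℕ∞) ≤ ⊤))
  simp only [ContinuousLinearMap.fderiv] at h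
  exact h.symm

variable {n : ℕ} {W : TopologicalSpace.Opens (TotC (n + 1) m)}

/-- The functions `± ρ(∂/∂y^σ_I, d_1, …, (no d_a), …, d_n)`, the components of `p_1 ρ`. -/
def contactFun {s : ℕ} (ρ : Form (n + 1) m s (n + 1)) (hρ : ContDiffOn ℝ ∞ ρ (jetDomain W s))
    (σ : Fin m) (a : Fin (n + 1)) (I : Multiset (Fin (n + 1))) : JetFun W N :=
  (-1 : ℝ) ^ (a : ℕ) • smoothFun.of
    (fun u => pull N ρ u (fun i => (Matrix.vecCons (fun _ => partialY N σ I)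
      (fun j => totalVec N N (a.succAbove j)) : Fin (n + 1) → JetC (n + 1) m N → _) i u))
    (contDiffOn_alternating_apply (contDiffOn_pull hρ)
      fun i => Fin.cases contDiffOn_const (fun _ => (contDiff_totalVec N N _).contDiffOn) i)

theorem contactFun_apply {s : ℕ} (ρ : Form (n + 1) m s (n + 1))
    (hρ : ContDiffOn ℝ ∞ ρ (jetDomain W s))
    (σ : Fin m) (a : Fin (n + 1)) (I : Multiset (Fin (n + 1))) (u : jetOpens W N) :
    (contactFun ρ hρ σ a I).1 u = (-1 : ℝ) ^ (a : ℕ) *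
      pull N ρ u (Matrix.vecCons (partialY N σ I) (fun j => totalVec N N (a.succAbove j) u)) := by
  change (-1 : ℝ) ^ (a : ℕ) * pull N ρ u _ = _
  congr 2
  funext i
  exact Fin.cases rfl (fun _ => rfl) i

theorem contactFun_eq_zero {s : ℕ} (ρ : Form (n + 1) m s (n + 1))
    (hρ : ContDiffOn ℝ ∞ ρ (jetDomain W s))
    (σ : Fin m) (a : Fin (n + 1)) {I : Multiset (Fin (n + 1))} (hI : s < I.card) :
    contactFun (N := N) ρ hρ σ a I = 0 := by
  refine smoothFun.ext fun u => ?_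
  rw [contactFun_apply, pull, ContinuousAlternatingMap.compContinuousLinearMap_apply,
    ContinuousAlternatingMap.map_coord_zero _ (0 : Fin (n + 1)), mul_zero]
  · rfl
  · simp only [Function.comp_apply, Matrix.cons_val_zero]
    rw [jetProj_partialY, partialY_of_lt σ hI, ite_self]

theorem lieBracket_partialY_totalVec (σ : Fin m) {I : Multiset (Fin (n + 1))} (hI : I.card ≤ N)
    (j : Fin (n + 1)) (u : JetC (n + 1) m N) :
    VectorField.lieBracket ℝ (fun _ => partialY N σ I) (totalVec N N j) u
      = if j ∈ I then partialY N σ (I.erase j) else 0 := by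
  rw [VectorField.lieBracket, (hasFDerivAt_totalVec N N j _).fderiv, totalLin_partialY j σ hI]
  simp

theorem lieBracket_totalVec (i j : Fin (n + 1)) (u : JetC (n + 1) m N) :
    VectorField.lieBracket ℝ (totalVec N N i) (totalVec N N j) u = 0 := by
  rw [VectorField.lieBracket, (hasFDerivAt_totalVec N N j _).fderiv,
    (hasFDerivAt_totalVec N N i _).fderiv, totalLin_totalVec_comm, sub_self]

/-- The value `dρ(∂/∂y^σ_I, d_1, …, d_n)`: up to a divergence in the sense of the Euler operator, it
is the partial derivative of the coefficient of `hρ`. -/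
theorem extDeriv_apply_partialY_totalVec {s : ℕ} (ρ : Form (n + 1) m s (n + 1))
    (hρ : ContDiffOn ℝ ∞ ρ (jetDomain W s)) (σ : Fin m) {I : Multiset (Fin (n + 1))}
    (hI : I.card ≤ N) (u : jetOpens W N) :
    (partialDer W N σ I (lagrFun ρ hρ) - ∑ a, ((totalDer W N).der a (contactFun ρ hρ σ a I)
        + if a ∈ I then contactFun ρ hρ σ a (I.erase a) else 0)).1 u =
      pull N (fun v => extDeriv ρ v) u
        (Matrix.vecCons (partialY N σ I) fun i => totalVec N N i u) := by
  have hd : DifferentiableAt ℝ (pull N ρ) (u : JetC (n + 1) m N) :=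
    ((contDiffOn_pull hρ).contDiffAt ((jetOpens W N).isOpen.mem_nhds u.2)).differentiableAt
      (by simp)
  set V : Fin (n + 2) → JetC (n + 1) m N → JetC (n + 1) m N :=
    Matrix.vecCons (fun _ => partialY N σ I) (fun i => totalVec N N i) with hV
  have hVd (i : Fin (n + 2)) : DifferentiableAt ℝ (V i) u :=
    Fin.cases (differentiableAt_const _)
      (fun i => (hasFDerivAt_totalVec N N i _).differentiableAt) i
  have hVu : (Matrix.vecCons (partialY N σ I) fun i => totalVec N N i (u : JetC (n + 1) m N))
      = fun i => V i u := funext fun i => Fin.cases rfl (fun _ => rfl) i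
  rw [extDeriv_pull hρ, hVu, extDeriv_apply_vectorField hd hVd,
    Fin.sum_univ_succ (n := n + 1),
    Fin.sum_univ_succ (n := n) (f := fun i : Fin (n + 1) => Finset.sum (Finset.Ici i) _)]
  have hR0 (x : JetC (n + 1) m N) : Fin.removeNth 0 (fun i => V i x)
      = fun i => totalVec N N i x := rfl
  have hRs (a : Fin (n + 1)) (x : JetC (n + 1) m N) : Fin.removeNth a.succ (fun i => V i x)
      = Matrix.vecCons (partialY N σ I) (fun j => totalVec N N (a.succAbove j) x) :=
    funext fun i => Fin.cases rfl (fun i => by simp [Fin.removeNth, hV]) i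
  have h0 : (partialDer W N σ I (lagrFun ρ hρ)).1 u
      = fderiv ℝ (fun x => pull N ρ x (Fin.removeNth 0 fun i => V i x)) u (V 0 u) :=
    vectorDer_apply_of_eq (hX := contDiffOn_const) (fun v => rfl) u
  have hs (a : Fin (n + 1)) : ((totalDer W N).der a (contactFun ρ hρ σ a I)).1 u
      = (-1 : ℝ) ^ (a : ℕ) *
        fderiv ℝ (fun x => pull N ρ x (Fin.removeNth a.succ fun i => V i x)) u (V a.succ u) := by
    rw [contactFun, Derivation.map_smul]
    change (-1 : ℝ) ^ (a : ℕ) * _ = _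
    congr 1
    refine totalDer_apply_of_eq (fun v => ?_) u
    rw [hRs, smoothFun.of_apply]
    congr 1
    funext i
    exact Fin.cases rfl (fun _ => rfl) i
  have hbr (i : Fin n) (j : Fin (n + 1)) :
      VectorField.lieBracket ℝ (V i.succ.castSucc) (V j.succ) u = 0 :=
    lieBracket_totalVec i.castSucc j (u : JetC (n + 1) m N)
  have hb0 (a : Fin (n + 1)) :
      (if a ∈ I then contactFun ρ hρ σ a (I.erase a) else (0 : JetFun W N)).1 u
      = (-1 : ℝ) ^ (a : ℕ) * pull N ρ u (Matrix.vecCons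
        (VectorField.lieBracket ℝ (V (Fin.castSucc 0)) (V a.succ) u)
        (a.removeNth (Fin.removeNth (Fin.castSucc 0) fun i => V i u))) := by
    have h1 : VectorField.lieBracket ℝ (V (Fin.castSucc 0)) (V a.succ) (u : JetC (n + 1) m N)
      = if a ∈ I then partialY N σ (I.erase a) else 0 := lieBracket_partialY_totalVec σ hI a u
    rw [h1]
    split_ifs
    · rw [contactFun_apply]
      rfl
    · rw [ContinuousAlternatingMap.map_coord_zero _ (0 : Fin (n + 1)) (by simp), mul_zero]
      rfl
  have hz : ∀ i : Fin n, ∑ j ∈ Finset.Ici i.succ, (-1 : ℤ) ^ ((i.succ : ℕ) + (j : ℕ)) •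
      pull N ρ u (Matrix.vecCons (VectorField.lieBracket ℝ (V i.succ.castSucc) (V j.succ) u)
        (j.removeNth (i.succ.castSucc.removeNth fun i => V i u))) = 0 := fun i =>
    Finset.sum_eq_zero fun j _ => by
      rw [hbr, ContinuousAlternatingMap.map_coord_zero _ (0 : Fin (n + 1)) (by simp), smul_zero]
  have hIci : Finset.Ici (0 : Fin (n + 1)) = Finset.univ := by ext; simp
  rw [Finset.sum_congr rfl fun i _ => hz i, Finset.sum_const_zero, add_zero, hIci]
  have hsub : ∀ (f g : JetFun W N), (f - g).1 u = f.1 u - g.1 u := fun _ _ => rfl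
  have hadd : ∀ (f g : JetFun W N), (f + g).1 u = f.1 u + g.1 u := fun _ _ => rfl
  rw [hsub, smoothFun.sum_apply, h0]
  simp only [hadd, hs, hb0, Finset.sum_add_distrib]
  simp only [Fin.val_zero, pow_zero, one_smul, zero_add, zsmul_eq_mul, Int.cast_pow, Int.cast_neg,
    Int.cast_one, Fin.val_succ, pow_succ]
  simp only [mul_neg, mul_one, Int.cast_neg, Int.cast_pow, Int.cast_one, neg_mul,
    Finset.sum_neg_distrib]
  ring

end Eta

/-! ### Euler–Lagrange expressions and source forms -/

section Euler

variable {d m N : ℕ} {W : TopologicalSpace.Opens (TotC d m)}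

/-- The Euler–Lagrange expressions of the function `f`, with the sum taken up to order `s`. -/
def eulerFun (s : ℕ) (f : JetFun W N) (σ : Fin m) : JetFun W N :=
  ∑ l ∈ Finset.range (s + 1), tupleSum l fun I =>
    (-1 : ℝ) ^ l • (totalDer W N).iter I (idxWeight I • partialDer W N σ I f)

theorem eulerFun_of_le {s M : ℕ} (h : s ≤ M) {f : JetFun W N} {σ : Fin m}
    (hf : ∀ I : Multiset (Fin d), s < I.card → partialDer W N σ I f = 0) :
    eulerFun M f σ = eulerFun s f σ := by
  rw [eulerFun, eulerFun]
  refine (Finset.sum_subset (Finset.range_subset_range.2 (by omega)) fun l _ hl => ?_).symm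
  refine tupleSum_eq_zero fun I hI => ?_
  rw [Finset.mem_range] at hl
  rw [hf I (by omega), smul_zero, map_zero, smul_zero]

theorem eulerFun_sub (s : ℕ) (f g : JetFun W N) (σ : Fin m) :
    eulerFun s (f - g) σ = eulerFun s f σ - eulerFun s g σ := by
  rw [eulerFun, eulerFun, eulerFun, ← Finset.sum_sub_distrib]
  refine Finset.sum_congr rfl fun l _ => ?_
  simp only [tupleSum, ← Finset.sum_sub_distrib, map_sub, smul_sub]

/-- The Euler–Lagrange expressions of a divergence vanish. -/
theorem eulerFun_divergence {M : ℕ} (hM : M ≤ N) (g : Fin d → JetFun W N) (σ : Fin m)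
    (hg : ∀ j, ∀ I : Multiset (Fin d), I.card = M → partialDer W N σ I (g j) = 0) :
    eulerFun M (∑ j, (totalDer W N).der j (g j)) σ = 0 := by
  have h (j : Fin d) : ∑ l ∈ Finset.range (M + 1), tupleSum l (fun I => (-1 : ℝ) ^ l •
      (totalDer W N).iter I (idxWeight I • partialDer W N σ I ((totalDer W N).der j (g j))))
        = 0 := by
    rw [← (totalDer W N).sum_tupleSum_euler_divergence M j (fun I => partialDer W N σ I (g j))
      (hg j)]
    refine Finset.sum_congr rfl fun l hl => tupleSum_congr fun I hI => ?_
    rw [partialDer_totalDer σ (by rw [Finset.mem_range] at hl; omega)]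
  rw [eulerFun, ← Finset.sum_const_zero (s := (Finset.univ : Finset (Fin d))),
    ← Finset.sum_congr rfl fun j _ => h j, Finset.sum_comm]
  refine Finset.sum_congr rfl fun l _ => ?_
  rw [← tupleSum_sum]
  simp only [map_sum, Finset.smul_sum]

theorem sum_comp_jetProj {ι : Type*} {K k q : ℕ} (s : Finset ι)
    (τ : ι → (JetC d m k) [⋀^Fin q]→L[ℝ] ℝ) :
    (∑ a ∈ s, τ a).compContinuousLinearMap (jetProj K k)
      = ∑ a ∈ s, (τ a).compContinuousLinearMap (jetProj K k) := by
  ext v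
  simp

theorem contactForm_comp_jetProj {K : ℕ} (hK : 1 ≤ K) (σ : Fin m) (u : JetC d m N) :
    (contactForm K σ 0 (jetProj N K u)).comp (jetProj N K) = contactForm N σ 0 u := by
  refine ContinuousLinearMap.ext fun v => ?_
  have h0 := dy_jetProj (K := N) (k := K) (σ := σ) (I := 0) (by simp) v
  simp [contactForm, ContinuousLinearMap.comp_apply, dy_jetProj, hK, h0]

theorem contactForm_apply_of_vertical {k : ℕ} (σ : Fin m) (I : Multiset (Fin d)) (u : JetC d m k)
    {v : JetC d m k} (hv : v.1 = 0) : contactForm k σ I u v = dy k σ I v := by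
  simp [contactForm, hv]

theorem pull_contract {k q : ℕ} {X : JetC d m k → JetC d m k} {θ : Form d m k (q + 1)}
    {u V : JetC d m N} (hX : X (jetProj N k u) = jetProj N k V) :
    pull N (contract X θ) u = (pull N θ u).curryLeft V := by
  ext w
  rw [ContinuousAlternatingMap.curryLeft_apply_apply]
  simp only [pull, contract, ContinuousAlternatingMap.compContinuousLinearMap_apply, hX,
    ContinuousAlternatingMap.curryLeft_apply_apply]
  congr 1
  funext i
  exact Fin.cases rfl (fun _ => rfl) i

end Euler

section SourceForms

variable {n m N : ℕ} {W : TopologicalSpace.Opens (TotC (n + 1) m)}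

/-- The form `θ`, pulled back to `N`-jets, is the source form `∑ e_σ ω^σ ∧ ds`. -/
def IsSourceForm {k : ℕ} (θ : Form (n + 1) m k (n + 2)) (e : Fin m → JetFun W N) : Prop :=
  ∀ u : jetOpens W N, pull N θ u =
    ∑ σ, wedgeOne (contactForm N σ 0 u) ((e σ).1 u • horForm N (baseVol (n + 1)))

theorem isSourceForm_interiorEuler {s : ℕ} {β : Form (n + 1) m s (n + 2)}
    {P : Fin m → Multiset (Fin (n + 1)) → JetFun W N} (hs : 2 * s + 1 ≤ N)
    (hP : ∀ σ (I : Multiset (Fin (n + 1))), I.card ≤ s →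
      HasVolCoeff (etaForm β σ I) (idxWeight I • P σ I)) :
    IsSourceForm (interiorEuler β) fun σ => ∑ l ∈ Finset.range (s + 1), tupleSum l fun I =>
      (-1 : ℝ) ^ l • (totalDer W N).iter I (idxWeight I • P σ I) := by
  intro u
  have hE (σ : Fin m) : HasVolCoeff (N := N) (W := W)
      (fun v => ∑ l ∈ Finset.range (s + 1), ∑ I : Fin l → Fin (n + 1),
        (-1 : ℝ) ^ l • pull (2 * s + 1) (formalDs l I (etaForm β σ (tupleIdx I))) v)
      (∑ l ∈ Finset.range (s + 1), tupleSum l fun I =>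
        (-1 : ℝ) ^ l • (totalDer W N).iter I (idxWeight I • P σ I)) := by
    refine HasCoeff.sum fun l hl => HasCoeff.sum fun I _ => HasCoeff.smul ?_ _
    rw [Finset.mem_range] at hl
    refine HasCoeff.pullBack ?_ (by omega)
    exact HasCoeff.formalDs (hP σ _ (by rw [card_tupleIdx]; omega)) l I (by omega)
  have h1 : pull N (interiorEuler β) u = ∑ σ, wedgeOne (contactForm N σ 0 u)
      (pull N (fun v => ∑ l ∈ Finset.range (s + 1), ∑ I : Fin l → Fin (n + 1),
        (-1 : ℝ) ^ l • pull (2 * s + 1) (formalDs l I (etaForm β σ (tupleIdx I))) v) u) := by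
    rw [pull, interiorEuler, sum_comp_jetProj]
    refine Finset.sum_congr rfl fun σ _ => ?_
    rw [wedgeOne_comp_jetProj, contactForm_comp_jetProj (by omega)]
    rfl
  rw [h1]
  refine Finset.sum_congr rfl fun σ _ => ?_
  rw [hasVolCoeff_iff.1 (hE σ) u]

/-- The Euler–Lagrange form of `hρ` can be computed from `ρ`: the difference between `p_1 dρ` and
`p_1 d hρ` is a divergence, and annihilated by the Euler operator. -/
theorem isSourceForm_eulerLagrange {s : ℕ} (ρ : Form (n + 1) m s (n + 1))
    (hρ : ContDiffOn ℝ ∞ ρ (jetDomain W s)) (hs : 2 * s + 1 ≤ N) :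
    IsSourceForm (W := W) (eulerLagrange ρ) (eulerFun (N := N) (s + 1) (lagrFun ρ hρ)) := by
  set P : Fin m → Multiset (Fin (n + 1)) → JetFun W N := fun σ I =>
    partialDer W N σ I (lagrFun ρ hρ) - ∑ a, ((totalDer W N).der a (contactFun ρ hρ σ a I)
        + if a ∈ I then contactFun ρ hρ σ a (I.erase a) else 0) with hPdef
  have hP (σ : Fin m) (I : Multiset (Fin (n + 1))) (hI : I.card ≤ s) :
      HasVolCoeff (etaForm (fun v => extDeriv ρ v) σ I) (idxWeight I • P σ I) :=
    hasVolCoeff_etaForm (by omega)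
      (extDeriv_apply_partialY_totalVec ρ hρ σ (I := I) (by omega)) (by omega)
  have hP0 (σ : Fin m) (I : Multiset (Fin (n + 1))) (hI : I.card = s + 1) : P σ I = 0 := by
    refine smoothFun.ext fun u => ?_
    rw [extDeriv_apply_partialY_totalVec ρ hρ σ (by omega) u, pull,
      ContinuousAlternatingMap.compContinuousLinearMap_apply,
      ContinuousAlternatingMap.map_coord_zero _ (0 : Fin (n + 2))]
    · rfl
    · simp only [Function.comp_apply, Matrix.cons_val_zero]
      rw [jetProj_partialY, partialY_of_lt σ (by omega), ite_self]
  have hsum (σ : Fin m) : ∑ l ∈ Finset.range (s + 1), tupleSum l (fun I =>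
        (-1 : ℝ) ^ l • (totalDer W N).iter I (idxWeight I • P σ I))
      = eulerFun (s + 1) (lagrFun ρ hρ) σ := by
    have h1 : tupleSum (s + 1) (fun I =>
        (-1 : ℝ) ^ (s + 1) • (totalDer W N).iter I (idxWeight I • P σ I)) = 0 :=
      tupleSum_eq_zero fun I hI => by rw [hP0 σ I hI, smul_zero, map_zero, smul_zero]
    have hdiv (a : Fin (n + 1)) := (totalDer W N).sum_tupleSum_euler_divergence (s + 1) a
      (fun I => contactFun ρ hρ σ a I) fun I hI => contactFun_eq_zero ρ hρ σ a (by omega)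
    rw [← add_zero (Finset.sum _ _), ← h1, ← Finset.sum_range_succ, eulerFun,
      ← sub_eq_zero, ← Finset.sum_sub_distrib, ← neg_eq_zero,
      ← Finset.sum_const_zero (s := (Finset.univ : Finset (Fin (n + 1)))),
      ← Finset.sum_congr rfl fun a _ => hdiv a, Finset.sum_comm, ← Finset.sum_neg_distrib]
    refine Finset.sum_congr rfl fun l _ => ?_
    rw [← tupleSum_sum]
    simp only [tupleSum, ← Finset.sum_sub_distrib, ← Finset.sum_neg_distrib]
    refine Finset.sum_congr rfl fun I _ => ?_
    simp only [hPdef, smul_sub, map_sub, Finset.smul_sum, map_sum]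
    abel
  rw [← funext hsum]
  exact isSourceForm_interiorEuler hs hP

/-- For a horizontal form `f ds`, the coefficients of `p_1 d(f ds)` are the partial derivatives
of `f`. -/
theorem hasVolCoeff_etaForm_extDeriv {s : ℕ} {L : Form (n + 1) m s (n + 1)} {f : JetFun W N}
    (hL : HasVolCoeff L f) (hs : s + 1 ≤ N) (σ : Fin m) {I : Multiset (Fin (n + 1))}
    (hI : I.card ≤ N) :
    HasVolCoeff (etaForm (fun v => extDeriv L v) σ I) (idxWeight I • partialDer W N σ I f) := by
  have hL' := HasCoeff.contDiffOn hL (by omega)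
  have h1 : lagrFun L hL' = f := smoothFun.ext fun u => by
    rw [lagrFun, smoothFun.of_apply, hasVolCoeff_iff.1 hL u,
      ContinuousAlternatingMap.smul_apply, horForm_baseVol_totalVec, smul_eq_mul, mul_one]
  have h2 (a : Fin (n + 1)) (J : Multiset (Fin (n + 1))) :
      contactFun (N := N) (W := W) L hL' σ a J = 0 := smoothFun.ext fun u => by
    rw [contactFun_apply, hasVolCoeff_iff.1 hL u, ContinuousAlternatingMap.smul_apply, horForm,
      ContinuousAlternatingMap.compContinuousLinearMap_apply,
      ContinuousAlternatingMap.map_coord_zero _ (0 : Fin (n + 1)) rfl, smul_zero, mul_zero]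
    rfl
  refine hasVolCoeff_etaForm hs (fun u => ?_) hI
  rw [← extDeriv_apply_partialY_totalVec L hL' σ hI u, h1]
  simp [h2]

theorem isSourceForm_eulerLagrange_of_hasVolCoeff {s : ℕ} {L : Form (n + 1) m s (n + 1)}
    {f : JetFun W N} (hL : HasVolCoeff L f) (hs : 2 * s + 1 ≤ N) :
    IsSourceForm (eulerLagrange L) (eulerFun s f) :=
  isSourceForm_interiorEuler hs fun σ _ hI =>
    hasVolCoeff_etaForm_extDeriv hL (by omega) σ (by omega)

/-- A vertical vector field with components `Q^σ` inserted in a source form. -/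
theorem IsSourceForm.hasVolCoeff_contract {k : ℕ} {θ : Form (n + 1) m k (n + 2)}
    {e Q : Fin m → JetFun W N} (h : IsSourceForm θ e) {X : JetC (n + 1) m k → JetC (n + 1) m k}
    {V : JetC (n + 1) m N → JetC (n + 1) m N}
    (hX : ∀ u : jetOpens W N, X (jetProj N k u) = jetProj N k (V u))
    (hV : ∀ u : jetOpens W N, (V u).1 = 0)
    (hQ : ∀ (u : jetOpens W N) σ, dy N σ 0 (V u) = (Q σ).1 u) :
    HasVolCoeff (contract X θ) (∑ σ, Q σ * e σ) := by
  rw [hasVolCoeff_iff]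
  intro u
  rw [pull_contract (hX u), h u, smoothFun.sum_apply, Finset.sum_smul]
  have hc : ∀ (s : Finset (Fin m)) (τ : Fin m → (JetC (n + 1) m N) [⋀^Fin (n + 2)]→L[ℝ] ℝ),
      (∑ σ ∈ s, τ σ).curryLeft (V u) = ∑ σ ∈ s, (τ σ).curryLeft (V u) := fun s τ => by
    ext w
    simp [ContinuousAlternatingMap.curryLeft_apply_apply]
  rw [hc]
  refine Finset.sum_congr rfl fun σ _ => ?_
  have h1 : (e σ).1 u • horForm (m := m) N (baseVol (n + 1))
      = horForm N ((e σ).1 u • baseVol (n + 1)) := rfl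
  rw [h1, curryLeft_wedgeOne_horForm _ _ (hV u), contactForm_apply_of_vertical _ _ _ (hV u), hQ,
    ← h1, smul_smul]
  rfl

end SourceForms

/-! ### Prolongations of projectable vector fields -/

section Prolongation

variable {d m : ℕ}

/-- A smooth projectable vector field on an open set of the total space, in coordinates: the
components `ξ^i` only depend on the base point. -/
structure IsProjectableOn (W : TopologicalSpace.Opens (TotC d m)) (Ξ : TotC d m → TotC d m) :
    Prop where
  smooth : ContDiffOn ℝ ∞ Ξ W
  fderiv_fst : ∀ w ∈ W, ∀ v : TotC d m, v.1 = 0 → (fderiv ℝ Ξ w v).1 = 0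

variable {N : ℕ} {W : TopologicalSpace.Opens (TotC d m)} {Ξ : TotC d m → TotC d m}

theorem IsProjectableOn.differentiableAt (hΞ : IsProjectableOn W Ξ) {w : TotC d m} (hw : w ∈ W) :
    DifferentiableAt ℝ Ξ w :=
  (hΞ.smooth.contDiffAt (W.isOpen.mem_nhds hw)).differentiableAt (by simp)

theorem contDiffOn_comp_toTot (hΞ : IsProjectableOn W Ξ) (k : ℕ) :
    ContDiffOn ℝ ∞ (fun u : JetC d m k => Ξ (toTot u)) (jetDomain W k) :=
  hΞ.smooth.comp (toTotCLM k).contDiff.contDiffOn fun _ hu => hu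

theorem contDiffOn_fst_comp_toTot (hΞ : IsProjectableOn W Ξ) (k : ℕ) (i : Fin d) :
    ContDiffOn ℝ ∞ (fun u : JetC d m k => (Ξ (toTot u)).1 i) (jetDomain W k) :=
  (contDiff_apply ℝ ℝ i).comp_contDiffOn
    (contDiff_fst.comp_contDiffOn (contDiffOn_comp_toTot hΞ k))

theorem contDiffOn_snd_comp_toTot (hΞ : IsProjectableOn W Ξ) (k : ℕ) (σ : Fin m) :
    ContDiffOn ℝ ∞ (fun u : JetC d m k => (Ξ (toTot u)).2 σ) (jetDomain W k) :=
  (contDiff_apply ℝ ℝ σ).comp_contDiffOn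
    (contDiff_snd.comp_contDiffOn (contDiffOn_comp_toTot hΞ k))

/-- The differential of the component `ξ^i`, which is a combination of the `dx^j`. -/
theorem hasFDerivAt_fst_comp_toTot (hΞ : IsProjectableOn W Ξ) {k : ℕ} {u : JetC d m k}
    (hu : u ∈ jetDomain W k) (i : Fin d) :
    HasFDerivAt (fun u : JetC d m k => (Ξ (toTot u)).1 i)
      (∑ j, (fderiv ℝ Ξ (toTot u) (Pi.single j 1, 0)).1 i • dx k j) u := by
  have h1 : HasFDerivAt (fun u : JetC d m k => Ξ (toTot u))
      ((fderiv ℝ Ξ (toTot u)).comp (toTotCLM k)) u :=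
    (hΞ.differentiableAt hu).hasFDerivAt.comp u (toTotCLM k).hasFDerivAt
  have h2 := ((ContinuousLinearMap.proj (R := ℝ) (φ := fun _ : Fin d => ℝ) i).comp
    (ContinuousLinearMap.fst ℝ (Fin d → ℝ) (Fin m → ℝ))).hasFDerivAt.comp u h1
  refine h2.congr_fderiv (ContinuousLinearMap.ext fun v => ?_)
  have h3 : toTotCLM k v = (∑ j, v.1 j • ((Pi.single j 1, 0) : TotC d m)) + (0, (toTot v).2) := by
    refine Prod.ext ?_ ?_
    · funext a
      simp [toTotCLM_apply, toTot, Prod.fst_sum, Finset.sum_apply, Pi.single_apply]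
    · simp [toTotCLM_apply, toTot, Prod.snd_sum]
  have h4 : ((fderiv ℝ Ξ (toTot u)) (0, (toTot v).2)).1 i = 0 :=
    congrFun (hΞ.fderiv_fst _ hu (0, (toTot v).2) rfl) i
  simp only [ContinuousLinearMap.comp_apply, h3, map_add, map_sum, map_smul]
  simp [mul_comm, h4]

/-- The components `Ξ^σ_L` of the prolongation are smooth. -/
theorem contDiffOn_prolComp (hΞ : IsProjectableOn W Ξ) (σ : Fin m) (L : List (Fin d)) :
    ContDiffOn ℝ ∞ (prolComp Ξ σ L) (jetDomain W L.length) := by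
  induction L with
  | nil => exact contDiffOn_snd_comp_toTot hΞ 0 σ
  | cons j L ih =>
    have h1 : ContDiffOn ℝ ∞ (fderiv ℝ (prolComp Ξ σ L)) (jetDomain W L.length) :=
      ih.fderiv_of_isOpen (isOpen_jetDomain W.isOpen _) (by simp)
    have h2 : ContDiffOn ℝ ∞ (fun u : JetC d m (L.length + 1) =>
        fderiv ℝ (prolComp Ξ σ L) (jetProj (L.length + 1) L.length u)
          (totalVec (L.length + 1) L.length j u)) (jetDomain W (L.length + 1)) :=
      (h1.comp (jetProj (L.length + 1) L.length).contDiff.contDiffOn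
        fun _ hu => jetProj_mem_jetDomain.2 hu).clm_apply (contDiff_totalVec _ _ j).contDiffOn
    refine h2.sub (ContDiffOn.sum fun i _ => (dy _ σ _).contDiff.contDiffOn.mul ?_)
    have h3 : ContDiffOn ℝ ∞ (fun u : JetC d m (L.length + 1) =>
        fderiv ℝ Ξ (toTot u) (Pi.single j 1, 0)) (jetDomain W (L.length + 1)) :=
      ((hΞ.smooth.fderiv_of_isOpen W.isOpen (by simp)).comp
        (toTotCLM (L.length + 1)).contDiff.contDiffOn fun _ hu => hu).clm_apply contDiffOn_const
    exact (contDiff_apply ℝ ℝ i).comp_contDiffOn (contDiff_fst.comp_contDiffOn h3)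

/-- The component `ξ^i`. -/
def xiFun (hΞ : IsProjectableOn W Ξ) (i : Fin d) : JetFun W N :=
  smoothFun.of (fun u => (Ξ (toTot u)).1 i) (contDiffOn_fst_comp_toTot hΞ N i)

/-- The characteristic `Q^σ = ξ^σ - y^σ_i ξ^i`. -/
def charFun (hΞ : IsProjectableOn W Ξ) (σ : Fin m) : JetFun W N :=
  smoothFun.of (fun u => (Ξ (toTot u)).2 σ - ∑ i, dy N σ (i ::ₘ 0) u * (Ξ (toTot u)).1 i)
    ((contDiffOn_snd_comp_toTot hΞ N σ).sub (ContDiffOn.sum fun i _ =>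
      (dy N σ _).contDiff.contDiffOn.mul (contDiffOn_fst_comp_toTot hΞ N i)))

theorem totalDer_xiFun (hΞ : IsProjectableOn W Ξ) (i j : Fin d) (u : jetOpens W N) :
    ((totalDer W N).der j (xiFun hΞ i)).1 u
      = (fderiv ℝ Ξ (toTot (u : JetC d m N)) (Pi.single j 1, 0)).1 i := by
  rw [totalDer_apply_of_eq (g := fun u => (Ξ (toTot u)).1 i) (fun _ => rfl),
    (hasFDerivAt_fst_comp_toTot hΞ u.2 i).fderiv]
  simp [Pi.single_apply]

/-- The vertical components `Ξ^σ_I - y^σ_{Ii} ξ^i` of the prolongation are the total derivatives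
of the characteristic. -/
theorem prolComp_sub_eq_iter (hΞ : IsProjectableOn W Ξ) (σ : Fin m) (L : List (Fin d))
    (hL : L.length + 1 ≤ N) (u : jetOpens W N) :
    prolComp Ξ σ L (jetProj N L.length u)
        - ∑ i, dy N σ (i ::ₘ (L : Multiset (Fin d))) u * (Ξ (toTot (u : JetC d m N))).1 i
      = ((totalDer W N).iter L (charFun hΞ σ)).1 u := by
  induction L generalizing u with
  | nil =>
    rw [Multiset.coe_nil, CommutingDerivations.iter_zero]
    change (Ξ (toTot (jetProj N 0 (u : JetC d m N)))).2 σ - _ = (Ξ (toTot (u : JetC d m N))).2 σ - _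
    rw [toTot_jetProj]
  | cons j L ih =>
    have hL' : L.length + 2 ≤ N := hL
    rw [← Multiset.cons_coe, CommutingDerivations.iter_cons,
      totalDer_apply_of_eq (g := fun u => prolComp Ξ σ L (jetProj N L.length u)
        - ∑ i, dy N σ (i ::ₘ (L : Multiset (Fin d))) u * (Ξ (toTot u)).1 i)
        (fun v => (ih (by omega) v).symm)]
    have h1 : HasFDerivAt (fun u : JetC d m N => prolComp Ξ σ L (jetProj N L.length u))
        ((fderiv ℝ (prolComp Ξ σ L) (jetProj N L.length u)).comp (jetProj N L.length))
        (u : JetC d m N) :=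
      HasFDerivAt.comp (u : JetC d m N) ((((contDiffOn_prolComp hΞ σ L).contDiffAt
        ((isOpen_jetDomain W.isOpen _).mem_nhds (jetProj_mem_jetDomain.2 u.2))).differentiableAt
          (by simp)).hasFDerivAt) (jetProj N L.length).hasFDerivAt
    have h2 := h1.sub (HasFDerivAt.fun_sum (u := Finset.univ) fun i _ =>
      (dy N σ (i ::ₘ (L : Multiset (Fin d)))).hasFDerivAt.mul
        (hasFDerivAt_fst_comp_toTot hΞ u.2 i))
    rw [show fderiv ℝ (fun u : JetC d m N => prolComp Ξ σ L (jetProj N L.length u)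
        - ∑ i, dy N σ (i ::ₘ (L : Multiset (Fin d))) u * (Ξ (toTot u)).1 i) u = _ from h2.fderiv]
    have h4 (i : Fin d) : dy N σ (i ::ₘ (L : Multiset (Fin d))) (totalVec N N j (u : JetC d m N))
        = dy N σ (i ::ₘ j ::ₘ (L : Multiset (Fin d))) u := by
      rw [dy_totalVec (by simp; omega), Multiset.cons_swap]
    have h5 (i : Fin d) : dy (L.length + 1) σ (i ::ₘ (L : Multiset (Fin d)))
        (jetProj N (L.length + 1) (u : JetC d m N)) = dy N σ (i ::ₘ (L : Multiset (Fin d))) u :=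
      dy_jetProj (by simp) _
    have h6 : prolComp Ξ σ (j :: L) (jetProj N (j :: L).length (u : JetC d m N))
        = fderiv ℝ (prolComp Ξ σ L) (jetProj N L.length u) (totalVec N L.length j u)
          - ∑ i, dy N σ (i ::ₘ (L : Multiset (Fin d))) u
            * (fderiv ℝ Ξ (toTot (u : JetC d m N)) (Pi.single j 1, 0)).1 i := by
      have h7 : prolComp Ξ σ (j :: L) (jetProj N (j :: L).length (u : JetC d m N))
          = fderiv ℝ (prolComp Ξ σ L) (jetProj (L.length + 1) L.length
              (jetProj N (L.length + 1) (u : JetC d m N)))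
              (totalVec (L.length + 1) L.length j (jetProj N (L.length + 1) (u : JetC d m N)))
            - ∑ i, dy (L.length + 1) σ (i ::ₘ (L : Multiset (Fin d)))
                (jetProj N (L.length + 1) (u : JetC d m N))
              * (fderiv ℝ Ξ (toTot (jetProj N (L.length + 1) (u : JetC d m N)))
                (Pi.single j 1, 0)).1 i := rfl
      rw [h7, jetProj_jetProj (Nat.le_succ _), totalVec_jetProj le_rfl, toTot_jetProj]
      simp only [h5]
    rw [h6]
    simp only [sub_apply, ContinuousLinearMap.comp_apply,
      jetProj_totalVec (show L.length ≤ N by omega),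
      sum_apply, add_apply, smul_apply, dx_apply, totalVec_fst, h4,
      smul_eq_mul, Pi.single_apply, mul_ite, mul_one, mul_zero, Finset.sum_ite_eq',
      Finset.mem_univ, if_true, Finset.sum_add_distrib]
    simp only [mul_comm ((Ξ _).1 _)]
    ring

theorem prolCoeff_sub_eq_iter (hΞ : IsProjectableOn W Ξ) (σ : Fin m) (I : Multiset (Fin d))
    (hI : I.card + 1 ≤ N) (u : jetOpens W N) :
    prolCoeff N Ξ σ I (u : JetC d m N)
        - ∑ i, dy N σ (i ::ₘ I) u * (Ξ (toTot (u : JetC d m N))).1 i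
      = ((totalDer W N).iter I (charFun hΞ σ)).1 u := by
  have h := prolComp_sub_eq_iter hΞ σ (I.sort (· ≥ ·)) (by simpa using hI) u
  rwa [Multiset.sort_eq] at h

theorem dy_vertPart (hΞ : IsProjectableOn W Ξ) {k : ℕ} (hk : k + 1 ≤ N) (σ : Fin m)
    {I : Multiset (Fin d)} (hI : I.card ≤ N) (u : jetOpens W N) :
    dy N σ I (vertPart N k Ξ u)
      = if I.card ≤ k then ((totalDer W N).iter I (charFun hΞ σ)).1 u else 0 := by
  rw [dy_apply hI, vertPart]
  refine if_ctx_congr Iff.rfl (fun h => ?_) fun _ => rfl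
  exact prolCoeff_sub_eq_iter hΞ σ I (by omega) u

theorem prolCoeff_jetProj {K : ℕ} (σ : Fin m) {I : Multiset (Fin d)} (hI : I.card ≤ K)
    (u : JetC d m N) : prolCoeff K Ξ σ I (jetProj N K u) = prolCoeff N Ξ σ I u := by
  rw [prolCoeff, prolCoeff, jetProj_jetProj (by simpa using hI)]

theorem vertPart_jetProj {K k : ℕ} (hk : k + 1 ≤ K) (u : JetC d m N) (hKN : K ≤ N) :
    vertPart K k Ξ (jetProj N K u) = jetProj N K (vertPart N k Ξ u) := by
  refine jetC_ext rfl fun σ I hI => ?_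
  rw [dy_jetProj hI, dy_apply hI, dy_apply (hI.trans hKN)]
  simp only [vertPart]
  refine if_ctx_congr Iff.rfl (fun h => ?_) fun _ => rfl
  rw [prolCoeff_jetProj σ hI, toTot_jetProj]
  congr 1
  refine Finset.sum_congr rfl fun i _ => ?_
  rw [dy_jetProj (by rw [Multiset.card_cons]; omega)]

/-- The prolongation is the sum of its horizontal and its vertical part. -/
theorem prolong_jetProj {k : ℕ} (hk : k + 1 ≤ N) (u : JetC d m N) :
    prolong k Ξ (jetProj N k u) =
      jetProj N k (∑ i, (Ξ (toTot u)).1 i • totalVec N N i u + vertPart N k Ξ u) := by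
  refine jetC_ext ?_ fun σ I hI => ?_
  · simp only [prolong, toTot_jetProj, jetProj_fst, Prod.fst_add, vertPart, Prod.fst_sum,
      Prod.smul_fst, totalVec_fst, add_zero]
    funext a
    simp [Finset.sum_apply, Pi.single_apply]
  · have h1 : dy N σ I (vertPart N k Ξ u)
        = prolCoeff N Ξ σ I u - ∑ i, dy N σ (i ::ₘ I) u * (Ξ (toTot u)).1 i := by
      rw [dy_apply (by omega)]
      exact if_pos hI
    rw [dy_jetProj hI, map_add, h1, map_sum, dy_apply hI]
    simp only [prolong, map_smul, dy_totalVec (show I.card ≤ N by omega), smul_eq_mul,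
      mul_comm (dy N σ _ u)]
    rw [prolCoeff_jetProj σ hI]
    ring

end Prolongation

/-! ### Lie derivatives of Lagrangians -/

section LieDerivative

variable {n m N : ℕ} {W : TopologicalSpace.Opens (TotC (n + 1) m)}
  {Ξ : TotC (n + 1) m → TotC (n + 1) m}

theorem hasFDerivAt_sum_smul_const {E F ι : Type*} [NormedAddCommGroup E] [NormedSpace ℝ E]
    [NormedAddCommGroup F] [NormedSpace ℝ F] [Fintype ι] {g : ι → E → ℝ} {g' : ι → E →L[ℝ] ℝ}
    {x : E} (h : ∀ a, HasFDerivAt (g a) (g' a) x) (α : ι → F) :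
    HasFDerivAt (fun v => ∑ a, g a v • α a) (∑ a, (g' a).smulRight (α a)) x :=
  HasFDerivAt.fun_sum fun a _ => (h a).smul_const (α a)

/-- The exterior derivative of a form `∑ g_a α_a` with constant `α_a`. -/
theorem extDeriv_sum_smul {d k q : ℕ} {ι : Type*} [Fintype ι] {θ : Form d m k q}
    {α : ι → (JetC d m k) [⋀^Fin q]→L[ℝ] ℝ} {g : ι → JetC d m k → ℝ}
    {g' : ι → JetC d m k →L[ℝ] ℝ} {w : JetC d m k}
    (hθ : θ =ᶠ[𝓝 w] fun v => ∑ a, g a v • α a) (hg : ∀ a, HasFDerivAt (g a) (g' a) w) :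
    extDeriv θ w = ∑ a, wedgeOne (g' a) (α a) := by
  rw [hθ.extDeriv_eq, extDeriv, (hasFDerivAt_sum_smul_const hg α).fderiv]
  have : ∀ s : Finset ι, ContinuousAlternatingMap.alternatizeUncurryFin
      (∑ a ∈ s, (g' a).smulRight (α a)) = ∑ a ∈ s, wedgeOne (g' a) (α a) := fun s =>
    map_sum (ContinuousAlternatingMap.alternatizeUncurryFinCLM ℝ (JetC d m k) ℝ (n := q)) _ s
  exact this _

/-- The derivative of a function along the vertical part of the prolongation. -/
theorem fderiv_zeroExt_vertPart {d : ℕ} {W : TopologicalSpace.Opens (TotC d m)}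
    {Ξ : TotC d m → TotC d m} (hΞ : IsProjectableOn W Ξ) {k : ℕ} (hk : k + 1 ≤ N) (f : JetFun W N)
    (u : jetOpens W N) :
    fderiv ℝ (zeroExt f.1) u (vertPart N k Ξ u) =
      (∑ σ, ∑ l ∈ Finset.range (k + 1), tupleSum l fun I =>
        (totalDer W N).iter I (charFun hΞ σ) * (idxWeight I • partialDer W N σ I f)).1 u := by
  rw [eq_sum_partialY (v := vertPart N k Ξ u) rfl]
  simp only [map_sum, map_smul, smoothFun.sum_apply]
  refine Finset.sum_congr rfl fun σ _ => ?_
  have h1 (l : ℕ) : tupleSum l (fun I => (totalDer W N).iter I (charFun hΞ σ) *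
      (idxWeight I • partialDer W N σ I f))
      = ∑ I ∈ idxFinset d l, (totalDer W N).iter I (charFun hΞ σ) * partialDer W N σ I f := by
    rw [← tupleSum_idxWeight_smul]
    simp only [mul_smul_comm]
  simp only [h1, smoothFun.sum_apply]
  refine (Finset.sum_subset (Finset.range_subset_range.2 (show k + 1 ≤ N + 1 by omega))
    fun l hl hl' => ?_).symm.trans ?_
  · refine Finset.sum_eq_zero fun I hI => ?_
    rw [mem_idxFinset] at hI
    rw [Finset.mem_range] at hl hl'
    rw [dy_vertPart hΞ hk σ (by omega), if_neg (by omega), zero_smul]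
  · refine Finset.sum_congr rfl fun l hl => Finset.sum_congr rfl fun I hI => ?_
    rw [mem_idxFinset] at hI
    rw [Finset.mem_range] at hl
    rw [dy_vertPart hΞ hk σ (by omega), if_pos (by omega)]
    rfl

/-- The coefficient of the Lie derivative of `f ds` along the prolongation of a projectable vector
field, `∑ d_i(ξ^i f) + ∑ d_I Q^σ ∂f/∂y^σ_I`. -/
def lieFun (k : ℕ) (hΞ : IsProjectableOn W Ξ) (f : JetFun W N) : JetFun W N :=
  ∑ i, (totalDer W N).der i (xiFun hΞ i * f) + ∑ σ, ∑ l ∈ Finset.range (k + 1), tupleSum l fun I =>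
    (totalDer W N).iter I (charFun hΞ σ) * (idxWeight I • partialDer W N σ I f)

theorem HasVolCoeff.lieDeriv_prolong (hΞ : IsProjectableOn W Ξ) {k : ℕ} (hk : k + 1 ≤ N)
    {L : Form (n + 1) m k (n + 1)} {f : JetFun W N} (hL : HasVolCoeff L f) :
    HasVolCoeff (lieDeriv (prolong k Ξ) L) (lieFun k hΞ f) := by
  rw [hasVolCoeff_iff]
  intro u
  set w := jetProj N k (u : JetC (n + 1) m N) with hw
  have hwU : w ∈ jetDomain W k := jetProj_mem_jetDomain.2 u.2
  set S := ∑ i, (Ξ (toTot (u : JetC (n + 1) m N))).1 i • totalVec N N i (u : JetC (n + 1) m N)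
    + vertPart N k Ξ u with hS
  have hX : prolong k Ξ w = jetProj N k S := prolong_jetProj hk _
  set g : JetC (n + 1) m k → ℝ := fun v => zeroExt f.1 (jetProj k N v) with hg
  have hLg (v) (hv : v ∈ jetDomain W k) : L v = g v • horForm k (baseVol (n + 1)) := by
    simpa using HasCoeff.apply hL (by omega) hv
  have hnhds : ∀ᶠ v in 𝓝 w, v ∈ jetDomain W k := (isOpen_jetDomain W.isOpen k).mem_nhds hwU
  have hgd : DifferentiableAt ℝ g w :=
    (((contDiffOn_zeroExt f).contDiffAt ((jetOpens W N).isOpen.mem_nhds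
      (jetProj_mem_jetDomain.2 hwU))).differentiableAt (by simp)).comp w
        (jetProj k N).differentiableAt
  have hfg : zeroExt f.1 =ᶠ[𝓝 (u : JetC (n + 1) m N)] fun v => g (jetProj N k v) := by
    filter_upwards [(jetOpens W N).isOpen.mem_nhds u.2] with v hv
    have h1 := HasCoeff.apply_jetProj hL (by omega) ⟨v, hv⟩
    rw [hLg _ (jetProj_mem_jetDomain.2 hv)] at h1
    have h2 := congrArg (fun β => β fun i => partialX k i) h1
    simpa [horForm_baseVol_partialX, ← zeroExt_apply] using h2.symm
  have hdf : fderiv ℝ (zeroExt f.1) u = (fderiv ℝ g w).comp (jetProj N k) := by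
    rw [hfg.fderiv_eq]
    exact (hgd.hasFDerivAt.comp (u : JetC (n + 1) m N) (jetProj N k).hasFDerivAt).fderiv
  have hfu : f.1 u = g w := by
    have h1 : zeroExt f.1 u = g w := hfg.self_of_nhds
    rw [← h1, zeroExt_apply]
  -- `dL = dg ∧ ds`
  have hdL : extDeriv L w = wedgeOne (fderiv ℝ g w) (horForm k (baseVol (n + 1))) := by
    have h1 := extDeriv_sum_smul (θ := L) (w := w) (ι := Unit) (g := fun _ => g)
      (α := fun _ => horForm k (baseVol (n + 1))) (g' := fun _ => fderiv ℝ g w)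
      (by filter_upwards [hnhds] with v hv; simpa using hLg v hv) fun _ => hgd.hasFDerivAt
    simpa using h1
  -- `X ⌋ L = ∑ g ξ^j ds_j`
  have hcon : contract (prolong k Ξ) L =ᶠ[𝓝 w]
      fun v => ∑ j, (g v * (Ξ (toTot v)).1 j) • horForm k (baseVolContr n j) := by
    filter_upwards [hnhds] with v hv
    rw [contract, hLg v hv]
    have h1 : (g v • horForm k (baseVol (n + 1))).curryLeft (prolong k Ξ v)
        = g v • (horForm k (baseVol (n + 1))).curryLeft (prolong k Ξ v) := rfl
    rw [h1, curryLeft_horForm_baseVol, Finset.smul_sum]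
    exact Finset.sum_congr rfl fun j _ => smul_smul _ _ _
  have hdcon := extDeriv_sum_smul hcon fun j =>
    hgd.hasFDerivAt.mul (hasFDerivAt_fst_comp_toTot hΞ hwU j)
  have hlie : lieDeriv (prolong k Ξ) L w = (fderiv ℝ g w (prolong k Ξ w)
      + g w * ∑ j, (fderiv ℝ Ξ (toTot w) (Pi.single j 1, 0)).1 j) •
        horForm k (baseVol (n + 1)) := by
    rw [lieDeriv, hdcon, contract, hdL, curryLeft_wedgeOne, curryLeft_horForm_baseVol, wedgeOne_sum]
    simp only [wedgeOne_smul, add_wedgeOne, smul_wedgeOne, sum_wedgeOne, wedgeOne_dx_baseVolContr,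
      smul_ite, smul_zero, Finset.sum_ite_eq', Finset.mem_univ, if_true,
      Finset.sum_add_distrib]
    have h1 (j : Fin (n + 1)) : (prolong k Ξ w).1 j = (Ξ (toTot w)).1 j := rfl
    simp only [h1, add_smul, mul_smul, Finset.sum_smul, Finset.mul_sum]
    abel
  have hval : fderiv ℝ g w (prolong k Ξ w)
      + g w * ∑ j, (fderiv ℝ Ξ (toTot w) (Pi.single j 1, 0)).1 j = (lieFun k hΞ f).1 u := by
    have h1 : fderiv ℝ g w (prolong k Ξ w) = fderiv ℝ (zeroExt f.1) u S := by
      rw [hdf, hX]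
      rfl
    have h2 (j : Fin (n + 1)) : ((totalDer W N).der j (xiFun hΞ j * f)).1 u
        = (Ξ (toTot (u : JetC (n + 1) m N))).1 j
            * fderiv ℝ (zeroExt f.1) u (totalVec N N j (u : JetC (n + 1) m N))
          + f.1 u * (fderiv ℝ Ξ (toTot (u : JetC (n + 1) m N)) (Pi.single j 1, 0)).1 j := by
      rw [Derivation.leibniz, ← totalDer_xiFun hΞ, ← totalDer_apply]
      rfl
    rw [h1, hS, map_add, fderiv_zeroExt_vertPart hΞ hk, lieFun]
    have hadd : ∀ (f g : JetFun W N), (f + g).1 u = f.1 u + g.1 u := fun _ _ => rfl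
    rw [hadd, smoothFun.sum_apply Finset.univ (fun j => (totalDer W N).der j (xiFun hΞ j * f)),
      Finset.sum_congr rfl fun j _ => h2 j, Finset.sum_add_distrib,
      map_sum, ← hfu, ← Finset.mul_sum, hw, toTot_jetProj]
    simp only [map_smul, smul_eq_mul]
    ring
  rw [pull, ← hw, hlie, hval]
  rfl

end LieDerivative

/-! ### Formal derivatives of one-forms, evaluated on vertical fields -/

section VerticalValues

variable {d m N : ℕ} {W : TopologicalSpace.Opens (TotC d m)}

/-- The components of a vertical vector field on `N`-jets. -/
abbrev VertComp (W : TopologicalSpace.Opens (TotC d m)) (N : ℕ) : Type :=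
  Fin m → Multiset (Fin d) → JetFun W N

/-- The vertical vector field on `N`-jets with given components. -/
def vertField (V : VertComp W N) (u : JetC d m N) : JetC d m N :=
  (0, fun σ I => zeroExt (V σ I.1).1 u)

/-- The components of the bracket of `d_i` with a vertical field. -/
def bracketComp (i : Fin d) (V : VertComp W N) : VertComp W N := fun σ J =>
  (totalDer W N).der i (V σ J) - V σ (i ::ₘ J)

/-- The smooth one-form `θ` on `k`-jets takes the value `Φ V` on the vertical field with
components `V`. -/
structure HasVertValue {k : ℕ} (θ : Form d m k 1) (Φ : VertComp W N → JetFun W N) : Prop where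
  smooth : ContDiffOn ℝ ∞ θ (jetDomain W k)
  value : ∀ (V : VertComp W N) (u : jetOpens W N), pull N θ u (fun _ => vertField V u) = (Φ V).1 u

/-- One-forms as functions with values in covectors. -/
def covec {k : ℕ} (θ : Form d m k 1) (u : JetC d m k) : JetC d m k →L[ℝ] ℝ :=
  (ContinuousAlternatingMap.ofSubsingletonLIE (𝕜 := ℝ) (F := ℝ) (0 : Fin 1)).symm (θ u)

theorem covec_apply {k : ℕ} (θ : Form d m k 1) (u v : JetC d m k) :
    covec θ u v = θ u (fun _ => v) := rfl

theorem contDiffOn_covec {k : ℕ} {θ : Form d m k 1} {s : Set (JetC d m k)}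
    (h : ContDiffOn ℝ ∞ θ s) : ContDiffOn ℝ ∞ (covec θ) s :=
  (ContinuousAlternatingMap.ofSubsingletonLIE (𝕜 := ℝ) (E := JetC d m k) (F := ℝ)
    (0 : Fin 1)).symm.contDiff.comp_contDiffOn h

/-- The formal derivative of a one-form, computed by the product rule. -/
theorem formalD_oneForm {k : ℕ} {θ : Form d m k 1} (hθ : ContDiffOn ℝ ∞ θ (jetDomain W k))
    (i : Fin d) {w : JetC d m (k + 1)} (hw : w ∈ jetDomain (W : Set (TotC d m)) (k + 1)) :
    formalD i θ w = ContinuousAlternatingMap.ofSubsingletonLIE (𝕜 := ℝ) (F := ℝ) (0 : Fin 1)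
      ((fderiv ℝ (covec θ) (jetProj (k + 1) k w) (totalVec (k + 1) k i w)).comp (jetProj (k + 1) k)
        + (covec θ (jetProj (k + 1) k w)).comp (totalLin (k + 1) k i)) := by
  set T := totalLin (m := m) (k + 1) k i with hT
  set v := totalVec (k + 1) k i w with hv
  have hd : DifferentiableAt ℝ (covec θ) (jetProj (k + 1) k w) :=
    ((contDiffOn_covec hθ).contDiffAt ((isOpen_jetDomain W.isOpen k).mem_nhds
      (jetProj_mem_jetDomain.2 hw))).differentiableAt (by simp)
  have h1 : HasDerivAt (fun t : ℝ => jetProj (k + 1) k w + t • v) v 0 := by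
    have := ((hasDerivAt_id (0 : ℝ)).smul_const v).const_add (jetProj (k + 1) k w)
    rwa [one_smul] at this
  have h2 : HasDerivAt (fun t : ℝ => covec θ (jetProj (k + 1) k w + t • v))
      (fderiv ℝ (covec θ) (jetProj (k + 1) k w) v) 0 := by
    have h3 : HasFDerivAt (covec θ) (fderiv ℝ (covec θ) (jetProj (k + 1) k w))
        (jetProj (k + 1) k w + (0 : ℝ) • v) := by
      rw [zero_smul, add_zero]
      exact hd.hasFDerivAt
    exact h3.comp_hasDerivAt 0 h1
  have h4 : HasDerivAt (fun t : ℝ => jetProj (m := m) (k + 1) k + t • T) T 0 := by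
    have := ((hasDerivAt_id (0 : ℝ)).smul_const T).const_add (jetProj (k + 1) k)
    rwa [one_smul] at this
  have h5 := h2.clm_comp h4
  have h6 := (ContinuousAlternatingMap.ofSubsingletonLIE (𝕜 := ℝ) (E := JetC d m (k + 1)) (F := ℝ)
    (0 : Fin 1)).toContinuousLinearEquiv.toContinuousLinearMap.hasFDerivAt.comp_hasDerivAt 0 h5
  rw [formalD, (hasFDerivAt_totalVec (k + 1) k i w).fderiv]
  refine Eq.trans (Eq.trans ?_ h6.deriv) ?_
  · congr 1
    funext t
    ext x
    exact congrArg (θ _) (funext fun a => by rw [Subsingleton.elim a 0])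
  · simp

theorem HasVertValue.formalD {k : ℕ} {θ : Form d m k 1} {Φ : VertComp W N → JetFun W N}
    (h : HasVertValue θ Φ) (hk : k + 1 ≤ N) (i : Fin d) :
    HasVertValue (formalD i θ)
      (fun V => (totalDer W N).der i (Φ V) - Φ (bracketComp i V)) where
  smooth := by
    refine ContDiffOn.congr ?_ fun w hw => formalD_oneForm h.smooth i hw
    have hproj : ContDiffOn ℝ ∞ (fun w : JetC d m (k + 1) => covec θ (jetProj (k + 1) k w))
        (jetDomain W (k + 1)) := (contDiffOn_covec h.smooth).comp
      (jetProj (k + 1) k).contDiff.contDiffOn fun _ hw => jetProj_mem_jetDomain.2 hw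
    have hder : ContDiffOn ℝ ∞ (fun w : JetC d m (k + 1) =>
        fderiv ℝ (covec θ) (jetProj (k + 1) k w) (totalVec (k + 1) k i w)) (jetDomain W (k + 1)) :=
      ((((contDiffOn_covec h.smooth).fderiv_of_isOpen (isOpen_jetDomain W.isOpen k)
        (by simp)).comp (jetProj (k + 1) k).contDiff.contDiffOn
          fun _ hw => jetProj_mem_jetDomain.2 hw)).clm_apply (contDiff_totalVec _ _ i).contDiffOn
    refine (ContinuousAlternatingMap.ofSubsingletonLIE (𝕜 := ℝ) (E := JetC d m (k + 1)) (F := ℝ)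
      (0 : Fin 1)).contDiff.comp_contDiffOn ?_
    exact (hder.clm_comp contDiffOn_const).add (hproj.clm_comp contDiffOn_const)
  value V u := by
    have hmem : jetProj N k (u : JetC d m N) ∈ jetDomain (W : Set (TotC d m)) k :=
      jetProj_mem_jetDomain.2 u.2
    have hd : DifferentiableAt ℝ (covec θ) (jetProj N k (u : JetC d m N)) :=
      ((contDiffOn_covec h.smooth).contDiffAt
        ((isOpen_jetDomain W.isOpen k).mem_nhds hmem)).differentiableAt (by simp)
    obtain ⟨DV, hV, hDV1, hDV2⟩ : ∃ DV : JetC d m N →L[ℝ] JetC d m N,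
        HasFDerivAt (vertField V) DV (u : JetC d m N) ∧ (∀ v, (DV v).1 = 0) ∧
          ∀ v σ (J : Multiset (Fin d)), J.card ≤ N →
            dy N σ J (DV v) = fderiv ℝ (zeroExt (V σ J).1) u v := by
      refine ⟨(0 : JetC d m N →L[ℝ] (Fin d → ℝ)).prod (ContinuousLinearMap.pi fun σ =>
          ContinuousLinearMap.pi fun I => fderiv ℝ (zeroExt (V σ I.1).1) u), ?_, fun _ => rfl,
          fun v σ J hJ => dy_apply hJ _⟩
      refine (hasFDerivAt_const _ _).prodMk (hasFDerivAt_pi.2 fun σ => hasFDerivAt_pi.2 fun I => ?_)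
      exact (smoothFun_differentiableAt (V σ I.1) u).hasFDerivAt
    have hlhs : pull N (SecondVariation.formalD i θ) u (fun _ => vertField V u)
        = fderiv ℝ (covec θ) (jetProj N k u) (totalVec N k i (u : JetC d m N))
            (jetProj N k (vertField V u))
          + covec θ (jetProj N k u) (totalLin (k + 1) k i (jetProj N (k + 1) (vertField V u))) := by
      rw [pull, formalD_oneForm h.smooth i (jetProj_mem_jetDomain.2 u.2),
        jetProj_jetProj (Nat.le_succ k), totalVec_jetProj le_rfl]
      change fderiv ℝ (covec θ) _ _ (jetProj (k + 1) k (jetProj N (k + 1) (vertField V u))) + _ = _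
      rw [jetProj_jetProj (Nat.le_succ k)]
      rfl
    have hrhs : ((totalDer W N).der i (Φ V)).1 u
        = fderiv ℝ (covec θ) (jetProj N k u) (totalVec N k i (u : JetC d m N))
            (jetProj N k (vertField V u))
          + covec θ (jetProj N k u) (jetProj N k
            (DV (totalVec N N i (u : JetC d m N)))) := by
      rw [totalDer_apply_of_eq (g := fun v => covec θ (jetProj N k v) (jetProj N k (vertField V v)))
        fun v => (h.value V v).symm]
      have h1 : HasFDerivAt (fun v => covec θ (jetProj N k v))
          ((fderiv ℝ (covec θ) (jetProj N k u)).comp (jetProj N k)) (u : JetC d m N) :=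
        HasFDerivAt.comp (u : JetC d m N) hd.hasFDerivAt (jetProj N k).hasFDerivAt
      have h2 : HasFDerivAt (fun v => jetProj N k (vertField V v)) _ (u : JetC d m N) :=
        (jetProj N k).hasFDerivAt.comp (u : JetC d m N) hV
      rw [(h1.clm_apply h2).fderiv, add_apply, ContinuousLinearMap.comp_apply,
        ContinuousLinearMap.flip_apply, ContinuousLinearMap.comp_apply,
        ContinuousLinearMap.comp_apply, jetProj_totalVec (show k ≤ N by omega), add_comm]
    have hbr : jetProj N k (DV (totalVec N N i (u : JetC d m N)))
        - jetProj N k (vertField (bracketComp i V) u)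
        = totalLin (k + 1) k i (jetProj N (k + 1) (vertField V u)) := by
      refine jetC_ext ?_ fun σ J hJ => ?_
      · rw [totalLin_fst, Prod.fst_sub, jetProj_fst, jetProj_fst, hDV1]
        exact sub_self _
      · rw [map_sub, dy_jetProj hJ, dy_jetProj hJ, dy_totalLin hJ,
          dy_jetProj (by rw [Multiset.card_cons]; omega), hDV2 _ σ J (by omega),
          dy_apply (by omega), dy_apply (by rw [Multiset.card_cons]; omega)]
        change fderiv ℝ (zeroExt (V σ J).1) u _ - zeroExt (bracketComp i V σ J).1 u
          = zeroExt (V σ (i ::ₘ J)).1 u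
        rw [zeroExt_apply _ u, zeroExt_apply _ u]
        change _ - (fderiv ℝ (zeroExt (V σ J).1) u _ - (V σ (i ::ₘ J)).1 u) = _
        ring
    have hsub : ∀ (f g : JetFun W N), (f - g).1 u = f.1 u - g.1 u := fun _ _ => rfl
    rw [hlhs, hsub, hrhs, ← hbr, map_sub, ← h.value (bracketComp i V) u]
    change _ = _ - covec θ (jetProj N k u) (jetProj N k (vertField (bracketComp i V) u))
    ring

/-- The values of the iterated formal derivatives of the one-form `∑ ζ_σ ω^σ` on a vertical field:
`d_i` is the Lie derivative along a vector field, so that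
`(d_i θ)(V) = d_i (θ(V)) - θ([d_i, V])`. -/
def iterVertValue (ζ : Fin m → JetFun W N) :
    (l : ℕ) → (Fin l → Fin d) → VertComp W N → JetFun W N
  | 0, _, V => ∑ σ, ζ σ * V σ 0
  | l + 1, I, V => (totalDer W N).der (I (Fin.last l)) (iterVertValue ζ l (fun a => I a.castSucc) V)
      - iterVertValue ζ l (fun a => I a.castSucc) (bracketComp (I (Fin.last l)) V)

theorem HasVertValue.formalDs {k : ℕ} {θ : Form d m k 1} {ζ : Fin m → JetFun W N}
    (h : HasVertValue θ fun V => ∑ σ, ζ σ * V σ 0) (l : ℕ) (I : Fin l → Fin d) (hk : k + l ≤ N) :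
    HasVertValue (formalDs l I θ) (iterVertValue ζ l I) := by
  induction l with
  | zero => exact h
  | succ l ih => exact (ih (fun a => I a.castSucc) (by omega)).formalD (by omega) (I (Fin.last l))

theorem iterVertValue_add (ζ ζ' : Fin m → JetFun W N) (l : ℕ) (I : Fin l → Fin d)
    (V : VertComp W N) :
    iterVertValue (fun σ => ζ σ + ζ' σ) l I V = iterVertValue ζ l I V + iterVertValue ζ' l I V := by
  induction l generalizing V with
  | zero => simp [iterVertValue, add_mul, Finset.sum_add_distrib]
  | succ l ih =>
    simp only [iterVertValue, ih, map_add]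
    abel

theorem iterVertValue_zero (l : ℕ) (I : Fin l → Fin d) (V : VertComp W N) :
    iterVertValue (fun _ => 0) l I V = 0 := by
  induction l generalizing V with
  | zero => simp [iterVertValue]
  | succ l ih => simp [iterVertValue, ih]

/-- The `l`-th formal derivatives only involve the components of order at most `l`. -/
theorem iterVertValue_eq_zero (ζ : Fin m → JetFun W N) (l : ℕ) (I : Fin l → Fin d)
    {V : VertComp W N} (hV : ∀ σ (J : Multiset (Fin d)), J.card ≤ l → V σ J = 0) :
    iterVertValue ζ l I V = 0 := by
  induction l generalizing V with
  | zero => exact Finset.sum_eq_zero fun σ _ => by rw [hV σ 0 (by simp), mul_zero]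
  | succ l ih =>
    rw [iterVertValue, ih _ fun σ J hJ => hV σ J (by omega), ih, map_zero, sub_zero]
    intro σ J hJ
    rw [bracketComp, hV σ J (by omega), hV σ _ (by rw [Multiset.card_cons]; omega), map_zero,
      sub_zero]

/-- On the prolongation `d_J Q^σ`, up to order `k`, of the characteristic, an iterated formal
derivative of order at most `k` takes the value `d_I (∑ ζ_σ Q^σ)`, because this field commutes
with the `d_i` up to order `k`. -/
theorem iterVertValue_prolonged (ζ Q : Fin m → JetFun W N) {k : ℕ} (l : ℕ) (I : Fin l → Fin d)
    (hl : l ≤ k) {V : VertComp W N}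
    (hV : ∀ σ (J : Multiset (Fin d)), J.card ≤ k → V σ J = (totalDer W N).iter J (Q σ)) :
    iterVertValue ζ l I V = (totalDer W N).iter (tupleIdx I) (∑ σ, Q σ * ζ σ) := by
  induction l with
  | zero =>
    have h0 : tupleIdx I = 0 := by simp [tupleIdx]
    rw [h0, CommutingDerivations.iter_zero, iterVertValue]
    refine Finset.sum_congr rfl fun σ _ => ?_
    rw [hV σ 0 (by simp), CommutingDerivations.iter_zero, mul_comm]
  | succ l ih =>
    rw [iterVertValue, ih _ (by omega), tupleIdx_succ_last, CommutingDerivations.iter_cons,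
      iterVertValue_eq_zero, sub_zero]
    intro σ J hJ
    rw [bracketComp, hV σ J (by omega), hV σ _ (by rw [Multiset.card_cons]; omega),
      CommutingDerivations.iter_cons, sub_self]

end VerticalValues

/-! ### Noether currents -/

section Currents

variable {n m N : ℕ} {W : TopologicalSpace.Opens (TotC (n + 1) m)}
  {Ξ : TotC (n + 1) m → TotC (n + 1) m}

/-- The components of the vertical part of the prolongation up to order `k`. -/
def prolongedComp (k : ℕ) (hΞ : IsProjectableOn W Ξ) : VertComp W N := fun σ J =>
  if J.card ≤ k then (totalDer W N).iter J (charFun hΞ σ) else 0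

theorem vertField_prolongedComp (hΞ : IsProjectableOn W Ξ) {k : ℕ} (hk : k + 1 ≤ N)
    (u : jetOpens W N) : vertField (prolongedComp k hΞ) (u : JetC (n + 1) m N)
      = vertPart N k Ξ u := by
  refine jetC_ext rfl fun σ J hJ => ?_
  rw [dy_vertPart hΞ hk σ hJ, dy_apply hJ]
  change zeroExt (prolongedComp k hΞ σ J).1 (u : JetC (n + 1) m N) = _
  rw [zeroExt_apply, prolongedComp]
  split_ifs <;> rfl

/-- The coefficients of the forms `ζ^I_σ` of the Lagrangian `f ds`. -/
def zetaFun (s : ℕ) (f : JetFun W N) (I : Multiset (Fin (n + 1))) (σ : Fin m) : JetFun W N :=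
  (totalDer W N).zeta s (fun J => idxWeight J • partialDer W N σ J f) I

theorem zetaFun_add (s : ℕ) (f g : JetFun W N) (I : Multiset (Fin (n + 1))) (σ : Fin m) :
    zetaFun s (f + g) I σ = zetaFun s f I σ + zetaFun s g I σ := by
  simp only [zetaFun, CommutingDerivations.zeta, map_add, smul_add, tupleSum_add_fun,
    Finset.sum_add_distrib]

theorem zetaFun_eq_zero (s : ℕ) {f : JetFun W N} {I : Multiset (Fin (n + 1))} {σ : Fin m}
    (h : ∀ J : Multiset (Fin (n + 1)), I.card ≤ J.card → partialDer W N σ J f = 0) :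
    zetaFun s f I σ = 0 := by
  rw [zetaFun, CommutingDerivations.zeta]
  exact Finset.sum_eq_zero fun l _ => tupleSum_eq_zero fun J _ => by
    rw [h _ (by rw [Multiset.card_add]; omega), smul_zero, map_zero, smul_zero]

theorem hasVolCoeff_zetaForm {s : ℕ} {L : Form (n + 1) m s (n + 1)} {f : JetFun W N}
    (hL : HasVolCoeff L f) (hs : 2 * s + 1 ≤ N) {I : Multiset (Fin (n + 1))} (hI : I.card ≤ s)
    (σ : Fin m) : HasVolCoeff (zetaForm (fun v => extDeriv L v) σ I) (zetaFun s f I σ) := by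
  refine HasCoeff.sum fun l hl => HasCoeff.sum fun J _ => HasCoeff.smul ?_ _
  rw [Finset.mem_range] at hl
  refine HasCoeff.pullBack ?_ (by omega)
  exact HasCoeff.formalDs (hasVolCoeff_etaForm_extDeriv hL (by omega) σ
    (by rw [Multiset.card_add, card_tupleIdx]; omega)) l J (by omega)

theorem contDiff_contactForm {d : ℕ} (k : ℕ) (σ : Fin m) (I : Multiset (Fin d)) :
    ContDiff ℝ ∞ (contactForm k σ I : JetC d m k → _) :=
  contDiff_const.sub (ContDiff.sum fun i _ => (dy k σ (i ::ₘ I)).contDiff.smul contDiff_const)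

theorem hasVertValue_chiForm {s : ℕ} {L : Form (n + 1) m s (n + 1)} {f : JetFun W N}
    (hL : HasVolCoeff L f) (hs : 2 * s + 1 ≤ N) {I : Multiset (Fin (n + 1))} (hI : I.card ≤ s) :
    HasVertValue (chiForm (fun v => extDeriv L v) I) fun V => ∑ σ, zetaFun s f I σ * V σ 0 where
  smooth := by
    refine ContDiffOn.sum fun σ _ => ContDiffOn.fun_smul ?_ ?_
    · exact contDiffOn_alternating_apply
        (HasCoeff.contDiffOn (hasVolCoeff_zetaForm hL hs hI σ) (by omega))
          fun _ => contDiffOn_const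
    · exact ((ContinuousAlternatingMap.ofSubsingletonLIE (𝕜 := ℝ) (F := ℝ)
        (0 : Fin 1)).contDiff.comp (contDiff_contactForm _ σ 0)).contDiffOn
  value V u := by
    have h1 (σ : Fin m) := congrArg (fun β => β fun a => partialX _ a)
      (HasCoeff.apply_jetProj (hasVolCoeff_zetaForm hL hs hI σ) (by omega) u)
    simp only [Finset.univ_unique, Finset.sum_const, Finset.card_singleton, one_smul,
      ContinuousAlternatingMap.smul_apply, horForm_baseVol_partialX, smul_eq_mul, mul_one] at h1
    rw [pull, ContinuousAlternatingMap.compContinuousLinearMap_apply, chiForm,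
      ContinuousAlternatingMap.sum_apply, smoothFun.sum_apply]
    refine Finset.sum_congr rfl fun σ _ => ?_
    rw [ContinuousAlternatingMap.smul_apply, h1]
    change _ * contactForm _ σ 0 (jetProj N _ (u : JetC (n + 1) m N))
      (jetProj N _ (vertField V (u : JetC (n + 1) m N))) = _ * (V σ 0).1 u
    rw [contactForm_apply_of_vertical _ _ _ rfl, dy_jetProj (by simp), dy_apply (by simp)]
    change _ * zeroExt (V σ 0).1 (u : JetC (n + 1) m N) = _
    rw [zeroExt_apply]

/-- The coefficients of the current `J^kΞ_V ⌋ p_{d_V L} + Ξ_H ⌋ L` of the Lagrangian `L = f ds`. -/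
def noetherFun (s k : ℕ) (hΞ : IsProjectableOn W Ξ) (f : JetFun W N) (j : Fin (n + 1)) :
    JetFun W N :=
  ∑ l ∈ Finset.range s, ∑ I : Fin l → Fin (n + 1),
    iterVertValue (zetaFun s f (j ::ₘ tupleIdx I)) l I (prolongedComp k hΞ) + xiFun hΞ j * f

theorem noetherFun_add (s k : ℕ) (hΞ : IsProjectableOn W Ξ) (f g : JetFun W N) (j : Fin (n + 1)) :
    noetherFun s k hΞ (f + g) j = noetherFun s k hΞ f j + noetherFun s k hΞ g j := by
  have h (I : Multiset (Fin (n + 1))) : zetaFun s (f + g) I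
      = fun σ => zetaFun s f I σ + zetaFun s g I σ := funext (zetaFun_add s f g I)
  simp only [noetherFun, h, iterVertValue_add, Finset.sum_add_distrib, mul_add]
  abel

/-- If the Lagrangian has order at most `k + 1`, the truncation of the prolongation at order `k`
does not affect the current. -/
theorem noetherFun_eq (s : ℕ) {k : ℕ} (hΞ : IsProjectableOn W Ξ) {f : JetFun W N}
    (hf : ∀ σ (J : Multiset (Fin (n + 1))), k + 1 < J.card → partialDer W N σ J f = 0)
    (j : Fin (n + 1)) :
    noetherFun s k hΞ f j = ∑ σ, ∑ l ∈ Finset.range s, tupleSum l (fun I =>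
      (totalDer W N).iter I (charFun hΞ σ * zetaFun s f (j ::ₘ I) σ)) + xiFun hΞ j * f := by
  rw [noetherFun, Finset.sum_comm]
  congr 1
  refine Finset.sum_congr rfl fun l _ => ?_
  rw [← tupleSum_sum]
  refine Finset.sum_congr rfl fun I _ => ?_
  change _ = ∑ σ, (totalDer W N).iter (tupleIdx I) (charFun hΞ σ * zetaFun s f (j ::ₘ tupleIdx I) σ)
  rw [← map_sum]
  by_cases hl : l ≤ k
  · exact iterVertValue_prolonged _ _ l I hl fun σ J hJ => if_pos hJ
  · have h0 : zetaFun s f (j ::ₘ tupleIdx I) = fun _ => 0 := funext fun σ =>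
      zetaFun_eq_zero s fun J hJ => hf σ J (by
        rw [Multiset.card_cons, card_tupleIdx] at hJ
        omega)
    rw [h0, iterVertValue_zero]
    simp

/-- The Noether current of the Lagrangian `f ds` has the coefficients `noetherFun`. -/
theorem hasCoeff_noetherCurrent (hΞ : IsProjectableOn W Ξ) {s k : ℕ}
    {L : Form (n + 1) m s (n + 1)} {f : JetFun W N} (hL : HasVolCoeff L f) (hs : 2 * s + 1 ≤ N)
    (hk : k + 1 ≤ 2 * s) :
    HasCoeff (noetherCurrent k Ξ L) (baseVolContr n) (noetherFun s k hΞ f) := by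
  have hver : HasCoeff (N := N) (W := W) (contract (vertPart (2 * s) k Ξ) (momentum L))
      (baseVolContr n) (fun j => ∑ l ∈ Finset.range s, ∑ I : Fin l → Fin (n + 1),
        iterVertValue (zetaFun s f (j ::ₘ tupleIdx I)) l I (prolongedComp k hΞ)) := by
    intro u
    rw [pull_contract (vertPart_jetProj hk (u : JetC (n + 1) m N) (by omega))]
    have h1 : pull N (momentum L) u = ∑ l ∈ Finset.range s, ∑ I : Fin l → Fin (n + 1),
        ∑ j : Fin (n + 1), wedgeOne (covec (pull N (formalDs l I
          (chiForm (fun v => extDeriv L v) (j ::ₘ tupleIdx I)))) u)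
            (horForm N (baseVolContr n j)) := by
      rw [pull, momentum, residual, neg_neg, sum_comp_jetProj]
      refine Finset.sum_congr rfl fun l hl => ?_
      rw [sum_comp_jetProj]
      refine Finset.sum_congr rfl fun I _ => ?_
      rw [sum_comp_jetProj]
      refine Finset.sum_congr rfl fun j _ => ?_
      rw [wedgeOne_comp_jetProj, volFormContr_eq, horForm_comp_jetProj]
      congr 1
      rw [Finset.mem_range] at hl
      have h2 := congrFun (pull_pull (K := 2 * s) (N := N)
        (by rw [Multiset.card_cons, card_tupleIdx]; omega)
        (formalDs l I (chiForm (fun v => extDeriv L v) (j ::ₘ tupleIdx I)))) u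
      rw [covec, ← h2]
      rfl
    have hc : ∀ {ι : Type} (t : Finset ι) (τ : ι → (JetC (n + 1) m N) [⋀^Fin (n + 1)]→L[ℝ] ℝ)
        (v : JetC (n + 1) m N), (∑ a ∈ t, τ a).curryLeft v = ∑ a ∈ t, (τ a).curryLeft v :=
      fun t τ v => by
        ext w
        simp [ContinuousAlternatingMap.curryLeft_apply_apply]
    rw [h1]
    simp only [hc, smoothFun.sum_apply, Finset.sum_smul]
    rw [Finset.sum_comm' (t' := Finset.range s) (s' := fun _ => Finset.univ) (by simp)]
    refine Finset.sum_congr rfl fun l hl => ?_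
    rw [Finset.sum_comm]
    refine Finset.sum_congr rfl fun j _ => Finset.sum_congr rfl fun I _ => ?_
    rw [Finset.mem_range] at hl
    rw [curryLeft_wedgeOne_horForm _ _ rfl, covec_apply,
      ← vertField_prolongedComp hΞ (by omega : k + 1 ≤ N)]
    congr 1
    have hcard : (j ::ₘ tupleIdx I).card = l + 1 := by rw [Multiset.card_cons, card_tupleIdx]
    exact ((hasVertValue_chiForm hL hs (by omega)).formalDs l I (by omega)).value _ u
  have hhor : HasCoeff (N := N) (W := W) (contract (horPart (2 * s) Ξ) (pull (2 * s) L))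
      (baseVolContr n) (fun j => xiFun hΞ j * f) := by
    intro u
    have h1 := HasCoeff.apply_jetProj (HasCoeff.pullBack hL (K := 2 * s) (by omega)) (by omega) u
    have h2 (j : Fin (n + 1)) : (horPart (2 * s) Ξ (jetProj N (2 * s) (u : JetC (n + 1) m N))).1 j
        = (Ξ (toTot (u : JetC (n + 1) m N))).1 j := by
      simp [horPart, Prod.fst_sum, totalVec_fst, Finset.sum_apply, Pi.single_apply, toTot_jetProj]
    have h3 : contract (horPart (2 * s) Ξ) (pull (2 * s) L) (jetProj N (2 * s) u)
        = ∑ j, ((xiFun hΞ j * f).1 u) • horForm (2 * s) (baseVolContr n j) := by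
      rw [contract, h1]
      have h4 : ∀ v : JetC (n + 1) m (2 * s),
          (∑ _a : Unit, f.1 u • horForm (2 * s) (baseVol (n + 1))).curryLeft v
          = f.1 u • (horForm (2 * s) (baseVol (n + 1))).curryLeft v := fun v => by
        ext w
        simp [ContinuousAlternatingMap.curryLeft_apply_apply]
      rw [h4, curryLeft_horForm_baseVol, Finset.smul_sum]
      refine Finset.sum_congr rfl fun j _ => ?_
      rw [smul_smul, h2, mul_comm (f.1 u)]
      rfl
    rw [pull, h3, sum_comp_jetProj]
    rfl
  exact hver.add hhor

/-- The horizontal differential of `∑ g_j ds_j` is the divergence of the `g_j`. -/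
theorem HasCoeff.hasVolCoeff_dH {k : ℕ} {θ : Form (n + 1) m k n} {g : Fin (n + 1) → JetFun W N}
    (h : HasCoeff θ (baseVolContr n) g) (hk : k + 1 ≤ N) :
    HasVolCoeff (dH θ) (∑ j, (totalDer W N).der j (g j)) := by
  rw [hasVolCoeff_iff]
  intro u
  have h1 : pull N (dH θ) u = ∑ i, wedgeOne (dx N i) (pull N (SecondVariation.formalD i θ) u) := by
    rw [pull, dH, sum_comp_jetProj]
    refine Finset.sum_congr rfl fun i _ => ?_
    rw [wedgeOne_comp_jetProj]
    rfl
  rw [h1, smoothFun.sum_apply, Finset.sum_smul]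
  refine Finset.sum_congr rfl fun i _ => ?_
  rw [h.formalD hk i u, wedgeOne_sum]
  simp [wedgeOne_smul, wedgeOne_dx_baseVolContr]

theorem lieFun_of_le {s M : ℕ} (h : s ≤ M) (hΞ : IsProjectableOn W Ξ) {f : JetFun W N}
    (hf : ∀ σ (I : Multiset (Fin (n + 1))), s < I.card → partialDer W N σ I f = 0) :
    lieFun M hΞ f = lieFun s hΞ f := by
  rw [lieFun, lieFun]
  congr 1
  refine Finset.sum_congr rfl fun σ _ =>
    (Finset.sum_subset (Finset.range_subset_range.2 (by omega)) fun l _ hl => ?_).symm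
  rw [Finset.mem_range] at hl
  exact tupleSum_eq_zero fun I hI => by rw [hf σ I (by omega), smul_zero, mul_zero]

/-- The first variation formula, for the coefficients. -/
theorem lieFun_eq (s : ℕ) {k : ℕ} (hΞ : IsProjectableOn W Ξ) {f : JetFun W N}
    (hf : ∀ σ (J : Multiset (Fin (n + 1))), k + 1 < J.card → partialDer W N σ J f = 0) :
    lieFun s hΞ f = ∑ σ, charFun hΞ σ * eulerFun s f σ
      + ∑ j, (totalDer W N).der j (noetherFun s k hΞ f j) := by
  have h1 (σ : Fin m) := (totalDer W N).sum_tupleSum_iter_mul_eq s (charFun hΞ σ)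
    (fun I => idxWeight I • partialDer W N σ I f)
  rw [lieFun, Finset.sum_congr rfl fun σ _ => h1 σ, Finset.sum_add_distrib,
    Finset.sum_comm (γ := Fin m)]
  simp only [noetherFun_eq s hΞ hf, map_add, map_sum, Finset.sum_add_distrib]
  rw [add_left_comm, add_comm (∑ j, (totalDer W N).der j (xiFun hΞ j * f))]
  rfl

end Currents

/-! ### Projectable vector fields in fibered charts -/

section Charts

variable {d m : ℕ} {X Y : Type*}
    [TopologicalSpace X] [ChartedSpace (Fin d → ℝ) X]
    [TopologicalSpace Y] [ChartedSpace (TotC d m) Y] [IsManifold 𝓘(ℝ, TotC d m) ∞ Y]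
    {π : Y → X}

theorem contDiffOn_rep (Ξ : ProjectableField d m π) (c : FiberedChart (n := d) (m := m) π) :
    ContDiffOn ℝ ∞ (Ξ.rep c) c.total.target := by
  have h1 : ContMDiffOn 𝓘(ℝ, TotC d m) 𝓘(ℝ, TotC d m) ∞ c.total c.total.source :=
    contMDiffOn_of_mem_maximalAtlas c.total_mem
  have h2 : ContMDiffOn 𝓘(ℝ, TotC d m) 𝓘(ℝ, TotC d m) ∞ c.total.symm c.total.target :=
    contMDiffOn_symm_of_mem_maximalAtlas c.total_mem
  have h3 := h1.contMDiffOn_tangentMapWithin (m := ∞) (by simp) c.total.open_source.uniqueMDiffOn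
  have h4 := h3.comp (Ξ.smooth.comp_contMDiffOn h2) fun w hw => c.total.map_target hw
  refine (contMDiffOn_vectorSpace_iff_contDiffOn (𝕜 := ℝ) (E := TotC d m) (n := ∞)
    (V := Ξ.rep c) (s := c.total.target)).1 ?_
  refine h4.congr fun w hw => ?_
  have h5 : tangentMapWithin 𝓘(ℝ, TotC d m) 𝓘(ℝ, TotC d m) c.total c.total.source
      ⟨c.total.symm w, Ξ.toFun (c.total.symm w)⟩ = ⟨c.total (c.total.symm w), Ξ.rep c w⟩ := by
    rw [tangentMapWithin, mfderivWithin_of_isOpen c.total.open_source (c.total.map_target hw)]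
    rfl
  refine Eq.trans ?_ h5.symm
  rw [c.total.right_inv hw]

/-- The base components of a projectable vector field only depend on the base point. -/
theorem exists_rep_fst_eq (hπ : IsFiberedManifold (n := d) (m := m) π) (Ξ : ProjectableField d m π)
    (c : FiberedChart (n := d) (m := m) π) :
    ∃ H : (Fin d → ℝ) → (Fin d → ℝ), ∀ w ∈ c.total.target, (Ξ.rep c w).1 = H w.1 := by
  obtain ⟨ξ, hξ⟩ := Ξ.projectable
  set F : X → (Fin d → ℝ) := fun x =>
    mfderiv 𝓘(ℝ, Fin d → ℝ) 𝓘(ℝ, Fin d → ℝ) c.base x (ξ x) with hF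
  refine ⟨fun x => F (c.base.symm x), fun w hw => ?_⟩
  set y := c.total.symm w with hy
  have hys : y ∈ c.total.source := c.total.map_target hw
  have hb : π y ∈ c.base.source := c.base_source ▸ ⟨y, hys, rfl⟩
  have hwy : w.1 = c.base (π y) := by
    rw [← c.fst_total y hys, hy, c.total.right_inv hw]
  have hinv : c.base.symm w.1 = π y := by rw [hwy, c.base.left_inv hb]
  have ht : MDifferentiableAt 𝓘(ℝ, TotC d m) 𝓘(ℝ, TotC d m) c.total y :=
    ((contMDiffOn_of_mem_maximalAtlas (n := ∞) c.total_mem).contMDiffAt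
      (c.total.open_source.mem_nhds hys)).mdifferentiableAt (by simp)
  have hbd : MDifferentiableAt 𝓘(ℝ, Fin d → ℝ) 𝓘(ℝ, Fin d → ℝ) c.base (π y) :=
    ((contMDiffOn_of_mem_maximalAtlas (n := ∞) c.base_mem).contMDiffAt
      (c.base.open_source.mem_nhds hb)).mdifferentiableAt (by simp)
  have hπd : MDifferentiableAt 𝓘(ℝ, TotC d m) 𝓘(ℝ, Fin d → ℝ) π y :=
    hπ.smooth.mdifferentiableAt (by simp)
  have hfst : HasMFDerivAt 𝓘(ℝ, TotC d m) 𝓘(ℝ, Fin d → ℝ) (Prod.fst : TotC d m → Fin d → ℝ)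
      (c.total y) (ContinuousLinearMap.fst ℝ (Fin d → ℝ) (Fin m → ℝ)) :=
    hasFDerivAt_fst.hasMFDerivAt
  have h1 := hfst.comp y ht.hasMFDerivAt
  have h2 := hbd.hasMFDerivAt.comp y hπd.hasMFDerivAt
  have h3 : (Prod.fst ∘ c.total : Y → Fin d → ℝ) =ᶠ[𝓝 y] c.base ∘ π := by
    filter_upwards [c.total.open_source.mem_nhds hys] with z hz using c.fst_total z hz
  have h4 := hasMFDerivAt_unique (h1.congr_of_eventuallyEq h3.symm) h2
  have h5 := congrArg (fun A : TotC d m →L[ℝ] (Fin d → ℝ) => A (Ξ.toFun y)) h4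
  refine Eq.trans (b := mfderiv 𝓘(ℝ, Fin d → ℝ) 𝓘(ℝ, Fin d → ℝ) c.base (π y)
    (mfderiv 𝓘(ℝ, TotC d m) 𝓘(ℝ, Fin d → ℝ) π y (Ξ.toFun y))) h5 ?_
  rw [hξ y]
  exact congrArg F hinv.symm

theorem isProjectableOn_rep (hπ : IsFiberedManifold (n := d) (m := m) π)
    (Ξ : ProjectableField d m π) (c : FiberedChart (n := d) (m := m) π) :
    IsProjectableOn ⟨c.total.target, c.total.open_target⟩ (Ξ.rep c) where
  smooth := contDiffOn_rep Ξ c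
  fderiv_fst w hw v hv := by
    obtain ⟨H, hH⟩ := exists_rep_fst_eq hπ Ξ c
    have hd : DifferentiableAt ℝ (Ξ.rep c) w :=
      ((contDiffOn_rep Ξ c).contDiffAt (c.total.open_target.mem_nhds hw)).differentiableAt (by simp)
    have h1 : HasDerivAt (fun t : ℝ => w + t • v) v 0 := by
      have := ((hasDerivAt_id (0 : ℝ)).smul_const v).const_add w
      rwa [one_smul] at this
    have h2 : HasFDerivAt (fun z => (Ξ.rep c z).1)
        ((ContinuousLinearMap.fst ℝ (Fin d → ℝ) (Fin m → ℝ)).comp (fderiv ℝ (Ξ.rep c) w))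
        (w + (0 : ℝ) • v) := by
      rw [zero_smul, add_zero]
      exact hd.hasFDerivAt.fst
    have h3 := h2.comp_hasDerivAt 0 h1
    have hmem : ∀ᶠ t in 𝓝 (0 : ℝ), w + t • v ∈ c.total.target := by
      have hc : ContinuousAt (fun t : ℝ => w + t • v) 0 := by fun_prop
      exact hc.eventually_mem (c.total.open_target.mem_nhds (by simpa using hw))
    refine h3.unique ((hasDerivAt_const (0 : ℝ) (H w.1)).congr_of_eventuallyEq ?_)
    filter_upwards [hmem] with t ht
    rw [Function.comp_apply, hH _ ht, Prod.fst_add, Prod.smul_fst, hv, smul_zero, add_zero]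

end Charts

/-! ### The second variation of a Lagrangian -/

section Main

variable {n m N : ℕ} {W : TopologicalSpace.Opens (TotC (n + 1) m)}
  {Ξ : TotC (n + 1) m → TotC (n + 1) m}

/-- The current coefficients of a Lagrangian of order `s` do not involve jet coordinates of order
exceeding `2 s`. -/
theorem noetherFun_partialDer_eq_zero (hΞ : IsProjectableOn W Ξ) {s k : ℕ}
    {L : Form (n + 1) m s (n + 1)} {f : JetFun W N} (hL : HasVolCoeff L f) (hs : 2 * s + 1 ≤ N)
    (hk : k + 1 ≤ 2 * s) (j : Fin (n + 1)) (σ : Fin m) {I : Multiset (Fin (n + 1))}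
    (hI : 2 * s < I.card) : partialDer W N σ I (noetherFun s k hΞ f j) = 0 := by
  refine HasCoeff.partialDer_eq_zero (hasCoeff_noetherCurrent hΞ hL hs hk) j
    (fun β => wedgeOne (dx N j) β fun i => partialX N i) (fun c => ?_) σ hI
  rw [wedgeOne_sum]
  simp [wedgeOne_smul, wedgeOne_dx_baseVolContr, horForm_baseVol_partialX]

theorem hasVolCoeff_contract_eulerLagrange (hΞ : IsProjectableOn W Ξ) {K : ℕ}
    {θ : Form (n + 1) m K (n + 2)} {e : Fin m → JetFun W N} (hθ : IsSourceForm θ e)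
    (hK : 1 ≤ K) (hKN : K ≤ N) :
    HasVolCoeff (contract (vertPart K 0 Ξ) θ) (∑ σ, charFun hΞ σ * e σ) :=
  hθ.hasVolCoeff_contract (V := vertPart N 0 Ξ) (fun u => vertPart_jetProj hK _ hKN)
    (fun _ => rfl) fun u σ => by
      rw [dy_vertPart hΞ (by omega) σ (by simp), if_pos (by simp)]
      simp

/-- Horizontal forms of degree `dim X` with the same coefficient agree. -/
theorem HasVolCoeff.eq_of_hasVolCoeff {k : ℕ} {θ θ' : Form (n + 1) m k (n + 1)} {f : JetFun W N}
    (h : HasVolCoeff θ f) (h' : HasVolCoeff θ' f) (hk : k ≤ N) {u : JetC (n + 1) m k}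
    (hu : u ∈ jetDomain W k) : θ u = θ' u := by
  rw [HasCoeff.apply h hk hu, HasCoeff.apply h' hk hu]

/-- The second variation formula, for a form and projectable vector fields in the coordinates of a
fibered chart. -/
theorem exists_secondVariation {ξ₁ ξ₂ : TotC (n + 1) m → TotC (n + 1) m}
    (h₁ : IsProjectableOn W ξ₁) (h₂ : IsProjectableOn W ξ₂) {r : ℕ} {ρ : Form (n + 1) m r (n + 1)}
    (hρ : ContDiffOn ℝ ∞ ρ (jetDomain W r)) :
    ∃ L₂ : Form (n + 1) m (2 * r + 1) (n + 1),
      ContDiffOn ℝ ∞ L₂ (jetDomain W (2 * r + 1)) ∧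
      (∀ u ∈ jetDomain (W : Set (TotC (n + 1) m)) (2 * (r + 1) + 1),
        pull (2 * (r + 1) + 1) L₂ u = dH (noetherCurrent (r + 1) ξ₁ (horizontal ρ)) u) ∧
      ∀ k, r + 1 ≤ k → k ≤ 2 * r + 1 →
        ∀ u ∈ jetDomain (W : Set (TotC (n + 1) m)) (2 * (2 * r + 1) + 1),
          pull (2 * (2 * r + 1) + 1)
              (lieDeriv (prolong (r + 1) ξ₂) (lieDeriv (prolong (r + 1) ξ₁) (horizontal ρ))) u =
            contract (vertPart (2 * (2 * r + 1) + 1) 0 ξ₂)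
                (eulerLagrange (contract (vertPart (2 * r + 1) 0 ξ₁) (eulerLagrange ρ))) u
              + dH (noetherCurrent k ξ₂ (contract (vertPart (2 * r + 1) 0 ξ₁) (eulerLagrange ρ))) u
              + dH (noetherCurrent k ξ₂ L₂) u := by
  set N := 2 * (2 * r + 1) + 1 with hN
  set f : JetFun W N := lagrFun ρ hρ with hf
  have hL : HasVolCoeff (horizontal ρ) f := hasVolCoeff_horizontal ρ hρ (by omega)
  set f₁ : JetFun W N := ∑ σ, charFun h₁ σ * eulerFun (r + 1) f σ with hf₁
  have hL₁ : HasVolCoeff (contract (vertPart (2 * r + 1) 0 ξ₁) (eulerLagrange ρ)) f₁ :=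
    hasVolCoeff_contract_eulerLagrange h₁ (isSourceForm_eulerLagrange ρ hρ (by omega))
      (by omega) (by omega)
  set f' : JetFun W N := lieFun (r + 1) h₁ f with hf'
  have hL' : HasVolCoeff (lieDeriv (prolong (r + 1) ξ₁) (horizontal ρ)) f' :=
    HasVolCoeff.lieDeriv_prolong h₁ (by omega) hL
  -- the divergence term in the first variation formula is the Lie derivative minus the Euler term
  set L₂ : Form (n + 1) m (2 * r + 1) (n + 1) := fun u =>
    pull (2 * r + 1) (lieDeriv (prolong (r + 1) ξ₁) (horizontal ρ)) u
      + (-1 : ℝ) • contract (vertPart (2 * r + 1) 0 ξ₁) (eulerLagrange ρ) u with hL₂def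
  set f₂ : JetFun W N := f' + (-1 : ℝ) • f₁ with hf₂
  have hL₂ : HasVolCoeff L₂ f₂ := (HasCoeff.pullBack hL' (by omega)).add (HasCoeff.smul hL₁ (-1))
  have hsum : f' = f₁ + f₂ := by
    rw [hf₂, neg_one_smul]
    abel
  have hfirst : f₂ = ∑ j, (totalDer W N).der j (noetherFun (r + 1) (r + 1) h₁ f j) := by
    have h3 := lieFun_eq (k := r + 1) (r + 1) h₁ (f := f) fun σ J hJ =>
      HasVolCoeff.partialDer_eq_zero hL σ (by omega)
    rw [← hf', ← hf₁, hsum] at h3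
    exact add_left_cancel h3
  -- `f₂` is a divergence, and annihilated by the Euler operator
  have heuler (σ : Fin m) : eulerFun (2 * r + 1) f₂ σ = 0 := by
    rw [← eulerFun_of_le (M := 2 * r + 3) (by omega) fun I hI =>
      HasVolCoeff.partialDer_eq_zero hL₂ σ hI, hfirst]
    exact eulerFun_divergence (by omega) _ σ fun j I hI =>
      noetherFun_partialDer_eq_zero h₁ hL (by omega) (by omega) j σ (by omega)
  refine ⟨L₂, HasCoeff.contDiffOn hL₂ (by omega), fun u hu => ?_, fun k hk hk' u hu => ?_⟩
  · refine HasVolCoeff.eq_of_hasVolCoeff (f := f₂) (HasCoeff.pullBack hL₂ (by omega)) ?_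
      (by omega) hu
    rw [hfirst]
    exact (hasCoeff_noetherCurrent h₁ hL (by omega) (by omega)).hasVolCoeff_dH (by omega)
  · have hlhs : HasVolCoeff (lieDeriv (prolong (r + 1) ξ₂)
        (lieDeriv (prolong (r + 1) ξ₁) (horizontal ρ))) (lieFun (r + 1) h₂ f') :=
      HasVolCoeff.lieDeriv_prolong h₂ (by omega) hL'
    have hE := hasVolCoeff_contract_eulerLagrange h₂
      (isSourceForm_eulerLagrange_of_hasVolCoeff hL₁ (by omega)) (K := N) (by omega) le_rfl
    have hd₁ := (hasCoeff_noetherCurrent h₂ hL₁ (k := k) (by omega) (by omega)).hasVolCoeff_dH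
      (by omega)
    have hd₂ := (hasCoeff_noetherCurrent h₂ hL₂ (k := k) (by omega) (by omega)).hasVolCoeff_dH
      (by omega)
    have hf'0 (σ : Fin m) (I : Multiset (Fin (n + 1))) (hI : r + 1 < I.card) :
        partialDer W N σ I f' = 0 := HasVolCoeff.partialDer_eq_zero hL' σ hI
    refine HasVolCoeff.eq_of_hasVolCoeff (HasCoeff.pullBack hlhs (by omega))
      ((HasCoeff.add (hE.add hd₁) hd₂).congr_coeff fun _ => ?_) le_rfl hu
    -- only the sum `f₁ + f₂` has order `r + 1 ≤ k + 1`, so that `f₁` and `f₂` are treated together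
    rw [← lieFun_of_le (show r + 1 ≤ 2 * r + 1 by omega) h₂ hf'0,
      lieFun_eq (k := k) (2 * r + 1) h₂ fun σ J hJ => hf'0 σ J (by omega)]
    have h3 (σ : Fin m) : eulerFun (2 * r + 1) f' σ = eulerFun (2 * r + 1) f₁ σ := by
      rw [← sub_eq_zero, ← eulerFun_sub, hsum, add_sub_cancel_left, heuler]
    have h4 (j : Fin (n + 1)) : noetherFun (2 * r + 1) k h₂ f' j
        = noetherFun (2 * r + 1) k h₂ f₁ j + noetherFun (2 * r + 1) k h₂ f₂ j := by
      rw [hsum, noetherFun_add]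
    simp only [h3, h4, map_add, Finset.sum_add_distrib]
    rw [add_assoc]

end Main

end SecondVariation
end

open SecondVariation in
theorem mainTheorem4 {n m : ℕ} {X Y : Type*}
    [TopologicalSpace X] [ChartedSpace (Fin (n + 1) → ℝ) X]
    [IsManifold 𝓘(ℝ, Fin (n + 1) → ℝ) ∞ X]
    [TopologicalSpace Y] [ChartedSpace (TotC (n + 1) m) Y]
    [IsManifold 𝓘(ℝ, TotC (n + 1) m) ∞ Y]
    (π : Y → X) (hπ : IsFiberedManifold (n := n + 1) (m := m) π)
    (r : ℕ) (ρ : JetForm (n + 1) m π r (n + 1))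
    (Ξ₁ Ξ₂ : ProjectableField (n + 1) m π)
    (c : FiberedChart (n := n + 1) (m := m) π) :
    let W : Set (TotC (n + 1) m) := c.total.target
    let ξ₁ : TotC (n + 1) m → TotC (n + 1) m := Ξ₁.rep c
    let ξ₂ : TotC (n + 1) m → TotC (n + 1) m := Ξ₂.rep c
    -- the Lagrangian `hρ`
    let L : Form (n + 1) m (r + 1) (n + 1) := horizontal (ρ.rep c)
    -- the Lagrangian `Ξ_{1,V} ⌋ E(hρ)`
    let L₁ : Form (n + 1) m (2 * r + 1) (n + 1) :=
      contract (vertPart (2 * r + 1) 0 ξ₁) (eulerLagrange (ρ.rep c))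
    -- the Lagrangian `d_H ε_{Ξ₁}(hρ)`, as a form on `(2r+1)`-jets
    ∃ L₂ : Form (n + 1) m (2 * r + 1) (n + 1),
      ContDiffOn ℝ ∞ L₂ (jetDomain W (2 * r + 1)) ∧
      (∀ u ∈ jetDomain W (2 * (r + 1) + 1),
        pull (2 * (r + 1) + 1) L₂ u = dH (noetherCurrent (r + 1) ξ₁ L) u) ∧
      ∀ k, r + 1 ≤ k → k ≤ 2 * r + 1 →
        ∀ u ∈ jetDomain W (2 * (2 * r + 1) + 1),
          pull (2 * (2 * r + 1) + 1)
              (lieDeriv (prolong (r + 1) ξ₂) (lieDeriv (prolong (r + 1) ξ₁) L)) u =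
            contract (vertPart (2 * (2 * r + 1) + 1) 0 ξ₂) (eulerLagrange L₁) u
              + dH (noetherCurrent k ξ₂ L₁) u
              + dH (noetherCurrent k ξ₂ L₂) u :=
  exists_secondVariation (W := ⟨c.total.target, c.total.open_target⟩)
    (isProjectableOn_rep hπ Ξ₁ c) (isProjectableOn_rep hπ Ξ₂ c) (ρ.smooth c)
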